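/- Conventions. $\log$ is the natural logarithm and $\log_+ x := \max\{1,\log x\}$. $X \preceq Y$ means that $Y-X$ is symmetric positive semidefinite (PSD). A collection $\mathcal A=\{A_1,\dots,A_r\}$ is an indexed family, and $\mathcal A_T := \{A_i : i\in T\}$ for $T\subseteq[r]$. For a finite collection $\mathcal A$ of real PSD matrices and $\alpha\ge 0$, the connectivity parameter $N(\alpha;\mathcal A)$ is the smallest integer $k$ such that every set $S$ of indices with $|S|\ge k$ contains an $i$ with $\alpha A_i \preceq \sum_{j\in S\setminus\{i\}} A_j$ (thus $1 \le N(\alpha;\mathcal A)\le r+1$). For $\varepsilon\in[0,1)$ let $\alpha_\varepsilon\in[0,1]$ be the unique number with $\alpha_\varepsilon(1+\alpha_\varepsilon)=\frac{1-\varepsilon}{1+\varepsilon}$, and let $N^*_\varepsilon(\mathcal A) := N(\alpha_\varepsilon;\mathcal A)$. Theorem. There is an absolute constant $C>0$ such that the following holds. Let $\mathcal A=\{A_1,\dots,A_r\}\subset\mathbb R^{n\times n}$ be a collection of PSD matrices, let $\varepsilon\in[0,1)$, let $T\subseteq[r]$ be such that the matrices $A_i$, $i\in T$, are not all $0$, and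 let $m$ be the rank of $\sum_{i\in T}A_i$. Then there is a map $\mu:T\to[0,\infty)$ with $$(1-\varepsilon)\sum_{i\in T}A_i \preceq \sum_{i\in T}\mu_iA_i \preceq (1+\varepsilon)\sum_{i\in T}A_i$$ and, where $\operatorname{supp}(\mu):=\{i\in T:\mu_i\ne 0\}$, $$\varepsilon^2|\operatorname{supp}(\mu)| \le C\,(\log_+|T|)(\log_+ m)\min_{\alpha\in(0,1]}\frac{N(\alpha;\mathcal A_T)}{\alpha} \le C\,(\log_+ r)(\log_+ n)\min_{\alpha\in(0,1]}\frac{N(\alpha;\mathcal A)}{\alpha},$$ and, if $\varepsilon\le 0.99$, also $$\varepsilon^2|\operatorname{supp}(\mu)| \le C\,(\log_+ r)(\log_+ n)\,N^*_\varepsilon(\mathcal A).$$ Furthermore, there is a randomized algorithm which, on input $(A_1,\dots,A_r,\varepsilon,T)$ as above, runs in time polynomial in $r$ and $n$ and, with probability at least $1-\frac1{n+2}$, outputs a map $\mu$ with all these properties (with the same constant $C$). Here an algorithm is a single finite program, independent of the input, for a random access machine with real-valued arrays, in which exact arithmetic operations and comparisons of real numbers, operations on natural-number index registers, and fair coin flips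 each take one unit of time; the only constants in the program are rational, there is no floor function, and the time bound holds for all outcomes of the coin flips. -/

import Mathlib

open scoped MatrixOrder

namespace PSDSparsification

/-- The logarithm convention of all the `O(log t)` bounds below: `log₊ x = max {1, log x}`,
with the natural logarithm. -/
noncomputable def logPlus (x : ℝ) : ℝ := max 1 (Real.log x)

/-! ### The connectivity parameter

A collection `A₁, …, A_r` is an indexed family (repetitions are allowed); `≤` between matrices is
the Loewner order, `X ≤ Y ↔ (Y - X).PosSemidef`. -/

section Connectivity

variable {ι : Type*} [DecidableEq ι] {n : ℕ}

/-- Every index set `S` with `|S| ≥ k` has an `i ∈ S` with `α A_i ⪯ ∑_{j ∈ S \ {i}} A_j`. -/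
def IsThreshold (α : ℝ) (A : ι → Matrix (Fin n) (Fin n) ℝ) (k : ℕ) : Prop :=
  ∀ S : Finset ι, k ≤ S.card → ∃ i ∈ S, α • A i ≤ ∑ j ∈ S.erase i, A j

/-- The connectivity parameter `N(α; A)`: the smallest threshold. The value `r + 1` always is
a threshold (for want of index sets of that size), so that the minimum is over a non-empty set. -/
noncomputable def connParam (α : ℝ) (A : ι → Matrix (Fin n) (Fin n) ℝ) : ℕ :=
  sInf {k : ℕ | IsThreshold α A k}

theorem isThreshold_card_add_one [Fintype ι] (α : ℝ) (A : ι → Matrix (Fin n) (Fin n) ℝ) :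
    IsThreshold α A (Fintype.card ι + 1) := by
  intro S hS
  have := S.card_le_univ
  omega

theorem isThreshold_connParam [Fintype ι] (α : ℝ) (A : ι → Matrix (Fin n) (Fin n) ℝ) :
    IsThreshold α A (connParam α A) :=
  Nat.sInf_mem (s := {k : ℕ | IsThreshold α A k}) ⟨_, isThreshold_card_add_one α A⟩

theorem connParam_le {α : ℝ} {A : ι → Matrix (Fin n) (Fin n) ℝ} {k : ℕ}
    (h : IsThreshold α A k) : connParam α A ≤ k :=
  Nat.sInf_le h

theorem connParam_pos [Fintype ι] (α : ℝ) (A : ι → Matrix (Fin n) (Fin n) ℝ) : 0 < connParam α A := by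
  rcases Nat.eq_zero_or_pos (connParam α A) with h | h
  · have := isThreshold_connParam α A ∅ (by simp [h])
    simp at this
  · exact h

/-- `min_{α ∈ (0,1]} N(α; A) / α`. The infimum is attained, see `isLeast_minRatio`. -/
noncomputable def minRatio (A : ι → Matrix (Fin n) (Fin n) ℝ) : ℝ :=
  sInf ((fun α : ℝ => (connParam α A : ℝ) / α) '' Set.Ioc 0 1)

theorem isClosed_isThreshold (A : ι → Matrix (Fin n) (Fin n) ℝ) (k : ℕ) :
    IsClosed {α : ℝ | IsThreshold α A k} := by
  have h1 : {α : ℝ | IsThreshold α A k} = ⋂ S : Finset ι, ⋂ _ : k ≤ S.card, ⋃ i ∈ S,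
      {α : ℝ | α • A i ≤ ∑ j ∈ S.erase i, A j} := by
    ext α
    simp [IsThreshold]
  rw [h1]
  refine isClosed_iInter fun S => isClosed_iInter fun _ => ?_
  refine S.finite_toSet.isClosed_biUnion fun i _ => ?_
  have h2 : {α : ℝ | α • A i ≤ ∑ j ∈ S.erase i, A j} =
      {α : ℝ | (∑ j ∈ S.erase i, A j - α • A i).IsHermitian} ∩ ⋂ x : Fin n → ℝ,
      {α : ℝ | 0 ≤ star x ⬝ᵥ ((∑ j ∈ S.erase i, A j - α • A i).mulVec x)} := by
    ext α
    simp [Matrix.le_iff, Matrix.posSemidef_iff_dotProduct_mulVec]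
  rw [h2]
  refine IsClosed.inter ?_ (isClosed_iInter fun x => ?_)
  · exact isClosed_eq (by fun_prop) (by fun_prop)
  · exact isClosed_le (by fun_prop) (by fun_prop)

theorem isLeast_minRatio [Fintype ι] (A : ι → Matrix (Fin n) (Fin n) ℝ) :
    IsLeast ((fun α : ℝ => (connParam α A : ℝ) / α) '' Set.Ioc 0 1) (minRatio A) := by
  have hex : ∃ α ∈ Set.Ioc (0 : ℝ) 1, ∀ β ∈ Set.Ioc (0 : ℝ) 1,
      (connParam α A : ℝ) / α ≤ (connParam β A : ℝ) / β := by
    have hN1 : (1 : ℝ) ≤ connParam 1 A := by exact_mod_cast connParam_pos 1 A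
    set δ : ℝ := 1 / connParam 1 A with hδ
    have hδ0 : 0 < δ := by positivity
    have hδ1 : δ ≤ 1 := by rw [hδ, div_le_one (by positivity)]; exact hN1
    let G : Set (ℝ × ℕ) := ⋃ k ∈ Finset.range (Fintype.card ι + 2),
      (Set.Icc δ 1 ∩ {α : ℝ | IsThreshold α A k}) ×ˢ {k}
    have hG : IsCompact G := by
      refine (Finset.finite_toSet _).isCompact_biUnion fun k _ => ?_
      exact (isCompact_Icc.inter_right (isClosed_isThreshold A k)).prod isCompact_singleton
    have hmem : ∀ β ∈ Set.Icc δ 1, (β, connParam β A) ∈ G := by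
      intro β hβ
      have h2 := connParam_le (isThreshold_card_add_one β A)
      simp only [G, Set.mem_iUnion, Finset.mem_range]
      exact ⟨connParam β A, by omega, ⟨hβ, isThreshold_connParam β A⟩, rfl⟩
    have hcont : ContinuousOn (fun p : ℝ × ℕ => (p.2 : ℝ) / p.1) G := by
      refine ContinuousOn.div (continuous_of_discreteTopology.comp continuous_snd).continuousOn
        (by fun_prop) ?_
      rintro ⟨α, k⟩ hp
      simp only [G, Set.mem_iUnion] at hp
      obtain ⟨_, _, hp, _⟩ := hp
      exact (hδ0.trans_le hp.1.1).ne'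
    obtain ⟨⟨α, k⟩, hp, hmin⟩ := hG.exists_isMinOn ⟨_, hmem 1 ⟨hδ1, le_rfl⟩⟩ hcont
    have hp' := hp
    simp only [G, Set.mem_iUnion] at hp'
    obtain ⟨k', _, ⟨hα, hthr⟩, hk⟩ := hp'
    obtain rfl : k = k' := hk
    have hα0 : 0 < α := hδ0.trans_le hα.1
    have key : ∀ β ∈ Set.Icc δ 1, (connParam α A : ℝ) / α ≤ (connParam β A : ℝ) / β := by
      intro β hβ
      have h3 : (k : ℝ) / α ≤ (connParam β A : ℝ) / β := hmin (hmem β hβ)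
      have h4 : (connParam α A : ℝ) ≤ k := by exact_mod_cast connParam_le hthr
      refine le_trans ?_ h3
      gcongr
    refine ⟨α, ⟨hα0, hα.2⟩, fun β hβ => ?_⟩
    rcases le_or_gt δ β with h | h
    · exact key β ⟨h, hβ.2⟩
    · refine (key 1 ⟨hδ1, le_rfl⟩).trans ?_
      have h5 : (1 : ℝ) ≤ connParam β A := by exact_mod_cast connParam_pos β A
      have hβ0 := hβ.1
      rw [div_one, le_div_iff₀ hβ0]
      have h6 : (connParam 1 A : ℝ) * β ≤ connParam 1 A * δ := by gcongr
      have h7 : (connParam 1 A : ℝ) * δ = 1 := by rw [hδ]; field_simp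
      linarith
  obtain ⟨α, hα, hmin⟩ := hex
  have hl : IsLeast ((fun α : ℝ => (connParam α A : ℝ) / α) '' Set.Ioc 0 1)
      ((connParam α A : ℝ) / α) := by
    refine ⟨⟨α, hα, rfl⟩, ?_⟩
    rintro _ ⟨β, hβ, rfl⟩
    exact hmin β hβ
  unfold minRatio
  rw [hl.csInf_eq]
  exact hl

/-- `α_ε`, the number in `[0,1]` with `α_ε (1 + α_ε) = (1 - ε) / (1 + ε)`. -/
noncomputable def alphaEps (ε : ℝ) : ℝ :=
  (Real.sqrt (1 + 4 * ((1 - ε) / (1 + ε))) - 1) / 2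

theorem alphaEps_iff {ε : ℝ} (h0 : 0 ≤ ε) (h1 : ε < 1) (a : ℝ) :
    a = alphaEps ε ↔ a ∈ Set.Icc (0 : ℝ) 1 ∧ a * (1 + a) = (1 - ε) / (1 + ε) := by
  have hq0 : 0 ≤ (1 - ε) / (1 + ε) := div_nonneg (by linarith) (by linarith)
  have hq1 : (1 - ε) / (1 + ε) ≤ 1 := by rw [div_le_one (by linarith)]; linarith
  unfold alphaEps
  generalize (1 - ε) / (1 + ε) = q at hq0 hq1
  have hs := Real.sq_sqrt (show 0 ≤ 1 + 4 * q by linarith)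
  have hs0 := Real.sqrt_nonneg (1 + 4 * q)
  constructor
  · rintro rfl
    exact ⟨⟨by nlinarith, by nlinarith⟩, by nlinarith⟩
  · rintro ⟨⟨ha0, ha1⟩, ha⟩
    have : Real.sqrt (1 + 4 * q) = 1 + 2 * a := by
      rw [show 1 + 4 * q = (1 + 2 * a) ^ 2 by linarith [ha, sq a, mul_self_nonneg a,
        show (1 + 2 * a) ^ 2 = 1 + 4 * (a * (1 + a)) by ring]]
      exact Real.sqrt_sq (by linarith)
    rw [this]
    ring

/-- The connectivity threshold `N*_ε(A) = N(α_ε; A)`. -/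
noncomputable def connThreshold (ε : ℝ) (A : ι → Matrix (Fin n) (Fin n) ℝ) : ℕ :=
  connParam (alphaEps ε) A

end Connectivity

section Sparsifier

variable {r n : ℕ}

/-- `(log |T|) (log m) min_{α ∈ (0,1]} N(α; {A_i : i ∈ T}) / α`, where `m` is the rank of
`∑_{i ∈ T} A_i`. -/
noncomputable def localBound (A : Fin r → Matrix (Fin n) (Fin n) ℝ) (T : Finset (Fin r)) : ℝ :=
  logPlus T.card * logPlus (∑ i ∈ T, A i).rank * minRatio (fun i : T => A i)

/-- `(log r) (log n) min_{α ∈ (0,1]} N(α; A) / α`. -/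
noncomputable def globalBound (A : Fin r → Matrix (Fin n) (Fin n) ℝ) : ℝ :=
  logPlus r * logPlus n * minRatio A

/-- The weights `μ : T → [0, ∞)` give an `ε`-sparsifier of `∑_{i ∈ T} A_i`, whose support obeys the
three size bounds with the constant `C`. A bound `|supp μ| ≤ C ε⁻² X` is written
`ε² |supp μ| ≤ C X`, which is the same for `ε > 0` and void (as `ε⁻² = ∞`) for `ε = 0`. -/
structure GoodWeights (C : ℝ) (A : Fin r → Matrix (Fin n) (Fin n) ℝ) (ε : ℝ)
    (T : Finset (Fin r)) (μ : T → ℝ) : Prop where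
  nonneg : ∀ i, 0 ≤ μ i
  lower : (1 - ε) • ∑ i : T, A i ≤ ∑ i : T, μ i • A i
  upper : ∑ i : T, μ i • A i ≤ (1 + ε) • ∑ i : T, A i
  card_local : ε ^ 2 * (Function.support μ).ncard ≤ C * localBound A T
  card_global : ε ^ 2 * (Function.support μ).ncard ≤ C * globalBound A
  card_threshold : ε ≤ 0.99 →
    ε ^ 2 * (Function.support μ).ncard ≤ C * (logPlus r * logPlus n * connThreshold ε A)

end Sparsifier

/-! ### The machine model

A randomized real random access machine: exact real arithmetic and comparisons at unit cost
(no rounding and no floor function), rational constants only, natural-number registers that serve as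
loop counters and array indices, fair coin flips. A program is a finite piece of code that does not
depend on the input, built with branches and counted loops (so that it always halts). -/

namespace RealRAM

/-- `reg x` is the natural-number register `x`, and `arr a i j k` is the entry `(i, j, k)` of the
array `a` of real numbers; `steps` counts the elementary operations executed so far. -/
structure State where
  reg : ℕ → ℕ
  arr : ℕ → ℕ → ℕ → ℕ → ℝ
  steps : ℕ

/-- Index expressions; `sub` is truncated subtraction. -/
inductive NExpr where
  | const (k : ℕ)
  | reg (x : ℕ)
  | add (e f : NExpr)
  | sub (e f : NExpr)

def NExpr.eval (s : State) : NExpr → ℕ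
  | const k => k
  | reg x => s.reg x
  | add e f => e.eval s + f.eval s
  | sub e f => e.eval s - f.eval s

/-- The number of elementary operations. -/
def NExpr.cost : NExpr → ℕ
  | const _ => 1
  | reg _ => 1
  | add e f => e.cost + f.cost + 1
  | sub e f => e.cost + f.cost + 1

/-- Real expressions; `get a i j k` reads an array entry. -/
inductive RExpr where
  | const (q : ℚ)
  | get (a : ℕ) (i j k : NExpr)
  | add (e f : RExpr)
  | sub (e f : RExpr)
  | mul (e f : RExpr)
  | div (e f : RExpr)

/-- Division by zero returns zero. -/
noncomputable def RExpr.eval (s : State) : RExpr → ℝ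
  | const q => (q : ℝ)
  | get a i j k => s.arr a (i.eval s) (j.eval s) (k.eval s)
  | add e f => e.eval s + f.eval s
  | sub e f => e.eval s - f.eval s
  | mul e f => e.eval s * f.eval s
  | div e f => e.eval s / f.eval s

/-- The number of elementary operations. -/
def RExpr.cost : RExpr → ℕ
  | const _ => 1
  | get _ i j k => i.cost + j.cost + k.cost + 1
  | add e f => e.cost + f.cost + 1
  | sub e f => e.cost + f.cost + 1
  | mul e f => e.cost + f.cost + 1
  | div e f => e.cost + f.cost + 1

/-- Branching conditions. -/
inductive Test where
  | natLE (e f : NExpr)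
  | realLE (e f : RExpr)
  | not (t : Test)
  | and (t u : Test)

def Test.Holds (s : State) : Test → Prop
  | natLE e f => e.eval s ≤ f.eval s
  | realLE e f => e.eval s ≤ f.eval s
  | not t => ¬ t.Holds s
  | and t u => t.Holds s ∧ u.Holds s

/-- The number of elementary operations. -/
def Test.cost : Test → ℕ
  | natLE e f => e.cost + f.cost + 1
  | realLE e f => e.cost + f.cost + 1
  | not t => t.cost + 1
  | and t u => t.cost + u.cost + 1

/-- Programs. `flip x` puts a fair random bit into register `x`, and `loop x e c` runs `c` for the
values `0, 1, …, e - 1` of the register `x`, where `e` is evaluated once, on entry. -/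
inductive Program where
  | skip
  | seq (c d : Program)
  | setReg (x : ℕ) (e : NExpr)
  | setArr (a : ℕ) (i j k : NExpr) (e : RExpr)
  | flip (x : ℕ)
  | ite (t : Test) (c d : Program)
  | loop (x : ℕ) (e : NExpr) (c : Program)

def State.tick (s : State) (k : ℕ) : State := { s with steps := s.steps + k }

def State.putReg (s : State) (x v : ℕ) : State :=
  { s with reg := fun y => if y = x then v else s.reg y }

def State.putArr (s : State) (a i j k : ℕ) (v : ℝ) : State :=
  { s with arr := fun a' i' j' k' =>
      if a' = a ∧ i' = i ∧ j' = j ∧ k' = k then v else s.arr a' i' j' k' }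

open Classical in
/-- The distribution of the final state (with its step count) of a run from the state `s`. Each
assignment, flip, test and loop iteration costs one step, and so does each operation in the
expressions that it evaluates. -/
noncomputable def Program.run : Program → State → PMF State
  | skip, s => PMF.pure (s.tick 1)
  | seq c d, s => (c.run s).bind fun s' => d.run s'
  | setReg x e, s => PMF.pure ((s.putReg x (e.eval s)).tick (e.cost + 1))
  | setArr a i j k e, s =>
      PMF.pure ((s.putArr a (i.eval s) (j.eval s) (k.eval s) (e.eval s)).tick
        (i.cost + j.cost + k.cost + e.cost + 1))
  | flip x, s =>
      (PMF.uniformOfFintype (Fin 2)).bind fun b => PMF.pure ((s.putReg x (b : ℕ)).tick 1)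
  | ite t c d, s =>
      if t.Holds s then c.run (s.tick (t.cost + 1)) else d.run (s.tick (t.cost + 1))
  | loop x e c, s =>
      Nat.rec (motive := fun _ => PMF State) (PMF.pure (s.tick (e.cost + 1)))
        (fun i p => p.bind fun s' => c.run ((s'.putReg x i).tick 1)) (e.eval s)

end RealRAM

section Encoding

variable {r n : ℕ}

/-- The input `(A, ε, T)`: the registers `0` and `1` hold `r` and `n`, the array `0` holds `ε` at
`(0, 0, 0)`, the array `1` holds the entry `A_i(j, k)` at `(i, j, k)`, the array `2` holds at
`(i, 0, 0)` a one if `i ∈ T`, and everything else is zero. -/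
noncomputable def inputState (A : Fin r → Matrix (Fin n) (Fin n) ℝ) (ε : ℝ)
    (T : Finset (Fin r)) : RealRAM.State where
  reg x := if x = 0 then r else if x = 1 then n else 0
  arr a i j k :=
    if a = 0 ∧ i = 0 ∧ j = 0 ∧ k = 0 then ε
    else if a = 1 then
      if h : i < r ∧ j < n ∧ k < n then A ⟨i, h.1⟩ ⟨j, h.2.1⟩ ⟨k, h.2.2⟩ else 0
    else if a = 2 ∧ j = 0 ∧ k = 0 then
      if h : i < r then if (⟨i, h⟩ : Fin r) ∈ T then 1 else 0 else 0
    else 0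
  steps := 0

/-- The weight `μ_i` is read off from the array `3` at `(i, 0, 0)`. -/
def outputWeights (T : Finset (Fin r)) (s : RealRAM.State) : T → ℝ :=
  fun i => s.arr 3 ((i : Fin r) : ℕ) 0 0

end Encoding

end PSDSparsification

/-! Let M be the sum of the A_i over T, of rank m. A factorization M = F Fᵀ of full rank writes A_i
= F B_i Fᵀ with ∑ B_i = 1 in dimension m (`exists_normalization`), so the identity has to be
approximated. Sampling suggests keeping i with a probability q_i proportional to an estimate of
‖B_i‖ and giving it the weight 1/q_i; about ∑ q_i indices survive.

Total importance. Fix α and N = N(α). Colour a set S at random with k ≈ |S|/(2N) colours. In each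
colour class fewer than N indices violate α A_i ≤ (rest of the class), so some i in S does so for at
most half of the colourings. Averaging over the other colourings gives A_i ≤ O(N/(α|S|)) M
(`exists_le_smul_sum`). Removing such indices one at a time bounds ∑ ‖B_i‖ by a harmonic sum, hence
by O(log|T| · N/α) (`sum_le_minRatio`).

Concentration. The potentials are traces of p-th powers with p of order ε⁻² log m, which need only
field operations. The base matrices are normalized combinations of (8/ε)·1 with the weights already
chosen and the remaining expectation, inflated by 1 + ε/4 for the upper potential and deflated by 1
- ε/4 for the lower one. Klein's inequality and `trace_add_pow_mul_le` show that the margin ε/4 pays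
for the second order error of one random choice (`round_upper`, `round_lower`). Hence the two
potentials plus a normalized estimator of the support size do not increase on average, and taking
the better option for every index is a deterministic procedure (`RoundInv.step`). The total starts
at no more than 3m and ends below (1 + ε²/32)^p, which confines all eigenvalues and bounds the
support by 3 ∑ q_i (`RoundInv.result`).

Computation. No eigenvalue or root is computed. A generalized inverse H of M arises from rank-one
updates (`IsPartialGenInv.succ`); then m = tr(MH), traces of powers of normalized matrices are
traces of powers of UH (`trace_conj_pow`), and ‖B_i‖ is found up to a factor 2 as a ratio of
consecutive trace powers (`importance_conj`). The exponent p is a power of two found by repeated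
squaring; if r + n squarings do not suffice, ε is so small that all weights equal to one meet the
bounds (`goodWeights_one`). The program flips no coin, so it succeeds with probability one. -/

namespace PSDSparsification

/-! ### Trace inequalities for powers of symmetric matrices. -/

section TraceInequalities

open Matrix

variable {ι : Type*} [Fintype ι] [DecidableEq ι]

theorem exists_diagonalization {Z : Matrix ι ι ℝ} (hZ : Z.IsHermitian) :
    ∃ (U : Matrix ι ι ℝ) (z : ι → ℝ), Uᵀ * U = 1 ∧ U * Uᵀ = 1 ∧ Z = U * diagonal z * Uᵀ := by
  refine ⟨hZ.eigenvectorUnitary, hZ.eigenvalues, ?_, ?_, ?_⟩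
  · simpa [star_eq_conjTranspose] using Unitary.coe_star_mul_self hZ.eigenvectorUnitary
  · simpa [star_eq_conjTranspose] using Unitary.coe_mul_star_self hZ.eigenvectorUnitary
  · have := hZ.spectral_theorem
    rw [Unitary.conjStarAlgAut_apply] at this
    simpa [star_eq_conjTranspose, Function.comp_def] using this

theorem pow_conj_diagonal {U : Matrix ι ι ℝ} {z : ι → ℝ} (h1 : Uᵀ * U = 1) (h2 : U * Uᵀ = 1)
    (a : ℕ) : (U * diagonal z * Uᵀ) ^ a = U * diagonal (fun i => z i ^ a) * Uᵀ := by
  induction a with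
  | zero => simp [h2]
  | succ a ih =>
    rw [pow_succ, ih]
    calc U * diagonal (fun i => z i ^ a) * Uᵀ * (U * diagonal z * Uᵀ)
        = U * diagonal (fun i => z i ^ a) * (Uᵀ * U) * diagonal z * Uᵀ := by
          simp only [Matrix.mul_assoc]
      _ = _ := by
          rw [h1, Matrix.mul_one, Matrix.mul_assoc U, diagonal_mul_diagonal]
          simp only [pow_succ]

theorem le_eigenvalue {U : Matrix ι ι ℝ} {z : ι → ℝ} (h1 : Uᵀ * U = 1) {c : ℝ}
    (h : c • (1 : Matrix ι ι ℝ) ≤ U * diagonal z * Uᵀ) (i : ι) : c ≤ z i := by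
  have h3 := (le_iff.1 h).conjTranspose_mul_mul_same U
  have h4 : Uᴴ * (U * diagonal z * Uᵀ - c • (1 : Matrix ι ι ℝ)) * U
      = diagonal z - c • (1 : Matrix ι ι ℝ) := by
    rw [conjTranspose_eq_transpose_of_trivial, Matrix.mul_sub, Matrix.sub_mul]
    congr 1
    · calc Uᵀ * (U * diagonal z * Uᵀ) * U = (Uᵀ * U) * diagonal z * (Uᵀ * U) := by
            simp only [Matrix.mul_assoc]
        _ = _ := by rw [h1]; simp
    · simp [h1]
  rw [h4] at h3
  have := h3.diag_nonneg (i := i)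
  simpa using this

theorem eigenvalue_le {U : Matrix ι ι ℝ} {z : ι → ℝ} (h1 : Uᵀ * U = 1) {c : ℝ}
    (h : U * diagonal z * Uᵀ ≤ c • (1 : Matrix ι ι ℝ)) (i : ι) : z i ≤ c := by
  have h5 : (-c) • (1 : Matrix ι ι ℝ) ≤ U * diagonal (-z) * Uᵀ := by
    have : U * diagonal (-z) * Uᵀ = - (U * diagonal z * Uᵀ) := by
      have h : diagonal (-z) = -diagonal z := by ext i j; by_cases h : i = j <;> simp [h]
      rw [h, Matrix.mul_neg, Matrix.neg_mul]
    rw [this, neg_smul]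
    exact neg_le_neg h
  have := le_eigenvalue h1 h5 i
  simp at this
  exact this

/-- The joint spectral weights of two Hermitian matrices `Z` and `Y` with respect to `X`. -/
theorem exists_trace_weights {Z Y : Matrix ι ι ℝ} (hZ : Z.IsHermitian) (hY : Y.IsHermitian)
    (X : Matrix ι ι ℝ) :
    ∃ (z y : ι → ℝ) (o : ι → ι → ℝ), (∀ i j, 0 ≤ o i j) ∧
      (∀ c : ℝ, c • 1 ≤ Z → ∀ i, c ≤ z i) ∧ (∀ c : ℝ, c • 1 ≤ Y → ∀ i, c ≤ y i) ∧
      ∀ a b : ℕ, (Z ^ a * X * Y ^ b * Xᵀ).trace = ∑ i, ∑ j, o i j * (z i ^ a * y j ^ b) := by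
  obtain ⟨U, z, hU1, hU2, rfl⟩ := exists_diagonalization hZ
  obtain ⟨W, y, hW1, hW2, rfl⟩ := exists_diagonalization hY
  -- The weights are the squared entries of X between the two eigenbases. They do not depend on the
  -- exponents, so scalar inequalities between monomials in z and y transfer term by term to traces.
  refine ⟨z, y, fun i j => ((Uᵀ * X * W) i j) ^ 2, fun _ _ => sq_nonneg _,
    fun c h => le_eigenvalue hU1 h, fun c h => le_eigenvalue hW1 h, fun a b => ?_⟩
  rw [pow_conj_diagonal hU1 hU2, pow_conj_diagonal hW1 hW2]
  set K := Uᵀ * X * W with hK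
  have h1 : (U * diagonal (fun i => z i ^ a) * Uᵀ * X * (W * diagonal (fun i => y i ^ b) * Wᵀ) * Xᵀ)
      = U * (diagonal (fun i => z i ^ a) * K * diagonal (fun i => y i ^ b) * (Wᵀ * Xᵀ)) := by
    simp only [hK, Matrix.mul_assoc]
  rw [h1, trace_mul_comm]
  have h2 : diagonal (fun i => z i ^ a) * K * diagonal (fun i => y i ^ b) * (Wᵀ * Xᵀ) * U
      = diagonal (fun i => z i ^ a) * K * diagonal (fun i => y i ^ b) * Kᵀ := by
    simp only [hK, Matrix.mul_assoc, transpose_mul, transpose_transpose]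
  rw [h2]
  simp only [trace, diag_apply, Matrix.mul_apply (M := diagonal (fun i => z i ^ a) * K *
    diagonal (fun i => y i ^ b)), mul_diagonal, diagonal_mul, transpose_apply]
  refine Finset.sum_congr rfl fun i _ => Finset.sum_congr rfl fun j _ => ?_
  ring

theorem trace_mul_nonneg {P Q : Matrix ι ι ℝ} (hP : 0 ≤ P) (hQ : 0 ≤ Q) : 0 ≤ (P * Q).trace := by
  obtain ⟨U, z, hU1, hU2, rfl⟩ := exists_diagonalization (nonneg_iff_posSemidef.1 hQ).isHermitian
  have hz : ∀ i, 0 ≤ z i := le_eigenvalue hU1 (by simpa using hQ)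
  have h1 : (P * (U * diagonal z * Uᵀ)).trace = (Uᵀ * P * U * diagonal z).trace := by
    rw [← Matrix.mul_assoc, trace_mul_comm]
    simp only [Matrix.mul_assoc]
  rw [h1]
  have h2 := (nonneg_iff_posSemidef.1 hP).conjTranspose_mul_mul_same U
  rw [conjTranspose_eq_transpose_of_trivial] at h2
  simp only [trace, diag_apply, mul_diagonal]
  exact Finset.sum_nonneg fun i _ => mul_nonneg h2.diag_nonneg (hz i)

theorem trace_mul_le_trace_mul {P X Y : Matrix ι ι ℝ} (hP : 0 ≤ P) (h : X ≤ Y) :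
    (P * X).trace ≤ (P * Y).trace := by
  have := trace_mul_nonneg hP (sub_nonneg.2 h)
  rw [Matrix.mul_sub, trace_sub] at this
  linarith

theorem pow_matrix_nonneg {P : Matrix ι ι ℝ} (hP : 0 ≤ P) (k : ℕ) : 0 ≤ P ^ k :=
  nonneg_iff_posSemidef.2 ((nonneg_iff_posSemidef.1 hP).pow k)

theorem isHermitian_of_nonneg {ι : Type*} [Fintype ι] {P : Matrix ι ι ℝ} (hP : 0 ≤ P) : P.IsHermitian :=
  (nonneg_iff_posSemidef.1 hP).isHermitian

/-- Scalar tangent line inequality for powers. -/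
theorem pow_tangent_le {v w : ℝ} (hv : 0 ≤ v) (hw : 0 ≤ w) (p : ℕ) :
    v ^ (p + 1) + (p + 1) * (v ^ p * (w - v)) ≤ w ^ (p + 1) := by
  induction p with
  | zero => simp
  | succ p ih =>
    have h2 : 0 ≤ (w ^ (p + 1) - v ^ (p + 1)) * (w - v) := by
      rcases le_total v w with h | h
      · exact mul_nonneg (sub_nonneg.2 (pow_le_pow_left₀ hv h _)) (sub_nonneg.2 h)
      · exact mul_nonneg_of_nonpos_of_nonpos (sub_nonpos.2 (pow_le_pow_left₀ hw h _))
          (sub_nonpos.2 h)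
    have h3 := mul_le_mul_of_nonneg_left ih hv
    have e1 : w ^ (p + 1 + 1) = w ^ (p + 1) * w := pow_succ _ _
    have e2 : v ^ (p + 1 + 1) = v ^ p * v * v := by ring
    have e3 : v ^ (p + 1) = v ^ p * v := pow_succ _ _
    rw [e1, e2, e3]
    rw [e3] at h2 h3
    push_cast
    generalize v ^ p = s at *
    generalize w ^ (p + 1) = t at *
    nlinarith

/-- Klein's inequality for the powers. -/
theorem trace_pow_tangent_le {V W : Matrix ι ι ℝ} (hV : 0 ≤ V) (hW : 0 ≤ W) (p : ℕ) :
    (V ^ (p + 1)).trace + (p + 1) * (V ^ p * (W - V)).trace ≤ (W ^ (p + 1)).trace := by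
  -- With X = 1 the weights compare the eigenbases of V and W, and the claim becomes the scalar
  -- tangent inequality for every pair of eigenvalues.
  obtain ⟨v, w, o, ho, hv, hw, h⟩ := exists_trace_weights (isHermitian_of_nonneg hV)
    (isHermitian_of_nonneg hW) 1
  have hv0 := hv 0 (by simpa using hV)
  have hw0 := hw 0 (by simpa using hW)
  have h1 := h (p + 1) 0
  have h2 := h p 1
  have h3 := h 0 (p + 1)
  simp only [Matrix.mul_one, pow_zero, Matrix.one_mul, transpose_one, pow_one] at h1 h2 h3
  rw [Matrix.mul_sub, trace_sub, ← pow_succ, h1, h2, h3]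
  simp only [mul_sub, Finset.mul_sum, ← Finset.sum_sub_distrib, ← Finset.sum_add_distrib]
  refine Finset.sum_le_sum fun i _ => Finset.sum_le_sum fun j _ => ?_
  have := mul_le_mul_of_nonneg_left (pow_tangent_le (hv0 i) (hw0 j) p) (ho i j)
  have e3 : v i ^ (p + 1) = v i ^ p * v i := pow_succ _ _
  rw [e3] at this ⊢
  linarith

theorem trace_pow_mono {V W : Matrix ι ι ℝ} (hV : 0 ≤ V) (hVW : V ≤ W) (p : ℕ) :
    (V ^ (p + 1)).trace ≤ (W ^ (p + 1)).trace := by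
  have h1 := trace_pow_tangent_le hV (hV.trans hVW) p
  have h2 := trace_mul_nonneg (pow_matrix_nonneg hV p) (sub_nonneg.2 hVW)
  have : 0 ≤ ((p : ℝ) + 1) * (V ^ p * (W - V)).trace := by positivity
  linarith

/-- Weighted arithmetic-geometric mean inequality with weights a/(a+b) and b/(a+b), cleared of
denominators so that a = b = 0 is allowed. -/
theorem pow_mul_pow_le {z y : ℝ} (hz : 0 ≤ z) (hy : 0 ≤ y) (a b : ℕ) :
    (a + b) * (z ^ a * y ^ b) ≤ a * z ^ (a + b) + b * y ^ (a + b) := by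
  rcases Nat.eq_zero_or_pos (a + b) with h | h
  · have : a = 0 := by omega
    have : b = 0 := by omega
    subst_vars; simp
  have hn : (0 : ℝ) < (a : ℝ) + b := by exact_mod_cast h
  have h1 := Real.geom_mean_le_arith_mean2_weighted (w₁ := a / (a + b)) (w₂ := b / (a + b))
    (p₁ := z ^ (a + b)) (p₂ := y ^ (a + b)) (by positivity) (by positivity) (by positivity)
    (by positivity) (by field_simp)
  have h2 : ∀ (x : ℝ) (k : ℕ), 0 ≤ x → (x ^ (a + b)) ^ ((k : ℝ) / (a + b)) = x ^ k := by
    intro x k hx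
    rw [← Real.rpow_natCast x (a + b), ← Real.rpow_mul hx]
    push_cast
    rw [mul_div_cancel₀ _ hn.ne', Real.rpow_natCast]
  rw [h2 z a hz, h2 y b hy] at h1
  have h3 := mul_le_mul_of_nonneg_left h1 hn.le
  have h4 : ((a : ℝ) + b) * (a / (a + b) * z ^ (a + b) + b / (a + b) * y ^ (a + b))
      = a * z ^ (a + b) + b * y ^ (a + b) := by field_simp
  linarith

/-- Telescoping `Z ^ q - Y ^ q`, with `Z - Y = X`, against `X`. -/
theorem trace_pow_sub_pow {Z Y X : Matrix ι ι ℝ} (h : Z = Y + X) (q : ℕ) :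
    (Z ^ q * X).trace - (Y ^ q * X).trace
      = ∑ a ∈ Finset.range q, (Z ^ a * X * Y ^ (q - 1 - a) * X).trace := by
  have h1 : Z ^ q - Y ^ q = ∑ a ∈ Finset.range q, Z ^ a * X * Y ^ (q - 1 - a) := by
    induction q with
    | zero => simp
    | succ q ih =>
      rw [Finset.sum_range_succ]
      have : ∀ a ∈ Finset.range q, Z ^ a * X * Y ^ (q + 1 - 1 - a)
          = Z ^ a * X * Y ^ (q - 1 - a) * Y := by
        intro a ha
        rw [Finset.mem_range] at ha
        rw [Matrix.mul_assoc _ (Y ^ _) Y, ← pow_succ]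
        congr 2
        omega
      rw [Finset.sum_congr rfl this, ← Finset.sum_mul, ← ih]
      have hX : X = Z - Y := by rw [h]; abel
      simp only [hX, Nat.add_sub_cancel, Nat.sub_self, pow_zero, pow_succ, mul_one]
      noncomm_ring
  rw [← trace_sub, ← Matrix.sub_mul, h1, Finset.sum_mul, trace_sum]

theorem mul_self_le_smul {X : Matrix ι ι ℝ} {ρ : ℝ} (h0 : 0 ≤ X) (h1 : X ≤ ρ • 1) :
    X * X ≤ ρ • X := by
  obtain ⟨U, z, hU1, hU2, rfl⟩ := exists_diagonalization (isHermitian_of_nonneg h0)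
  have hz : ∀ i, 0 ≤ z i := le_eigenvalue hU1 (by simpa using h0)
  have hz1 := eigenvalue_le hU1 h1
  rw [le_iff]
  have h2 : ρ • (U * diagonal z * Uᵀ) - U * diagonal z * Uᵀ * (U * diagonal z * Uᵀ)
      = U * diagonal (fun i => ρ * z i - z i * z i) * Uᵀ := by
    have e1 : U * diagonal z * Uᵀ * (U * diagonal z * Uᵀ)
        = U * diagonal (fun i => z i * z i) * Uᵀ := by
      have := pow_conj_diagonal (z := z) hU1 hU2 2
      simpa only [pow_two] using this
    have e2 : diagonal (fun i => ρ * z i - z i * z i)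
        = ρ • diagonal z - diagonal (fun i => z i * z i) := by
      ext i j
      by_cases h : i = j <;> simp [h]
    rw [e1, e2, Matrix.mul_sub, Matrix.sub_mul, Matrix.mul_smul, Matrix.smul_mul]
  rw [h2, ← conjTranspose_eq_transpose_of_trivial]
  refine (PosSemidef.diagonal fun i => ?_).mul_mul_conjTranspose_same U
  simp only [Pi.zero_apply]
  nlinarith [hz i, hz1 i]

theorem smul_one_nonneg {ι : Type*} [DecidableEq ι] {c : ℝ} (hc : 0 ≤ c) : (0 : Matrix ι ι ℝ) ≤ c • 1 :=
  nonneg_iff_posSemidef.2 (PosSemidef.one.smul hc)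

/-- Two comparisons under the trace: X² ≤ ρX because the spectrum of X lies in [0, ρ], and c Z^q ≤
Z^(q+1) because that of Z lies above c. The square is traded for one more power of Z, at the price
ρ/c. -/
theorem trace_pow_mul_sq_le {Z X : Matrix ι ι ℝ} {c ρ : ℝ} (hc : 0 < c) (hρ : 0 ≤ ρ)
    (hZ : c • 1 ≤ Z) (hX : 0 ≤ X) (hXρ : X ≤ ρ • 1) (q : ℕ) :
    (Z ^ q * (X * X)).trace ≤ ρ / c * (Z ^ (q + 1) * X).trace := by
  have hZ0 : 0 ≤ Z := (smul_one_nonneg hc.le).trans hZ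
  have h1 := trace_mul_le_trace_mul (pow_matrix_nonneg hZ0 q) (mul_self_le_smul hX hXρ)
  rw [Matrix.mul_smul, trace_smul, smul_eq_mul] at h1
  obtain ⟨U, z, hU1, hU2, hU⟩ := exists_diagonalization (isHermitian_of_nonneg hZ0)
  have hz : ∀ i, c ≤ z i := le_eigenvalue hU1 (by rwa [← hU])
  have h2 : 0 ≤ Z ^ (q + 1) - c • Z ^ q := by
    rw [hU, pow_conj_diagonal hU1 hU2, pow_conj_diagonal hU1 hU2]
    have e2 : U * diagonal (fun i => z i ^ (q + 1)) * Uᵀ - c • (U * diagonal (fun i => z i ^ q) * Uᵀ)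
        = U * diagonal (fun i => z i ^ (q + 1) - c * z i ^ q) * Uᴴ := by
      have e2 : diagonal (fun i => z i ^ (q + 1) - c * z i ^ q)
          = diagonal (fun i => z i ^ (q + 1)) - c • diagonal (fun i => z i ^ q) := by
        ext i j
        by_cases h : i = j <;> simp [h]
      rw [e2, Matrix.mul_sub, Matrix.sub_mul, Matrix.mul_smul, Matrix.smul_mul,
        conjTranspose_eq_transpose_of_trivial]
    rw [e2]
    refine nonneg_iff_posSemidef.2 ((PosSemidef.diagonal fun i => ?_).mul_mul_conjTranspose_same U)
    have h3 : 0 ≤ z i ^ q := pow_nonneg (hc.le.trans (hz i)) q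
    simp only [Pi.zero_apply, pow_succ]
    nlinarith [hz i]
  have h3 := trace_mul_nonneg h2 hX
  rw [Matrix.sub_mul, trace_sub, Matrix.smul_mul, trace_smul, smul_eq_mul] at h3
  calc _ ≤ ρ * (Z ^ q * X).trace := h1
    _ = ρ / c * (c * (Z ^ q * X).trace) := by field_simp
    _ ≤ _ := by gcongr; linarith

/-- The growth of `tr (Y ^ q X)` when `X` is added to `Y`. -/
theorem trace_add_pow_mul_le {Y X : Matrix ι ι ℝ} {c ρ θ : ℝ} (hc : 0 < c) (hρ : 0 ≤ ρ)
    (hY : c • 1 ≤ Y) (hX : 0 ≤ X) (hXρ : X ≤ ρ • 1) (q : ℕ) (hθ : q * ρ / c ≤ θ) :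
    (1 - θ / 2) * ((Y + X) ^ q * X).trace ≤ (1 + θ / 2) * (Y ^ q * X).trace := by
  set Z := Y + X with hZ
  have hY0 : 0 ≤ Y := (smul_one_nonneg hc.le).trans hY
  have hcZ : c • 1 ≤ Z := hY.trans (le_add_of_nonneg_right hX)
  have hZ0 : 0 ≤ Z := (smul_one_nonneg hc.le).trans hcZ
  have hXt : Xᵀ = X := by
    simpa [conjTranspose_eq_transpose_of_trivial] using (isHermitian_of_nonneg hX).eq
  have hn1 := trace_mul_nonneg (pow_matrix_nonneg hY0 q) hX
  have hn2 := trace_mul_nonneg (pow_matrix_nonneg hZ0 q) hX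
  -- A symmetric form of the claim: the difference of the two traces is at most θ/2 times their sum.
  suffices (Z ^ q * X).trace - (Y ^ q * X).trace ≤
      (q * ρ / c) / 2 * ((Z ^ q * X).trace + (Y ^ q * X).trace) by nlinarith
  rcases q with _ | q
  · simp
  rw [trace_pow_sub_pow hZ]
  obtain ⟨z, y, o, ho, hz, hy, h⟩ := exists_trace_weights (isHermitian_of_nonneg hZ0)
    (isHermitian_of_nonneg hY0) X
  rw [hXt] at h
  have hz0 := fun i => hc.le.trans (hz c hcZ i)
  have hy0 := fun i => hc.le.trans (hy c hY i)
  set S := (Z ^ q * (X * X)).trace with hS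
  set R := (Y ^ q * (X * X)).trace with hR
  have hS' : S = ∑ i, ∑ j, o i j * z i ^ q := by
    have := h q 0
    simp only [pow_zero, mul_one] at this
    rw [hS, ← Matrix.mul_assoc, this]
  have hR' : R = ∑ i, ∑ j, o i j * y j ^ q := by
    have := h 0 q
    simp only [pow_zero, one_mul] at this
    rw [hR, trace_mul_comm, Matrix.mul_assoc, trace_mul_comm, ← this]
  -- Each mixed term of the telescoping sum is a convex combination of the pure terms S and R. The
  -- inequality is multiplied by q, so it says nothing for q = 0, which is treated separately below;
  -- summed over a, both ends receive the same weight.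
  have key : ∀ a ∈ Finset.range (q + 1), q * (Z ^ a * X * Y ^ (q + 1 - 1 - a) * X).trace
      ≤ a * S + (q - a) * R := by
    intro a ha
    rw [Finset.mem_range] at ha
    rw [h, hS', hR']
    simp only [Finset.mul_sum, ← Finset.sum_add_distrib]
    refine Finset.sum_le_sum fun i _ => Finset.sum_le_sum fun j _ => ?_
    have h1 := mul_le_mul_of_nonneg_left
      (pow_mul_pow_le (hz0 i) (hy0 j) a (q - a)) (ho i j)
    have e1 : a + (q - a) = q := by omega
    rw [e1, Nat.cast_sub (by omega)] at h1
    simp only [Nat.add_sub_cancel]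
    nlinarith
  have hsum : ∑ a ∈ Finset.range (q + 1), (Z ^ a * X * Y ^ (q + 1 - 1 - a) * X).trace
      ≤ (q + 1) / 2 * (S + R) := by
    rcases Nat.eq_zero_or_pos q with rfl | hq
    · have : S = R := by rw [hS, hR]; simp
      rw [← this, hS]
      simp
      linarith
    have hq' : (0 : ℝ) < q := by exact_mod_cast hq
    have h1 := Finset.sum_le_sum key
    rw [← Finset.mul_sum, Finset.sum_add_distrib, ← Finset.sum_mul, ← Finset.sum_mul,
      Finset.sum_sub_distrib] at h1
    have h2 : (∑ a ∈ Finset.range (q + 1), (a : ℝ)) = q * (q + 1) / 2 := by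
      have := Finset.sum_range_id_mul_two (q + 1)
      rw [Nat.add_sub_cancel] at this
      have h3 : ((∑ a ∈ Finset.range (q + 1), a : ℕ) : ℝ) * 2 = (q + 1) * q := by exact_mod_cast this
      push_cast at h3
      linarith
    rw [h2] at h1
    simp only [Finset.sum_const, Finset.card_range, nsmul_eq_mul] at h1
    rw [Nat.cast_add_one] at h1
    have h3 : (q : ℝ) * ∑ a ∈ Finset.range (q + 1), (Z ^ a * X * Y ^ (q + 1 - 1 - a) * X).trace
      ≤ q * ((q + 1) / 2 * (S + R)) := by linarith
    exact le_of_mul_le_mul_left h3 hq'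
  have hS1 := trace_pow_mul_sq_le hc hρ hcZ hX hXρ q
  have hR1 := trace_pow_mul_sq_le hc hρ hY hX hXρ q
  calc _ ≤ ((q : ℝ) + 1) / 2 * (S + R) := hsum
    _ ≤ ((q : ℝ) + 1) / 2 * (ρ / c * (Z ^ (q + 1) * X).trace + ρ / c * (Y ^ (q + 1) * X).trace) := by
        gcongr
    _ = _ := by push_cast; ring

end TraceInequalities

/-! ### One random choice and the two trace potentials. -/

section Rounding

open Matrix

variable {ι : Type*} [Fintype ι] [DecidableEq ι]

/-- Klein's inequality at V + q⁻¹B bounds the gain from keeping B by a trace against (V + q⁻¹B)^k,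
`trace_add_pow_mul_le` moves this trace back to V^k at the cost of the factor g, and Klein's
inequality at V absorbs the result into V + gB. The smallness of B is only asked for q < 1, since
for q = 1 there is no randomness and monotonicity is enough. -/
theorem round_upper {V B : Matrix ι ι ℝ} {c ρ θ g q : ℝ} {k : ℕ} (hc : 0 < c) (hρ : 0 ≤ ρ)
    (hV : c • 1 ≤ V) (hB : 0 ≤ B) (hq0 : 0 ≤ q) (hq1 : q ≤ 1) (hqB : q < 1 → B ≤ (q * ρ) • 1)
    (hθ : k * ρ / c ≤ θ) (hθ2 : θ < 2) (hg1 : 1 ≤ g) (hg : 1 + θ / 2 ≤ g * (1 - θ / 2)) :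
    q * ((V + q⁻¹ • B) ^ (k + 1)).trace + (1 - q) * (V ^ (k + 1)).trace
      ≤ ((V + g • B) ^ (k + 1)).trace := by
  have hV0 : 0 ≤ V := (smul_one_nonneg hc.le).trans hV
  rcases hq0.eq_or_lt with rfl | hq
  · have : B = 0 := le_antisymm (by simpa using hqB one_pos) hB
    simp [this]
  rcases hq1.eq_or_lt with rfl | hq1
  · simp only [inv_one, one_smul, one_mul, sub_self, zero_mul, add_zero]
    refine trace_pow_mono (add_nonneg hV0 hB) ?_ k
    gcongr
    simpa using smul_le_smul_of_nonneg_right hg1 hB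
  have hX : 0 ≤ q⁻¹ • B := smul_nonneg (by positivity) hB
  have hXρ : q⁻¹ • B ≤ ρ • 1 := by
    have := smul_le_smul_of_nonneg_left (hqB hq1) (inv_nonneg.2 hq0)
    rwa [smul_smul, ← mul_assoc, inv_mul_cancel₀ hq.ne', one_mul] at this
  have h1 := trace_pow_tangent_le (add_nonneg hV0 hX) hV0 k
  have h2 := trace_add_pow_mul_le hc hρ hV hX hXρ k hθ
  have h3 := trace_pow_tangent_le hV0 (add_nonneg hV0 (smul_nonneg (zero_le_one.trans hg1) hB)) k
  have e1 : V - (V + q⁻¹ • B) = -(q⁻¹ • B) := by abel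
  rw [e1, Matrix.mul_neg, trace_neg] at h1
  rw [add_sub_cancel_left, Matrix.mul_smul, trace_smul, smul_eq_mul] at h3
  have h4 := trace_mul_nonneg (pow_matrix_nonneg hV0 k) hB
  have e2 : (V ^ k * q⁻¹ • B).trace = q⁻¹ * (V ^ k * B).trace := by
    rw [Matrix.mul_smul, trace_smul, smul_eq_mul]
  rw [e2] at h2
  set s := ((V + q⁻¹ • B) ^ k * q⁻¹ • B).trace
  set t := (V ^ k * B).trace
  have h5 : q * s ≤ g * t := by
    have h6 : q * ((1 - θ / 2) * s) ≤ (1 + θ / 2) * t := by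
      calc q * ((1 - θ / 2) * s) ≤ q * ((1 + θ / 2) * (q⁻¹ * t)) := by gcongr
        _ = _ := by field_simp
    have h7 : (1 + θ / 2) * t ≤ g * (1 - θ / 2) * t := by gcongr
    have h8 : (1 - θ / 2) * (q * s) ≤ (1 - θ / 2) * (g * t) := by linarith
    exact le_of_mul_le_mul_left h8 (by linarith)
  have h9 := mul_le_mul_of_nonneg_left h5 (show (0 : ℝ) ≤ (k : ℝ) + 1 by positivity)
  have h10 := mul_le_mul_of_nonneg_left h1 hq0
  nlinarith

/-- The same argument downwards. Now the growth estimate starts from V - q⁻¹B, so it is this matrix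
that has to stay above c, and the factor g ≤ 1 is what remains of the expected decrease. -/
theorem round_lower {V B : Matrix ι ι ℝ} {c ρ θ g q : ℝ} {k : ℕ} (hc : 0 < c) (hρ : 0 ≤ ρ)
    (hV : 0 < q → c • 1 ≤ V - q⁻¹ • B) (hVg : 0 ≤ V - g • B) (hB : 0 ≤ B) (hq0 : 0 ≤ q)
    (hq1 : q ≤ 1) (hqB : q < 1 → B ≤ (q * ρ) • 1)
    (hθ : k * ρ / c ≤ θ) (hθ0 : 0 ≤ θ) (hg1 : g ≤ 1)
    (hg : g * (1 + θ / 2) ≤ 1 - θ / 2) :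
    q * ((V - q⁻¹ • B) ^ (k + 1)).trace + (1 - q) * (V ^ (k + 1)).trace
      ≤ ((V - g • B) ^ (k + 1)).trace := by
  rcases hq0.eq_or_lt with rfl | hq
  · have : B = 0 := le_antisymm (by simpa using hqB one_pos) hB
    simp [this]
  have hW := hV hq
  have hW0 : 0 ≤ V - q⁻¹ • B := (smul_one_nonneg hc.le).trans hW
  rcases hq1.eq_or_lt with rfl | hq1
  · simp only [inv_one, one_smul, one_mul, sub_self, zero_mul, add_zero] at hW0 ⊢
    refine trace_pow_mono hW0 ?_ k
    gcongr
    simpa using smul_le_smul_of_nonneg_right hg1 hB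
  have hX : 0 ≤ q⁻¹ • B := smul_nonneg (by positivity) hB
  have hXρ : q⁻¹ • B ≤ ρ • 1 := by
    have := smul_le_smul_of_nonneg_left (hqB hq1) (inv_nonneg.2 hq0)
    rwa [smul_smul, ← mul_assoc, inv_mul_cancel₀ hq.ne', one_mul] at this
  have hV0 : 0 ≤ V := by simpa using add_nonneg hW0 hX
  have h1 := trace_pow_tangent_le hW0 hV0 k
  have h2 := trace_add_pow_mul_le hc hρ hW hX hXρ k hθ
  rw [sub_add_cancel] at h2
  have h3 := trace_pow_tangent_le hV0 hVg k
  have e1 : V - g • B - V = -(g • B) := by abel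
  rw [sub_sub_cancel] at h1
  rw [e1, Matrix.mul_neg, trace_neg, Matrix.mul_smul, trace_smul, smul_eq_mul] at h3
  have h4 := trace_mul_nonneg (pow_matrix_nonneg hV0 k) hB
  have e2 : (V ^ k * q⁻¹ • B).trace = q⁻¹ * (V ^ k * B).trace := by
    rw [Matrix.mul_smul, trace_smul, smul_eq_mul]
  rw [e2] at h2
  set s := ((V - q⁻¹ • B) ^ k * q⁻¹ • B).trace
  set t := (V ^ k * B).trace
  have h5 : g * t ≤ q * s := by
    have h6 : (1 - θ / 2) * t ≤ q * ((1 + θ / 2) * s) := by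
      calc (1 - θ / 2) * t = q * ((1 - θ / 2) * (q⁻¹ * t)) := by field_simp
        _ ≤ _ := by gcongr
    have h7 : g * (1 + θ / 2) * t ≤ (1 - θ / 2) * t := by gcongr
    have h8 : (1 + θ / 2) * (g * t) ≤ (1 + θ / 2) * (q * s) := by linarith
    exact le_of_mul_le_mul_left h8 (by linarith)
  have h9 := mul_le_mul_of_nonneg_left h5 (show (0 : ℝ) ≤ (k : ℝ) + 1 by positivity)
  have h10 := mul_le_mul_of_nonneg_left h1 hq0
  nlinarith

/-- The power of a single eigenvalue is at most the sum of the powers of all of them. -/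
theorem le_of_trace_pow_le {U : Matrix ι ι ℝ} (hU : 0 ≤ U) {c : ℝ} (hc : 0 ≤ c) {k : ℕ}
    (h : (U ^ (k + 1)).trace ≤ c ^ (k + 1)) : U ≤ c • 1 := by
  obtain ⟨W, z, h1, h2, hW⟩ := exists_diagonalization (isHermitian_of_nonneg hU)
  have hz : ∀ i, 0 ≤ z i := le_eigenvalue h1 (by rw [← hW]; simpa using hU)
  rw [hW, pow_conj_diagonal h1 h2, trace_mul_comm, ← Matrix.mul_assoc, h1, Matrix.one_mul,
    trace_diagonal] at h
  have hzc : ∀ i, z i ≤ c := fun i => by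
    refine le_of_pow_le_pow_left₀ (n := k + 1) (by omega) hc (le_trans ?_ h)
    exact Finset.single_le_sum (f := fun i => z i ^ (k + 1)) (fun j _ => pow_nonneg (hz j) _)
      (Finset.mem_univ i)
  have e : c • 1 - U = W * diagonal (fun i => c - z i) * Wᴴ := by
    have e2 : diagonal (fun i => c - z i) = c • 1 - diagonal z := by
      ext i j
      by_cases h : i = j <;> simp [h]
    rw [e2, Matrix.mul_sub, Matrix.sub_mul, conjTranspose_eq_transpose_of_trivial, ← hW,
      Matrix.mul_smul, Matrix.smul_mul, Matrix.mul_one, h2]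
  rw [le_iff, e]
  exact (PosSemidef.diagonal fun i => sub_nonneg.2 (hzc i)).mul_mul_conjTranspose_same W

theorem smul_one_mono {ι : Type*} [DecidableEq ι] {c d : ℝ} (h : c ≤ d) :
    (c • 1 : Matrix ι ι ℝ) ≤ d • 1 := by
  rw [← sub_nonneg, ← sub_smul]
  exact smul_one_nonneg (sub_nonneg.2 h)

theorem smul_trace_pow (a : ℝ) (U : Matrix ι ι ℝ) (p : ℕ) :
    ((a • U) ^ p).trace = a ^ p * (U ^ p).trace := by
  rw [smul_pow, trace_smul, smul_eq_mul]

/-- From the potential bound to a bound for the partial sum. -/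
theorem partial_sum_le {Z : Matrix ι ι ℝ} {ε κ : ℝ} {k : ℕ} (hε0 : 0 < ε) (hε1 : ε < 1)
    (hκ : κ ≤ (1 + ε ^ 2 / 32) ^ (k + 1)) (hZ : 0 ≤ Z)
    (h : (((8 / ε + (1 + ε / 4))⁻¹ • ((8 / ε) • 1 + Z)) ^ (k + 1)).trace ≤ κ) :
    Z ≤ (1 + ε) • 1 := by
  have hL : 0 < 8 / ε := by positivity
  have h1 := le_of_trace_pow_le (U := (8 / ε + (1 + ε / 4))⁻¹ • ((8 / ε) • 1 + Z))
    (smul_nonneg (by positivity) (add_nonneg (smul_one_nonneg hL.le) hZ)) (by positivity)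
    (h.trans hκ)
  have h2 := smul_le_smul_of_nonneg_left h1 (show 0 ≤ 8 / ε + (1 + ε / 4) by positivity)
  rw [smul_smul, mul_inv_cancel₀ (by positivity), one_smul, smul_smul] at h2
  have h3 : Z ≤ ((8 / ε + (1 + ε / 4)) * (1 + ε ^ 2 / 32) - 8 / ε) • 1 := by
    rw [sub_smul]
    exact le_sub_iff_add_le'.2 h2
  refine h3.trans (smul_one_mono ?_)
  -- The relative error ε²/32 acts on the shift 8/ε and becomes an absolute error ε/4; together with
  -- the inflation ε/4 this stays below ε.
  have : (8 / ε + (1 + ε / 4)) * (1 + ε ^ 2 / 32) - 8 / ε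
      = 1 + ε / 4 + ε / 4 + (1 + ε / 4) * ε ^ 2 / 32 := by field_simp; ring
  rw [this]
  nlinarith [sq_nonneg ε]

/-- Mirror image of `partial_sum_le`, with the partial sum subtracted from the shift. Positivity of
the base matrix is not automatic here and has to be assumed. -/
theorem le_partial_sum {Z : Matrix ι ι ℝ} {ε κ : ℝ} {k : ℕ} (hε0 : 0 < ε) (hε1 : ε < 1)
    (hκ : κ ≤ (1 + ε ^ 2 / 32) ^ (k + 1)) (hZ : 0 ≤ (8 / ε) • 1 - Z)
    (h : (((8 / ε - (1 - ε / 4))⁻¹ • ((8 / ε) • 1 - Z)) ^ (k + 1)).trace ≤ κ) :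
    (1 - ε) • 1 ≤ Z := by
  have hL : 8 < 8 / ε := by rw [lt_div_iff₀ hε0]; linarith
  have hb : 0 < 8 / ε - (1 - ε / 4) := by linarith
  have h1 := le_of_trace_pow_le (U := (8 / ε - (1 - ε / 4))⁻¹ • ((8 / ε) • 1 - Z))
    (smul_nonneg (by positivity) hZ) (by positivity) (h.trans hκ)
  have h2 := smul_le_smul_of_nonneg_left h1 hb.le
  rw [smul_smul, mul_inv_cancel₀ hb.ne', one_smul, smul_smul] at h2
  have h3 : (8 / ε - (8 / ε - (1 - ε / 4)) * (1 + ε ^ 2 / 32)) • 1 ≤ Z := by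
    rw [sub_smul]
    exact sub_le_comm.1 h2
  refine le_trans (smul_one_mono ?_) h3
  have : 8 / ε - (8 / ε - (1 - ε / 4)) * (1 + ε ^ 2 / 32)
      = 1 - ε / 4 - ε / 4 + (1 - ε / 4) * ε ^ 2 / 32 := by field_simp; ring
  rw [this]
  nlinarith [sq_nonneg ε]

/-- One step of the derandomised rounding: averaged over the two choices, neither of the two
potentials increases. -/
theorem round_step {Y B R : Matrix ι ι ℝ} {ε κ q : ℝ} {k : ℕ} (hε0 : 0 < ε) (hε1 : ε < 1)
    (hκ : κ ≤ (1 + ε ^ 2 / 32) ^ (k + 1)) (hY : 0 ≤ Y) (hB : 0 ≤ B) (hR : 0 ≤ R)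
    (hq0 : 0 ≤ q) (hq1 : q ≤ 1) (hqB : q < 1 → B ≤ (q / (4 * (k + 1))) • 1)
    (h : (((8 / ε + (1 + ε / 4))⁻¹ • ((8 / ε) • 1 + (Y + (1 + ε / 4) • (B + R)))) ^ (k + 1)).trace
      ≤ κ) :
    0 ≤ (8 / ε) • 1 - (Y + (1 - ε / 4) • (B + R)) ∧
    q * (((8 / ε + (1 + ε / 4))⁻¹ • ((8 / ε) • 1 + (Y + q⁻¹ • B + (1 + ε / 4) • R)))
        ^ (k + 1)).trace
      + (1 - q) * (((8 / ε + (1 + ε / 4))⁻¹ • ((8 / ε) • 1 + (Y + (1 + ε / 4) • R)))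
        ^ (k + 1)).trace
      ≤ (((8 / ε + (1 + ε / 4))⁻¹ • ((8 / ε) • 1 + (Y + (1 + ε / 4) • (B + R))))
        ^ (k + 1)).trace ∧
    q * (((8 / ε - (1 - ε / 4))⁻¹ • ((8 / ε) • 1 - (Y + q⁻¹ • B + (1 - ε / 4) • R)))
        ^ (k + 1)).trace
      + (1 - q) * (((8 / ε - (1 - ε / 4))⁻¹ • ((8 / ε) • 1 - (Y + (1 - ε / 4) • R)))
        ^ (k + 1)).trace
      ≤ (((8 / ε - (1 - ε / 4))⁻¹ • ((8 / ε) • 1 - (Y + (1 - ε / 4) • (B + R))))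
        ^ (k + 1)).trace := by
  have hL : 8 < 8 / ε := by rw [lt_div_iff₀ hε0]; linarith
  have hg : (0 : ℝ) ≤ 1 + ε / 4 := by positivity
  have hg' : (0 : ℝ) ≤ 1 - ε / 4 := by linarith
  have hp : (0 : ℝ) < (k : ℝ) + 1 := by positivity
  have hk : (k : ℝ) / (k + 1) ≤ 1 := by rw [div_le_one hp]; linarith
  -- The upper potential also serves the lower one: it keeps the partial sum below 1 + ε, far under
  -- the shift 8/ε > 8, so the base matrix of the lower potential is positive.
  have hZ := partial_sum_le hε0 hε1 hκ (add_nonneg hY (smul_nonneg hg (add_nonneg hB hR))) h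
  have hYBR : Y + (1 - ε / 4) • (B + R) ≤ (1 + ε) • 1 := by
    refine le_trans ?_ hZ
    exact add_le_add le_rfl (smul_le_smul_of_nonneg_right (by linarith) (add_nonneg hB hR))
  have hYR : Y + (1 - ε / 4) • R ≤ (1 + ε) • 1 := by
    refine le_trans ?_ hYBR
    gcongr
    exact le_add_of_nonneg_left hB
  have hYBR2 : Y + B + (1 - ε / 4) • R ≤ (1 + ε) • 1 := by
    refine le_trans ?_ hZ
    rw [smul_add, ← add_assoc]
    gcongr
    · have := smul_le_smul_of_nonneg_right (show (1 : ℝ) ≤ 1 + ε / 4 by linarith) hB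
      rwa [one_smul] at this
    · linarith
  have hqB' : q < 1 → B ≤ (q * (1 / (4 * (k + 1)))) • 1 := by
    intro h
    have := hqB h
    rwa [mul_one_div]
  have h0 : 0 ≤ (8 / ε) • 1 - (Y + (1 - ε / 4) • (B + R)) :=
    sub_nonneg.2 (hYBR.trans (smul_one_mono (by linarith)))
  refine ⟨h0, ?_, ?_⟩
  · simp only [smul_trace_pow]
    -- The shift provides c = 8/ε and the sampling rate provides ρ = 1/(4p) with p = k + 1, so kρ/c
    -- ≤ ε/32. The larger θ = ε/16 is used in both cases; then (1 + θ/2)/(1 - θ/2) is within 1 +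
    -- ε/4.
    have := round_upper (V := (8 / ε) • 1 + (Y + (1 + ε / 4) • R)) (B := B) (c := 8 / ε)
      (ρ := 1 / (4 * (k + 1))) (θ := ε / 16) (g := 1 + ε / 4) (k := k) (by linarith) (by positivity)
      (le_add_of_nonneg_right (add_nonneg hY (smul_nonneg hg hR))) hB hq0 hq1 hqB' ?_ (by linarith)
      (by linarith) (by nlinarith)
    · have e1 : (8 / ε) • 1 + (Y + (1 + ε / 4) • R) + q⁻¹ • B
          = (8 / ε) • 1 + (Y + q⁻¹ • B + (1 + ε / 4) • R) := by abel
      have e2 : (8 / ε) • 1 + (Y + (1 + ε / 4) • R) + (1 + ε / 4) • B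
          = (8 / ε) • 1 + (Y + (1 + ε / 4) • (B + R)) := by rw [smul_add]; abel
      rw [e1, e2] at this
      have h2 := mul_le_mul_of_nonneg_left this
        (show 0 ≤ (8 / ε + (1 + ε / 4))⁻¹ ^ (k + 1) by positivity)
      linarith
    · have : (k : ℝ) * (1 / (4 * (k + 1))) / (8 / ε) = (k / (k + 1)) * (ε / 32) := by
        field_simp; ring
      rw [this]
      nlinarith
  · simp only [smul_trace_pow]
    -- Half of the shift is given away: after keeping q⁻¹B the subtracted matrix is at most 2 + ε <
    -- 4 < 4/ε, so the base matrix stays above c = 4/ε.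
    have := round_lower (V := (8 / ε) • 1 - (Y + (1 - ε / 4) • R)) (B := B) (c := 4 / ε) (q := q)
      (ρ := 1 / (4 * (k + 1))) (θ := ε / 16) (g := 1 - ε / 4) (k := k) (by positivity)
      (by positivity) ?_ ?_ hB hq0 hq1 hqB' ?_ (by positivity) (by linarith) (by nlinarith)
    · have e1 : (8 / ε) • 1 - (Y + (1 - ε / 4) • R) - q⁻¹ • B
          = (8 / ε) • 1 - (Y + q⁻¹ • B + (1 - ε / 4) • R) := by abel
      have e2 : (8 / ε) • 1 - (Y + (1 - ε / 4) • R) - (1 - ε / 4) • B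
          = (8 / ε) • 1 - (Y + (1 - ε / 4) • (B + R)) := by rw [smul_add]; abel
      rw [e1, e2] at this
      have hb : 0 < 8 / ε - (1 - ε / 4) := by linarith
      have h2 := mul_le_mul_of_nonneg_left this
        (show 0 ≤ (8 / ε - (1 - ε / 4))⁻¹ ^ (k + 1) by positivity)
      linarith
    · intro hq
      have e3 : 4 / ε = 8 / ε - 4 / ε := by ring
      have hL4 : 4 < 4 / ε := by rw [lt_div_iff₀ hε0]; linarith
      have e1 : (8 / ε) • 1 - (Y + (1 - ε / 4) • R) - q⁻¹ • B
          = (8 / ε) • 1 - (Y + q⁻¹ • B + (1 - ε / 4) • R) := by abel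
      rw [e1, e3, sub_smul]
      refine sub_le_sub_left ?_ _
      rcases hq1.eq_or_lt with rfl | hq1
      · rw [inv_one, one_smul]
        exact hYBR2.trans (smul_one_mono (by linarith))
      · have h5 : q⁻¹ • B ≤ (1 : ℝ) • 1 := by
          have := smul_le_smul_of_nonneg_left (hqB hq1) (inv_nonneg.2 hq0)
          rw [smul_smul] at this
          refine this.trans (smul_one_mono ?_)
          rw [← mul_div_assoc, inv_mul_cancel₀ hq.ne', div_le_one (by positivity)]
          linarith
        have h6 : Y + q⁻¹ • B + (1 - ε / 4) • R ≤ (1 + ε) • 1 + (1 : ℝ) • 1 := by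
          have := add_le_add hYR h5
          refine le_trans (le_of_eq ?_) this
          abel
        rw [← add_smul] at h6
        exact h6.trans (smul_one_mono (by linarith))
    · have e2 : (8 / ε) • 1 - (Y + (1 - ε / 4) • R) - (1 - ε / 4) • B
          = (8 / ε) • 1 - (Y + (1 - ε / 4) • (B + R)) := by rw [smul_add]; abel
      rw [e2]
      exact h0
    · have : (k : ℝ) * (1 / (4 * (k + 1))) / (4 / ε) = (k / (k + 1)) * (ε / 16) := by
        field_simp; ring
      rw [this]
      nlinarith

end Rounding

/-! ### From the connectivity parameter to the total importance, and comparison of the size bounds.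
-/

section ConnectivityBounds

variable {κ : Type*} [DecidableEq κ] {n : ℕ}

/-- Shifting the colour of j by a constant is a bijection of the colourings, so the difference of
the colours of i and j is equidistributed on the k residues. -/
theorem card_coloring_eq [Fintype κ] {i j : κ} (hij : i ≠ j) (k : ℕ) [NeZero k] :
    k * (Finset.univ.filter fun f : κ → Fin k => f j = f i).card
      = Fintype.card (κ → Fin k) := by
  have h1 : ∀ c : Fin k, (Finset.univ.filter fun f : κ → Fin k => f j + c = f i).card
      = (Finset.univ.filter fun f : κ → Fin k => f j = f i).card := by
    intro c
    refine Finset.card_bij' (fun f _ => Function.update f j (f j + c))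
      (fun f _ => Function.update f j (f j - c)) ?_ ?_ ?_ ?_
    · intro f hf
      simpa [Function.update_of_ne hij] using hf
    · intro f hf
      simpa [Function.update_of_ne hij] using hf
    · intro f _
      simp
    · intro f _
      simp
  have h2 : ∑ c : Fin k, (Finset.univ.filter fun f : κ → Fin k => f j + c = f i).card
      = Fintype.card (κ → Fin k) := by
    simp only [Finset.card_filter]
    rw [Finset.sum_comm, ← Finset.card_univ, Finset.card_eq_sum_ones]
    refine Finset.sum_congr rfl fun f _ => ?_
    rw [Finset.sum_eq_single (f i - f j)]
    · simp
    · intro b _ hb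
      rw [if_neg]
      rintro h
      exact hb (by rw [← h]; simp)
    · simp
  rw [← h2]
  simp [h1]

/-- Fewer than `N` members of a set fail to be dominated by the rest of the set. -/
theorem card_not_dominated_lt {α : ℝ} {A : κ → Matrix (Fin n) (Fin n) ℝ} {N : ℕ}
    (hA : ∀ i, 0 ≤ A i) (hN : IsThreshold α A N) (S : Finset κ) :
    (open Classical in S.filter fun i => ¬ α • A i ≤ ∑ j ∈ S.erase i, A j).card < N := by
  classical
  by_contra! h
  -- The threshold property is applied to the set of failures itself: one of them is dominated by
  -- the other failures, hence by the rest of S.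
  obtain ⟨i, hi, h2⟩ := hN _ h
  rw [Finset.mem_filter] at hi
  refine hi.2 (h2.trans ?_)
  exact Finset.sum_le_sum_of_subset_of_nonneg
    (Finset.erase_subset_erase _ (Finset.filter_subset _ _)) fun j _ _ => hA j

/-- Random colouring. At most kN indices of S fail to be dominated inside their own colour class, at
most half of S, so some i is dominated for at least half of the colourings. Another index shares the
colour of i for a fraction 1/k of the colourings; summing the dominations therefore gains a factor
of order k over a single application of the threshold. -/
theorem exists_dominated_of_coloring [Fintype κ] {α : ℝ} (hα : 0 < α)
    {A : κ → Matrix (Fin n) (Fin n) ℝ} {N : ℕ} (hA : ∀ i, 0 ≤ A i) (hN : IsThreshold α A N)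
    {S : Finset κ} {k : ℕ} [NeZero k] (hS : 0 < S.card) (hk : 2 * k * N ≤ S.card) :
    ∃ i ∈ S, A i ≤ (2 / (α * k)) • ∑ j ∈ S, A j := by
  classical
  let cls : (κ → Fin k) → κ → Finset κ := fun f i => S.filter fun j => f j = f i
  let bad : (κ → Fin k) → κ → Prop := fun f i => ¬ α • A i ≤ ∑ j ∈ (cls f i).erase i, A j
  have hk0 : (0 : ℝ) < k := by exact_mod_cast NeZero.pos k
  set F := Fintype.card (κ → Fin k) with hF
  have h1 : ∀ f, (S.filter fun i => bad f i).card ≤ k * N := by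
    intro f
    have e : S.filter (fun i => bad f i) = Finset.univ.biUnion fun c : Fin k =>
        (S.filter fun i => f i = c).filter fun i =>
          ¬ α • A i ≤ ∑ j ∈ (S.filter fun i => f i = c).erase i, A j := by
      ext i
      simp only [Finset.mem_filter, Finset.mem_biUnion, Finset.mem_univ, true_and]
      constructor
      · rintro ⟨hi, hb⟩
        exact ⟨f i, ⟨hi, rfl⟩, hb⟩
      · rintro ⟨c, ⟨hi, rfl⟩, hb⟩
        exact ⟨hi, hb⟩
    rw [e]
    refine Finset.card_biUnion_le.trans ?_
    calc _ ≤ ∑ c : Fin k, N := Finset.sum_le_sum fun c _ => (card_not_dominated_lt hA hN _).le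
      _ = _ := by simp
  -- Double counting of the pairs of a colouring and an index that is bad for it.
  have h2 : ∃ i ∈ S, 2 * (Finset.univ.filter fun f => bad f i).card ≤ F := by
    by_contra! h
    have e1 : ∑ i ∈ S, (Finset.univ.filter fun f => bad f i).card ≤ F * (k * N) := by
      simp only [Finset.card_filter]
      rw [Finset.sum_comm]
      calc _ = ∑ f : κ → Fin k, (S.filter fun i => bad f i).card := by
            simp only [Finset.card_filter]
        _ ≤ ∑ f : κ → Fin k, k * N := Finset.sum_le_sum fun f _ => h1 f
        _ = _ := by simp [hF]
    have e2 : ∑ i ∈ S, F < ∑ i ∈ S, 2 * (Finset.univ.filter fun f => bad f i).card :=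
      Finset.sum_lt_sum_of_nonempty (Finset.card_pos.1 hS) h
    rw [← Finset.mul_sum, Finset.sum_const, smul_eq_mul] at e2
    have e3 : F * (2 * k * N) ≤ F * S.card := Nat.mul_le_mul_left _ hk
    nlinarith
  obtain ⟨i, hi, h2⟩ := h2
  refine ⟨i, hi, ?_⟩
  have h3 : (F : ℝ) / 2 ≤ (Finset.univ.filter fun f => ¬ bad f i).card := by
    have := Finset.card_filter_add_card_filter_not (s := (Finset.univ : Finset (κ → Fin k)))
      (fun f => bad f i)
    rw [Finset.card_univ, ← hF] at this
    have h4 : F ≤ 2 * (Finset.univ.filter fun f => ¬ bad f i).card := by omega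
    have h5 : (F : ℝ) ≤ 2 * (Finset.univ.filter fun f => ¬ bad f i).card := by exact_mod_cast h4
    linarith
  have h4 : ∑ f ∈ Finset.univ.filter (fun f => ¬ bad f i), α • A i
      ≤ ∑ f : κ → Fin k, ∑ j ∈ S.erase i, if f j = f i then A j else 0 := by
    calc _ ≤ ∑ f ∈ Finset.univ.filter (fun f => ¬ bad f i),
          ∑ j ∈ S.erase i, (if f j = f i then A j else 0) := by
          refine Finset.sum_le_sum fun f hf => ?_
          have hf := not_not.1 (Finset.mem_filter.1 hf).2
          refine hf.trans (le_of_eq ?_)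
          rw [← Finset.sum_filter]
          congr 1
          ext j
          simp only [cls, Finset.mem_erase, Finset.mem_filter]
          tauto
      _ ≤ _ := by
          refine Finset.sum_le_sum_of_subset_of_nonneg (Finset.filter_subset _ _) fun f _ _ => ?_
          exact Finset.sum_nonneg fun j _ => by split_ifs; exacts [hA j, le_rfl]
  have h5 : ∑ f : κ → Fin k, ∑ j ∈ S.erase i, (if f j = f i then A j else 0)
      = ((F : ℝ) / k) • ∑ j ∈ S.erase i, A j := by
    rw [Finset.sum_comm, Finset.smul_sum]
    refine Finset.sum_congr rfl fun j hj => ?_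
    rw [← Finset.sum_filter, Finset.sum_const]
    have := card_coloring_eq (Finset.ne_of_mem_erase hj).symm k
    rw [← hF] at this
    rw [← Nat.cast_smul_eq_nsmul ℝ]
    congr 1
    rw [eq_div_iff hk0.ne', ← this]
    push_cast
    ring
  rw [h5, Finset.sum_const, ← Nat.cast_smul_eq_nsmul ℝ, smul_smul] at h4
  have hF0 : (0 : ℝ) < F := by
    have : Nonempty (κ → Fin k) := ⟨fun _ => 0⟩
    exact_mod_cast Fintype.card_pos
  have h6 : ((F : ℝ) / 2 * α) • A i ≤ ((F : ℝ) / k) • ∑ j ∈ S, A j := by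
    calc _ ≤ _ := smul_le_smul_of_nonneg_right (mul_le_mul_of_nonneg_right h3 hα.le) (hA i)
      _ ≤ _ := h4
      _ ≤ _ := smul_le_smul_of_nonneg_left (Finset.sum_le_sum_of_subset_of_nonneg
          (Finset.erase_subset _ _) fun j _ _ => hA j) (by positivity)
  have h7 := smul_le_smul_of_nonneg_left h6 (show 0 ≤ ((F : ℝ) / 2 * α)⁻¹ by positivity)
  rw [smul_smul, smul_smul, inv_mul_cancel₀ (by positivity), one_smul] at h7
  convert h7 using 2
  field_simp

/-- Every nonempty index set contains an `i` for which `A i` is a small part of the sum. -/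
theorem exists_le_smul_sum [Fintype κ] {α : ℝ} (hα : 0 < α) (hα1 : α ≤ 1)
    {A : κ → Matrix (Fin n) (Fin n) ℝ} {N : ℕ} (hA : ∀ i, 0 ≤ A i) (hN0 : 0 < N)
    (hN : IsThreshold α A N) {S : Finset κ} (hS : S.Nonempty) :
    ∃ i ∈ S, A i ≤ (8 * (N / α) / S.card) • ∑ j, A j := by
  have hS0 : (0 : ℝ) < S.card := by exact_mod_cast hS.card_pos
  have hN0' : (0 : ℝ) < N := by exact_mod_cast hN0
  have hM : ∑ j ∈ S, A j ≤ ∑ j, A j :=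
    Finset.sum_le_sum_of_subset_of_nonneg (Finset.subset_univ _) fun j _ _ => hA j
  have hMn : 0 ≤ ∑ j, A j := Finset.sum_nonneg fun j _ => hA j
  -- For small S the factor is at least one, and any member will do.
  rcases le_or_gt (S.card : ℝ) (8 * (N / α)) with h | h
  · obtain ⟨i, hi⟩ := hS
    refine ⟨i, hi, (Finset.single_le_sum (fun j _ => hA j) (Finset.mem_univ i)).trans ?_⟩
    have : (1 : ℝ) ≤ 8 * (N / α) / S.card := by rwa [le_div_iff₀ hS0, one_mul]
    simpa using smul_le_smul_of_nonneg_right this hMn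
  · have h1 : (N : ℝ) ≤ N / α := by rw [le_div_iff₀ hα]; nlinarith
    have h2 : 8 * N ≤ S.card := by
      have : (8 : ℝ) * N ≤ S.card := by linarith
      exact_mod_cast this
    -- The largest number of colours that the colouring lemma allows. Rounding down costs a factor
    -- two, |S| ≤ 4Nk, which turns 2/(αk) into 8N/(α|S|).
    set k := S.card / (2 * N) with hk
    have hk1 : 1 ≤ k := by rw [hk, Nat.le_div_iff_mul_le (by omega)]; omega
    have : NeZero k := ⟨by omega⟩
    have h3 : 2 * k * N ≤ S.card := by
      have := Nat.div_mul_le_self S.card (2 * N)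
      rw [← hk] at this
      linarith
    have h4 : S.card < 2 * N * (k + 1) := Nat.lt_mul_div_succ _ (by omega)
    have h5 : (S.card : ℝ) ≤ 4 * N * k := by
      have : S.card ≤ 4 * N * k := by nlinarith
      exact_mod_cast this
    have hk0 : (0 : ℝ) < k := by exact_mod_cast hk1
    obtain ⟨i, hi, h6⟩ := exists_dominated_of_coloring hα hA hN hS.card_pos h3
    refine ⟨i, hi, h6.trans ((smul_le_smul_of_nonneg_left hM (by positivity)).trans ?_)⟩
    refine smul_le_smul_of_nonneg_right ?_ hMn
    rw [div_le_div_iff₀ (by positivity) hS0]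
    have : 8 * (↑N / α) * (α * ↑k) = 8 * N * k := by field_simp
    rw [this]
    linarith

/-- Summing importances along an elimination order gives a harmonic sum. -/
theorem sum_le_harmonic {t : κ → ℝ} {c : ℝ}
    (h : ∀ S : Finset κ, S.Nonempty → ∃ i ∈ S, t i ≤ c / S.card) (S : Finset κ) :
    ∑ i ∈ S, t i ≤ c * harmonic S.card := by
  induction hs : S.card generalizing S with
  | zero =>
    rw [Finset.card_eq_zero] at hs
    simp [hs]
  | succ m ih =>
    obtain ⟨i, hi, hti⟩ := h S (Finset.card_pos.1 (by omega))
    have h1 := ih (S.erase i) (by rw [Finset.card_erase_of_mem hi]; omega)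
    rw [← Finset.add_sum_erase _ _ hi, harmonic_succ]
    rw [hs] at hti
    push_cast at hti ⊢
    rw [div_eq_mul_inv] at hti
    linarith

theorem one_le_logPlus (x : ℝ) : 1 ≤ logPlus x := le_max_left _ _

theorem log_le_logPlus (x : ℝ) : Real.log x ≤ logPlus x := le_max_right _ _

theorem logPlus_mono {x y : ℝ} (hx : 0 < x) (h : x ≤ y) : logPlus x ≤ logPlus y :=
  max_le_max le_rfl (Real.log_le_log hx h)

theorem minRatio_nonneg (A : κ → Matrix (Fin n) (Fin n) ℝ) : 0 ≤ minRatio A := by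
  refine Real.sInf_nonneg ?_
  rintro _ ⟨α, hα, rfl⟩
  exact div_nonneg (Nat.cast_nonneg _) hα.1.le

theorem one_le_minRatio [Fintype κ] (A : κ → Matrix (Fin n) (Fin n) ℝ) : 1 ≤ minRatio A := by
  obtain ⟨α, hα, h⟩ := (isLeast_minRatio A).1
  rw [← h]
  have h1 : (1 : ℝ) ≤ connParam α A := by exact_mod_cast connParam_pos α A
  simp only
  rw [le_div_iff₀ hα.1]
  linarith [hα.2]

/-- The total importance is at most a logarithm times the connectivity ratio. -/
theorem sum_le_minRatio [Fintype κ] {A : κ → Matrix (Fin n) (Fin n) ℝ} (hA : ∀ i, 0 ≤ A i)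
    {t : κ → ℝ} (ht : ∀ i, ∀ τ : ℝ, 0 ≤ τ → A i ≤ τ • ∑ j, A j → t i ≤ 2 * τ) :
    ∑ i, t i ≤ 32 * (logPlus (Fintype.card κ) * minRatio A) := by
  obtain ⟨α, hα, h⟩ := (isLeast_minRatio A).1
  have hr := minRatio_nonneg A
  rcases isEmpty_or_nonempty κ with he | he
  · simp only [Finset.univ_eq_empty, Finset.sum_empty]
    have := one_le_logPlus (Fintype.card κ)
    positivity
  -- The constant is 16 = 2 · 8, from the factor two in the estimate t and the 8 of
  -- `exists_le_smul_sum`; the harmonic number contributes at most 2 logPlus, hence 32 in total.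
  have h1 := sum_le_harmonic (t := t) (c := 16 * minRatio A) (fun S hS => by
    obtain ⟨i, hi, h2⟩ := exists_le_smul_sum hα.1 hα.2 hA (connParam_pos α A)
      (isThreshold_connParam α A) hS
    refine ⟨i, hi, ?_⟩
    simp only at h
    rw [h] at h2
    have := ht i _ (by positivity) h2
    calc _ ≤ _ := this
      _ = _ := by ring) Finset.univ
  have h2 := harmonic_le_one_add_log (Fintype.card κ)
  rw [Finset.card_univ] at h1
  have h3 := one_le_logPlus (Fintype.card κ)
  have h4 := log_le_logPlus (Fintype.card κ)
  calc _ ≤ _ := h1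
    _ ≤ 16 * minRatio A * (2 * logPlus (Fintype.card κ)) := by gcongr; linarith
    _ = _ := by ring

theorem IsThreshold.comp_injective {κ' : Type*} [DecidableEq κ'] {α : ℝ}
    {A : κ → Matrix (Fin n) (Fin n) ℝ} {N : ℕ} (hN : IsThreshold α A N) {f : κ' → κ}
    (hf : Function.Injective f) : IsThreshold α (fun i => A (f i)) N := by
  intro S hS
  obtain ⟨i, hi, h⟩ := hN (S.map ⟨f, hf⟩) (by simpa using hS)
  rw [Finset.mem_map] at hi
  obtain ⟨j, hj, rfl⟩ := hi
  refine ⟨j, hj, h.trans (le_of_eq ?_)⟩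
  rw [← Finset.map_erase, Finset.sum_map]
  rfl

theorem minRatio_comp_injective_le [Fintype κ] {κ' : Type*} [DecidableEq κ'] [Fintype κ']
    (A : κ → Matrix (Fin n) (Fin n) ℝ) {f : κ' → κ} (hf : Function.Injective f) :
    minRatio (fun i => A (f i)) ≤ minRatio A := by
  obtain ⟨α, hα, h⟩ := (isLeast_minRatio A).1
  rw [← h]
  refine ((isLeast_minRatio fun i => A (f i)).2 ⟨α, hα, rfl⟩).trans ?_
  have := connParam_le ((isThreshold_connParam α A).comp_injective hf)
  have hα0 := hα.1
  simp only
  gcongr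

variable {r : ℕ}

theorem eq_zero_of_rank_eq_zero {M : Matrix (Fin n) (Fin n) ℝ} (h : M.rank = 0) : M = 0 := by
  rw [Matrix.rank, Submodule.finrank_eq_zero, LinearMap.range_eq_bot] at h
  ext i j
  have := congrFun (LinearMap.congr_fun h (Pi.single j 1)) i
  simpa using this

/-- Each of the three factors is monotone; a threshold for the whole family is one for every
subfamily. The nonzero member makes |T| and the rank positive, as monotonicity of the logarithm
requires. -/
theorem localBound_le_globalBound (A : Fin r → Matrix (Fin n) (Fin n) ℝ)
    (hA : ∀ i, (A i).PosSemidef) {T : Finset (Fin r)} (hT : ∃ i ∈ T, A i ≠ 0) :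
    localBound A T ≤ globalBound A := by
  unfold localBound globalBound
  obtain ⟨i, hi, hne⟩ := hT
  have hA' : ∀ i, 0 ≤ A i := fun i => Matrix.nonneg_iff_posSemidef.2 (hA i)
  have h1 : logPlus T.card ≤ logPlus r := by
    refine logPlus_mono (by exact_mod_cast Finset.card_pos.2 ⟨i, hi⟩) ?_
    have := T.card_le_univ
    rw [Fintype.card_fin] at this
    exact_mod_cast this
  have h2 : logPlus (∑ i ∈ T, A i).rank ≤ logPlus n := by
    refine logPlus_mono ?_ ?_
    · have : (∑ i ∈ T, A i).rank ≠ 0 := by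
        intro h0
        replace h0 := eq_zero_of_rank_eq_zero h0
        have h3 : A i ≤ ∑ i ∈ T, A i := Finset.single_le_sum (fun j _ => hA' j) hi
        exact hne (le_antisymm (h3.trans h0.le) (hA' i))
      exact_mod_cast Nat.pos_of_ne_zero this
    · exact_mod_cast (Matrix.rank_le_width _)
  have h3 := minRatio_comp_injective_le A (f := fun i : T => (i : Fin r)) Subtype.val_injective
  have h4 := minRatio_nonneg (fun i : T => A i)
  have h5 := one_le_logPlus T.card
  have h6 := one_le_logPlus (∑ i ∈ T, A i).rank
  have h7 := one_le_logPlus n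
  have h8 := one_le_logPlus r
  gcongr

/-- At ε = 0.99 the right side of the defining equation is 1/199, which already exceeds a(1 + a) for
a = 1/250. -/
theorem alphaEps_bounds {ε : ℝ} (h0 : 0 ≤ ε) (h1 : ε ≤ 0.99) :
    1 / 250 ≤ alphaEps ε ∧ alphaEps ε ≤ 1 := by
  obtain ⟨⟨h2, h3⟩, h4⟩ := (alphaEps_iff h0 (by norm_num at h1 ⊢; linarith) (alphaEps ε)).1 rfl
  refine ⟨?_, h3⟩
  by_contra! h
  have h5 : (1 - ε) / (1 + ε) ≥ 1 / 199 := by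
    rw [ge_iff_le, div_le_div_iff₀ (by norm_num) (by linarith)]
    norm_num at h1
    linarith
  nlinarith

theorem globalBound_le_connThreshold {ε : ℝ} (h0 : 0 ≤ ε) (h1 : ε ≤ 0.99)
    (A : Fin r → Matrix (Fin n) (Fin n) ℝ) :
    globalBound A ≤ 250 * (logPlus r * logPlus n * connThreshold ε A) := by
  obtain ⟨h2, h3⟩ := alphaEps_bounds h0 h1
  have h4 := (isLeast_minRatio A).2 ⟨alphaEps ε, ⟨by linarith, h3⟩, rfl⟩
  simp only at h4
  have h5 : (connParam (alphaEps ε) A : ℝ) / alphaEps ε ≤ 250 * connThreshold ε A := by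
    rw [div_le_iff₀ (by linarith), connThreshold]
    have : (0 : ℝ) ≤ connParam (alphaEps ε) A := Nat.cast_nonneg _
    nlinarith
  have h6 := one_le_logPlus r
  have h7 := one_le_logPlus n
  calc globalBound A = logPlus r * logPlus n * minRatio A := rfl
    _ ≤ logPlus r * logPlus n * (250 * connThreshold ε A) := by
        gcongr
        exact h4.trans h5
    _ = _ := by ring

/-- Only the local size bound has to be proved. The global one follows by monotonicity, and the
bound by the connectivity threshold by inserting α_ε, which is at least 1/250; this is the factor
250. -/
theorem goodWeights_of_local {A : Fin r → Matrix (Fin n) (Fin n) ℝ}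
    (hA : ∀ i, (A i).PosSemidef) {T : Finset (Fin r)} (hT : ∃ i ∈ T, A i ≠ 0) {ε C : ℝ}
    (hε : 0 ≤ ε) (hC : 0 ≤ C) {μ : T → ℝ} (hμ : ∀ i, 0 ≤ μ i)
    (hl : (1 - ε) • ∑ i : T, A i ≤ ∑ i : T, μ i • A i)
    (hu : ∑ i : T, μ i • A i ≤ (1 + ε) • ∑ i : T, A i)
    (hc : ε ^ 2 * (Function.support μ).ncard ≤ C * localBound A T) :
    GoodWeights (250 * C) A ε T μ := by
  have h1 := localBound_le_globalBound A hA hT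
  have h0 : 0 ≤ localBound A T := by
    have h4 := minRatio_nonneg (fun i : T => A i)
    have h5 := one_le_logPlus T.card
    have h6 := one_le_logPlus (∑ i ∈ T, A i).rank
    unfold localBound
    positivity
  have h2 : C * localBound A T ≤ C * globalBound A := by gcongr
  refine ⟨hμ, hl, hu, ?_, ?_, fun h => ?_⟩
  · nlinarith
  · nlinarith
  · have := globalBound_le_connThreshold hε h A
    nlinarith

end ConnectivityBounds

/-! ### Full rank factorization, generalized inverses, and norm estimates from traces. -/

section Factorization

open Matrix

variable {n : ℕ}

theorem exists_eq_mul_transpose {ι : Type*} [Fintype ι] [DecidableEq ι] {A : Matrix ι ι ℝ}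
    (hA : 0 ≤ A) : ∃ R : Matrix ι ι ℝ, A = R * Rᵀ := by
  obtain ⟨U, z, h1, h2, rfl⟩ := exists_diagonalization (isHermitian_of_nonneg hA)
  have hz : ∀ i, 0 ≤ z i := le_eigenvalue h1 (by simpa using hA)
  refine ⟨U * diagonal fun i => Real.sqrt (z i), ?_⟩
  rw [transpose_mul, diagonal_transpose, ← Matrix.mul_assoc,
    Matrix.mul_assoc U (diagonal _) (diagonal _), diagonal_mul_diagonal]
  simp only [Real.mul_self_sqrt (hz _)]

/-- With A = RRᵀ the hypothesis reads (KR)(KR)ᵀ = 0, so KR = 0. -/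
theorem mul_eq_zero_of_mul_mul_transpose {ι κ : Type*} [Fintype ι] [DecidableEq ι] [Fintype κ]
    {A : Matrix ι ι ℝ} (hA : 0 ≤ A) {K : Matrix κ ι ℝ} (h : K * A * Kᵀ = 0) : K * A = 0 := by
  obtain ⟨R, rfl⟩ := exists_eq_mul_transpose hA
  have h1 : (K * R) * (K * R)ᴴ = 0 := by
    rw [conjTranspose_eq_transpose_of_trivial, transpose_mul, ← h]
    simp only [Matrix.mul_assoc]
  rw [self_mul_conjTranspose_eq_zero] at h1
  rw [← Matrix.mul_assoc, h1, Matrix.zero_mul]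

theorem mul_mul_transpose_nonneg {ι κ : Type*} [Fintype ι] [Fintype κ]
    {A : Matrix ι ι ℝ} (hA : 0 ≤ A) (K : Matrix κ ι ℝ) : 0 ≤ K * A * Kᵀ := by
  rw [nonneg_iff_posSemidef] at *
  have := hA.mul_mul_conjTranspose_same K
  rwa [conjTranspose_eq_transpose_of_trivial] at this

theorem mul_mul_transpose_mono {ι κ : Type*} [Fintype ι] [Fintype κ]
    {A B : Matrix ι ι ℝ} (h : A ≤ B) (K : Matrix κ ι ℝ) : K * A * Kᵀ ≤ K * B * Kᵀ := by
  rw [← sub_nonneg, ← Matrix.sub_mul, ← Matrix.mul_sub]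
  exact mul_mul_transpose_nonneg (sub_nonneg.2 h) K

/-- A full rank factorization `M = F Fᵀ` of a positive semidefinite matrix with a left inverse `G`
of `F`; the matrices dominated by `M` are the `F B Fᵀ`. -/
theorem exists_factorization {M : Matrix (Fin n) (Fin n) ℝ} (hM : 0 ≤ M) :
    ∃ (ι : Type) (_ : Fintype ι) (_ : DecidableEq ι) (F : Matrix (Fin n) ι ℝ)
      (G : Matrix ι (Fin n) ℝ), M = F * Fᵀ ∧ G * F = 1 ∧ Fintype.card ι = M.rank ∧
      ∀ A : Matrix (Fin n) (Fin n) ℝ, 0 ≤ A → A ≤ M → F * (G * A * Gᵀ) * Fᵀ = A := by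
  obtain ⟨U, z, h1, h2, hU⟩ := exists_diagonalization (isHermitian_of_nonneg hM)
  have hz : ∀ i, 0 ≤ z i := le_eigenvalue h1 (by rw [← hU]; simpa using hM)
  -- Only the eigenvectors with nonzero eigenvalue are kept, each scaled by the root of its
  -- eigenvalue, so that the number of columns is the rank.
  let F : Matrix (Fin n) {i // z i ≠ 0} ℝ := of fun a i => U a i * Real.sqrt (z i)
  let G : Matrix {i // z i ≠ 0} (Fin n) ℝ := of fun i a => U a i / Real.sqrt (z i)
  have hMF : M = F * Fᵀ := by
    ext a b
    rw [hU, mul_apply, mul_apply]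
    simp only [mul_diagonal, transpose_apply, F, of_apply]
    have : ∀ i : {i // z i ≠ 0}, U a i * Real.sqrt (z i) * (U b i * Real.sqrt (z i))
        = U a i * z i * U b i := by
      intro i
      nth_rw 3 [← Real.mul_self_sqrt (hz i)]
      ring
    rw [Finset.sum_congr rfl fun i _ => this i,
      ← Finset.sum_subtype (Finset.univ.filter fun i => z i ≠ 0) (by simp)
        fun i => U a i * z i * U b i, Finset.sum_filter]
    refine Finset.sum_congr rfl fun i _ => ?_
    by_cases h : z i = 0 <;> simp [h]
  have hGF : G * F = 1 := by
    ext i j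
    simp only [mul_apply, F, G, of_apply]
    have h3 : ∀ i j, ∑ a, U a i * U a j = (1 : Matrix (Fin n) (Fin n) ℝ) i j := by
      intro i j
      rw [← h1]
      simp [mul_apply]
    have h4 : ∀ a, U a i / Real.sqrt (z i) * (U a j * Real.sqrt (z j))
        = U a i * U a j * (Real.sqrt (z j) / Real.sqrt (z i)) := fun a => by ring
    simp only [h4]
    rw [← Finset.sum_mul, h3]
    have h5 : Real.sqrt (z i) ≠ 0 := (Real.sqrt_pos.2 ((hz i).lt_of_ne' i.2)).ne'
    by_cases h : i = j
    · subst h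
      simp [h5]
    · simp [h, Subtype.val_injective.ne h]
  refine ⟨{i // z i ≠ 0}, inferInstance, inferInstance, F, G, hMF, hGF, ?_, fun A hA hAM => ?_⟩
  · rw [hMF, rank_self_mul_transpose]
    refine le_antisymm ?_ (rank_le_card_width F)
    have := rank_mul_le_right G F
    rwa [hGF, rank_one] at this
  -- K annihilates M, and 0 ≤ A ≤ M squeezes K A Kᵀ to zero; hence K A = 0 and FG fixes A from both
  -- sides.
  · set K := 1 - F * G with hK
    have hKM : K * M = 0 := by
      rw [hMF, hK, Matrix.sub_mul, Matrix.one_mul, ← Matrix.mul_assoc, Matrix.mul_assoc F G F, hGF,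
        Matrix.mul_one, sub_self]
    have h6 : K * A * Kᵀ = 0 := by
      refine le_antisymm ?_ (mul_mul_transpose_nonneg hA K)
      have := mul_mul_transpose_mono hAM K
      rwa [hKM, Matrix.zero_mul] at this
    have h7 := mul_eq_zero_of_mul_mul_transpose hA h6
    rw [hK, Matrix.sub_mul, Matrix.one_mul, sub_eq_zero] at h7
    have h8 : A = A * (F * G)ᵀ := by
      have := congrArg transpose h7
      rw [transpose_mul] at this
      have hAt : Aᵀ = A := by
        simpa [conjTranspose_eq_transpose_of_trivial] using (isHermitian_of_nonneg hA).eq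
      rwa [hAt] at this
    calc F * (G * A * Gᵀ) * Fᵀ = (F * G * A) * (F * G)ᵀ := by
          rw [transpose_mul]; simp only [Matrix.mul_assoc]
      _ = A := by rw [← h7, ← h8]

/-- `H` is a reflexive symmetric generalized inverse of `M`. -/
structure IsGenInv (M H : Matrix (Fin n) (Fin n) ℝ) : Prop where
  symm : Hᵀ = H
  inner : H * M * H = H
  outer : M * H * M = M

/-- `H` is a generalized inverse of `M` as far as the first `k` columns of `M` are concerned. -/
structure IsPartialGenInv (M H : Matrix (Fin n) (Fin n) ℝ) (k : ℕ) : Prop where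
  symm : Hᵀ = H
  inner : H * M * H = H
  outer : ∀ j : Fin n, (j : ℕ) < k → ∀ i, (M * H * M) i j = M i j

theorem IsPartialGenInv.zero (M : Matrix (Fin n) (Fin n) ℝ) : IsPartialGenInv M 0 0 :=
  ⟨by simp, by simp, by simp⟩

theorem IsPartialGenInv.isGenInv {M H : Matrix (Fin n) (Fin n) ℝ} (h : IsPartialGenInv M H n) :
    IsGenInv M H :=
  ⟨h.symm, h.inner, by ext i j; exact h.outer j j.2 i⟩

/-- One elimination step. The defect E = M - MHM equals JᵀMJ with J = 1 - HM, so it is positive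
semidefinite, and the update replaces it by E minus the rank-one matrix built from its column k and
pivot d = E k k. This clears column k and leaves earlier columns zero. The relation H M H = H
survives because H M J = 0. -/
theorem IsPartialGenInv.succ {M H : Matrix (Fin n) (Fin n) ℝ} (hM : 0 ≤ M) {k : ℕ} (hk : k < n)
    (h : IsPartialGenInv M H k) :
    IsPartialGenInv M (H + (M ⟨k, hk⟩ ⟨k, hk⟩ - (M * (H * M)) ⟨k, hk⟩ ⟨k, hk⟩)⁻¹ •
      of fun j l => (1 - H * M) j ⟨k, hk⟩ * (1 - H * M) l ⟨k, hk⟩) (k + 1) := by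
  set κ : Fin n := ⟨k, hk⟩ with hκ
  have hMt : Mᵀ = M := by
    simpa [conjTranspose_eq_transpose_of_trivial] using (isHermitian_of_nonneg hM).eq
  set P : Matrix (Fin n) (Fin n) ℝ := single κ κ 1 with hP
  set J := 1 - H * M with hJ
  have hJt : Jᵀ = 1 - M * H := by
    rw [hJ, transpose_sub, transpose_mul, hMt, h.symm, transpose_one]
  set E := M - M * H * M with hE
  have hEE : Jᵀ * M * J = E := by
    have h1 : M * H * M * H * M = M * H * M := by
      calc M * H * M * H * M = M * (H * M * H) * M := by simp only [Matrix.mul_assoc]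
        _ = _ := by rw [h.inner]
    rw [hJt, hJ, hE]
    calc (1 - M * H) * M * (1 - H * M)
        = M - M * H * M - (M * H * M - M * H * M * H * M) := by noncomm_ring
      _ = _ := by rw [h1, sub_self, sub_zero]
  have hE0 : 0 ≤ E := by
    rw [← hEE]
    simpa using mul_mul_transpose_nonneg hM Jᵀ
  have hEt : Eᵀ = E := by
    simpa [conjTranspose_eq_transpose_of_trivial] using (isHermitian_of_nonneg hE0).eq
  have hMJ : M * J = E := by rw [hJ, hE, Matrix.mul_sub, Matrix.mul_one, Matrix.mul_assoc]
  have hJM : Jᵀ * M = E := by rw [hJt, hE, Matrix.sub_mul, Matrix.one_mul]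
  have hHMJ : H * M * J = 0 := by
    rw [hJ, Matrix.mul_sub, Matrix.mul_one, ← Matrix.mul_assoc, h.inner, sub_self]
  have hJMH : Jᵀ * M * H = 0 := by
    have := congrArg transpose hHMJ
    rw [transpose_mul, transpose_mul, hMt, h.symm, transpose_zero, ← Matrix.mul_assoc] at this
    exact this
  set d := M κ κ - (M * (H * M)) κ κ with hd
  have hdE : d = E κ κ := by rw [hd, hE, Matrix.sub_apply, Matrix.mul_assoc]
  have hPEP : P * E * P = d • P := by
    rw [hdE, hP]
    ext i j
    simp [single_mul_mul_single, single_apply]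
  have hW : (of fun j l => J j κ * J l κ : Matrix (Fin n) (Fin n) ℝ) = J * P * Jᵀ := by
    ext j l
    simp [hP, mul_apply, single_apply, transpose_apply, ite_and]
  have hPt : Pᵀ = P := by simp [hP]
  rw [hW]
  have hMHM : M * (H + d⁻¹ • (J * P * Jᵀ)) * M = M * H * M + d⁻¹ • (E * P * E) := by
    rw [Matrix.mul_add, Matrix.add_mul, Matrix.mul_smul, Matrix.smul_mul]
    congr 2
    calc M * (J * P * Jᵀ) * M = (M * J) * P * (Jᵀ * M) := by simp only [Matrix.mul_assoc]
      _ = _ := by rw [hMJ, hJM]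
  refine ⟨?_, ?_, ?_⟩
  · rw [transpose_add, transpose_smul, transpose_mul, transpose_mul, transpose_transpose, hPt,
      h.symm, Matrix.mul_assoc]
  · have e1 : H * M * (J * P * Jᵀ) = 0 := by
      rw [← Matrix.mul_assoc, ← Matrix.mul_assoc, hHMJ]; simp
    have e2 : J * P * Jᵀ * M * H = 0 := by
      calc J * P * Jᵀ * M * H = J * P * (Jᵀ * M * H) := by simp only [Matrix.mul_assoc]
        _ = 0 := by rw [hJMH, Matrix.mul_zero]
    have e3 : J * P * Jᵀ * M * (J * P * Jᵀ) = d • (J * P * Jᵀ) := by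
      calc J * P * Jᵀ * M * (J * P * Jᵀ) = J * (P * (Jᵀ * M * J) * P) * Jᵀ := by
            simp only [Matrix.mul_assoc]
        _ = _ := by rw [hEE, hPEP, Matrix.mul_smul, Matrix.smul_mul]
    simp only [Matrix.add_mul, Matrix.mul_add, Matrix.smul_mul, Matrix.mul_smul, h.inner, e1, e2,
      e3, smul_zero, add_zero, zero_add, smul_smul]
    congr 2
    by_cases h0 : d = 0
    · simp [h0]
    · field_simp
  · intro j hj i
    rw [hMHM]
    have e4 : (M * H * M) i j = M i j - E i j := by simp [hE]
    have e5 : (E * P * E) i j = E i κ * E κ j := by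
      simp [hP, mul_apply, single_apply, ite_and]
    rw [Matrix.add_apply, Matrix.smul_apply, e4, e5, smul_eq_mul]
    rcases Nat.lt_succ_iff_lt_or_eq.1 hj with hj | hj
    · have h1 : ∀ i, E i j = 0 := fun i => by rw [hE, Matrix.sub_apply, h.outer j hj i, sub_self]
      rw [h1, h1]
      ring
    · obtain rfl : j = κ := Fin.ext hj
      rw [← hdE]
      -- With pivot zero the update vanishes, as 0⁻¹ = 0. This is right: a positive semidefinite
      -- matrix with a zero diagonal entry has a zero column there, so column k of E is already
      -- clear.
      by_cases h0 : d = 0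
      · have h2 : P * E * Pᵀ = 0 := by rw [hPt, hPEP, h0, zero_smul]
        have h3 := mul_eq_zero_of_mul_mul_transpose hE0 h2
        have h4 : E κ i = 0 := by
          have := congrFun (congrFun h3 κ) i
          simpa [hP, mul_apply, single_apply, ite_and] using this
        have h5 : E i κ = E κ i := by
          have := congrFun (congrFun hEt κ) i
          simpa using this
        simp [h5, h4]
      · field_simp
        ring

section Normalized

variable {ι : Type} [Fintype ι] [DecidableEq ι] {M H : Matrix (Fin n) (Fin n) ℝ}
  {F : Matrix (Fin n) ι ℝ} {G : Matrix ι (Fin n) ℝ}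

/-- In the coordinates of F every generalized inverse of M becomes the identity: multiplying by GF =
1 on the left and by its transpose on the right reduces the claim to M H M = M. -/
theorem IsGenInv.transpose_mul_mul (h : IsGenInv M H) (hMF : M = F * Fᵀ) (hGF : G * F = 1) :
    Fᵀ * H * F = 1 := by
  have hGF' : Fᵀ * Gᵀ = 1 := by rw [← transpose_mul, hGF, transpose_one]
  calc Fᵀ * H * F = (G * F) * (Fᵀ * H * F) * (Fᵀ * Gᵀ) := by rw [hGF, hGF']; simp
    _ = G * ((F * Fᵀ) * H * (F * Fᵀ)) * Gᵀ := by simp only [Matrix.mul_assoc]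
    _ = (G * F) * (Fᵀ * Gᵀ) := by rw [← hMF, h.outer, hMF]; simp only [Matrix.mul_assoc]
    _ = 1 := by rw [hGF, hGF', Matrix.one_mul]

/-- The factors Fᵀ H F between consecutive copies of X cancel. Traces in the normalized coordinates
thus become computable without knowing F. The exponent must be positive, since the zeroth powers
have traces equal to the two, possibly different, dimensions. -/
theorem trace_conj_pow (hFHF : Fᵀ * H * F = 1) (X : Matrix ι ι ℝ) (k : ℕ) :
    ((F * X * Fᵀ * H) ^ (k + 1)).trace = (X ^ (k + 1)).trace := by
  have h1 : ∀ k : ℕ, (F * X * Fᵀ * H) ^ (k + 1) = F * X ^ (k + 1) * (Fᵀ * H) := by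
    intro k
    induction k with
    | zero => simp [Matrix.mul_assoc]
    | succ k ih =>
      rw [pow_succ, ih, pow_succ X (k + 1)]
      calc F * X ^ (k + 1) * (Fᵀ * H) * (F * X * Fᵀ * H)
          = F * X ^ (k + 1) * (Fᵀ * H * F) * X * (Fᵀ * H) := by simp only [Matrix.mul_assoc]
        _ = _ := by rw [hFHF]; simp only [Matrix.mul_assoc, Matrix.one_mul]
  rw [h1, Matrix.mul_assoc, trace_mul_comm, Matrix.mul_assoc, hFHF, Matrix.mul_one]

theorem IsGenInv.trace_mul (h : IsGenInv M H) (hM : 0 ≤ M) : (M * H).trace = M.rank := by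
  obtain ⟨ι, _, _, F, G, hMF, hGF, hcard, -⟩ := exists_factorization hM
  have := trace_conj_pow (h.transpose_mul_mul hMF hGF) 1 0
  rw [Matrix.mul_one, ← hMF, zero_add, pow_one, pow_one, trace_one, hcard] at this
  exact this

end Normalized

theorem trace_pow_eq_sum {ι : Type*} [Fintype ι] [DecidableEq ι] {U : Matrix ι ι ℝ} {z : ι → ℝ}
    (h1 : Uᵀ * U = 1) (h2 : U * Uᵀ = 1) (p : ℕ) :
    ((U * diagonal z * Uᵀ) ^ p).trace = ∑ i, z i ^ p := by
  rw [pow_conj_diagonal h1 h2, trace_mul_comm, ← Matrix.mul_assoc, h1, Matrix.one_mul,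
    trace_diagonal]

/-- The ratio of consecutive trace powers estimates the largest eigenvalue. -/
theorem le_two_mul_ratio {ι : Type*} [Fintype ι] {z : ι → ℝ} (hz : ∀ i, 0 ≤ z i) {p : ℕ}
    (hp : (Fintype.card ι : ℝ) ≤ 2 ^ p) (i : ι) :
    z i ≤ 2 * ((∑ j, z j ^ (p + 1)) / ∑ j, z j ^ p) := by
  classical
  have hne : (Finset.univ : Finset ι).Nonempty := ⟨i, Finset.mem_univ i⟩
  obtain ⟨m, -, hm⟩ := Finset.exists_max_image Finset.univ z hne
  set l := z m with hl
  refine (hm i (Finset.mem_univ i)).trans ?_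
  rcases (hz m).eq_or_lt with h0 | h0
  · rw [hl, ← h0]
    have h1 : 0 ≤ ∑ j, z j ^ (p + 1) := Finset.sum_nonneg fun j _ => pow_nonneg (hz j) _
    have h2 : 0 ≤ ∑ j, z j ^ p := Finset.sum_nonneg fun j _ => pow_nonneg (hz j) _
    positivity
  have hS : 0 < ∑ j, z j ^ p :=
    (pow_pos h0 p).trans_le (Finset.single_le_sum (f := fun j => z j ^ p)
      (fun j _ => pow_nonneg (hz j) _) (Finset.mem_univ m))
  rw [← mul_div_assoc, le_div_iff₀ hS]
  -- Only eigenvalues below l/2 contribute positively, each at most l^(p+1)/2^p, and there are at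
  -- most 2^p of them; the largest eigenvalue alone contributes -l^(p+1), which outweighs them
  -- together.
  have key : ∀ j, z j ^ p * (l - 2 * z j) ≤ l ^ (p + 1) / 2 ^ p - if j = m then l ^ (p + 1) else 0 := by
    intro j
    have h3 : (0 : ℝ) ≤ l ^ (p + 1) / 2 ^ p := by positivity
    split_ifs with hj
    · subst hj
      rw [← hl, pow_succ] at *
      nlinarith
    · rw [sub_zero]
      rcases le_total l (2 * z j) with h | h
      · exact (mul_nonpos_of_nonneg_of_nonpos (pow_nonneg (hz j) p) (by linarith)).trans h3
      · have h4 : z j ^ p ≤ (l / 2) ^ p := pow_le_pow_left₀ (hz j) (by linarith) p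
        calc z j ^ p * (l - 2 * z j) ≤ (l / 2) ^ p * l :=
              mul_le_mul h4 (by linarith [hz j]) (by linarith) (by positivity)
          _ = _ := by rw [div_pow, pow_succ]; ring
  have h5 := Finset.sum_le_sum fun j (_ : j ∈ Finset.univ) => key j
  rw [Finset.sum_sub_distrib, Finset.sum_const, Finset.sum_ite_eq' Finset.univ m,
    if_pos (Finset.mem_univ m), Finset.card_univ, nsmul_eq_mul] at h5
  have h6 : (Fintype.card ι : ℝ) * (l ^ (p + 1) / 2 ^ p) ≤ l ^ (p + 1) := by
    calc (Fintype.card ι : ℝ) * (l ^ (p + 1) / 2 ^ p) ≤ 2 ^ p * (l ^ (p + 1) / 2 ^ p) := by gcongr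
      _ = _ := by field_simp
  have h7 : ∑ j, z j ^ p * (l - 2 * z j) = l * (∑ j, z j ^ p) - 2 * ∑ j, z j ^ (p + 1) := by
    rw [Finset.mul_sum, Finset.mul_sum, ← Finset.sum_sub_distrib]
    refine Finset.sum_congr rfl fun j _ => ?_
    ring
  linarith

theorem two_mul_ratio_le {ι : Type*} [Fintype ι] {z : ι → ℝ} (hz : ∀ i, 0 ≤ z i) (p : ℕ) {τ : ℝ}
    (hτ : 0 ≤ τ) (h : ∀ i, z i ≤ τ) :
    2 * ((∑ j, z j ^ (p + 1)) / ∑ j, z j ^ p) ≤ 2 * τ := by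
  have h2 : 0 ≤ ∑ j, z j ^ p := Finset.sum_nonneg fun j _ => pow_nonneg (hz j) _
  gcongr
  refine div_le_of_le_mul₀ h2 hτ ?_
  rw [Finset.mul_sum]
  refine Finset.sum_le_sum fun j _ => ?_
  rw [pow_succ, mul_comm]
  gcongr
  · exact pow_nonneg (hz j) p
  · exact h j

/-- The importance estimate computed from traces. -/
noncomputable def importance (H A : Matrix (Fin n) (Fin n) ℝ) (p : ℕ) : ℝ :=
  2 * (((A * H) ^ (p + 1)).trace / ((A * H) ^ p).trace)

section Importance

variable {ι : Type} [Fintype ι] [DecidableEq ι] {H : Matrix (Fin n) (Fin n) ℝ}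
  {F : Matrix (Fin n) ι ℝ}

/-- The estimate lies between ‖B‖ and 2‖B‖. The lower bound keeps the sampling probabilities large
enough for the concentration argument, the upper bound keeps their sum small. For B = 0 the quotient
0/0 = 0 is the correct value. -/
theorem importance_conj (hFHF : Fᵀ * H * F = 1) {B : Matrix ι ι ℝ} (hB : 0 ≤ B) {k : ℕ}
    (hp : (Fintype.card ι : ℝ) ≤ 2 ^ (k + 1)) :
    0 ≤ importance H (F * B * Fᵀ) (k + 1) ∧
      B ≤ importance H (F * B * Fᵀ) (k + 1) • 1 ∧
      ∀ τ : ℝ, 0 ≤ τ → B ≤ τ • 1 → importance H (F * B * Fᵀ) (k + 1) ≤ 2 * τ := by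
  obtain ⟨U, z, h1, h2, rfl⟩ := exists_diagonalization (isHermitian_of_nonneg hB)
  have hz : ∀ i, 0 ≤ z i := le_eigenvalue h1 (by simpa using hB)
  unfold importance
  rw [trace_conj_pow hFHF, trace_conj_pow hFHF, trace_pow_eq_sum h1 h2, trace_pow_eq_sum h1 h2]
  refine ⟨?_, ?_, fun τ hτ h => two_mul_ratio_le hz _ hτ (eigenvalue_le h1 h)⟩
  · have h3 : ∀ p, 0 ≤ ∑ j, z j ^ p := fun p => Finset.sum_nonneg fun j _ => pow_nonneg (hz j) _
    have := h3 (k + 1)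
    have := h3 (k + 1 + 1)
    positivity
  · set t := 2 * ((∑ i, z i ^ (k + 1 + 1)) / ∑ i, z i ^ (k + 1)) with ht
    have e : t • 1 - U * diagonal z * Uᵀ = U * diagonal (fun i => t - z i) * Uᵀ := by
      have e2 : diagonal (fun i => t - z i) = t • 1 - diagonal z := by
        ext i j
        by_cases h : i = j <;> simp [h]
      rw [e2, Matrix.mul_sub, Matrix.sub_mul, Matrix.mul_smul, Matrix.smul_mul, Matrix.mul_one, h2]
    rw [← sub_nonneg, e]
    refine mul_mul_transpose_nonneg (nonneg_iff_posSemidef.2 (PosSemidef.diagonal fun i => ?_)) U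
    exact sub_nonneg.2 (le_two_mul_ratio hz hp i)

end Importance

end Factorization

/-! ### The derandomised rounding and its invariant. -/

section Algorithm

open Matrix

variable {r n : ℕ}

/-- The trace potential of `U` relative to the generalized inverse `H`. -/
noncomputable def potential (H : Matrix (Fin n) (Fin n) ℝ) (p : ℕ) (U : Matrix (Fin n) (Fin n) ℝ) :
    ℝ :=
  ((U * H) ^ p).trace

/-- The probability with which a matrix is kept by the rounding. -/
noncomputable def keepProb (H A : Matrix (Fin n) (Fin n) ℝ) (p : ℕ) : ℝ :=
  min 1 (4 * p * importance H A p)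

/-- `∑_{j < i} μ_j A_j`. -/
def lowSum {m : Type*} (A : Fin r → Matrix m m ℝ) (μ : ℕ → ℝ) (i : ℕ) : Matrix m m ℝ :=
  ∑ j : Fin r, if (j : ℕ) < i then μ j • A j else 0

/-- `∑_{j ≥ i} A_j`. -/
def highSum {E : Type*} [AddCommMonoid E] (A : Fin r → E) (i : ℕ) : E :=
  ∑ j : Fin r, if (j : ℕ) < i then 0 else A j

theorem lowSum_succ {m : Type*} (A : Fin r → Matrix m m ℝ) {μ μ' : ℕ → ℝ} {i : ℕ} (hi : i < r)
    (h : ∀ j < i, μ' j = μ j) : lowSum A μ' (i + 1) = lowSum A μ i + μ' i • A ⟨i, hi⟩ := by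
  unfold lowSum
  have h1 : μ' i • A ⟨i, hi⟩ = ∑ j : Fin r, if j = ⟨i, hi⟩ then μ' j • A j else 0 := by simp
  rw [h1, ← Finset.sum_add_distrib]
  refine Finset.sum_congr rfl fun j _ => ?_
  rcases lt_trichotomy (j : ℕ) i with hj | hj | hj
  · have h2 : j ≠ ⟨i, hi⟩ := fun h => by rw [h] at hj; exact lt_irrefl _ hj
    simp [hj, h2, h j hj, Nat.lt_succ_of_lt hj]
  · have h2 : j = ⟨i, hi⟩ := Fin.ext hj
    simp [h2]
  · have h2 : j ≠ ⟨i, hi⟩ := fun h => by rw [h] at hj; exact lt_irrefl _ hj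
    simp [h2, not_lt.2 hj.le, not_le.2 hj]

theorem highSum_eq_add {E : Type*} [AddCommMonoid E] (A : Fin r → E) {i : ℕ} (hi : i < r) :
    highSum A i = A ⟨i, hi⟩ + highSum A (i + 1) := by
  unfold highSum
  have h1 : A ⟨i, hi⟩ = ∑ j : Fin r, if j = ⟨i, hi⟩ then A j else 0 := by simp
  rw [h1, ← Finset.sum_add_distrib]
  refine Finset.sum_congr rfl fun j _ => ?_
  rcases lt_trichotomy (j : ℕ) i with hj | hj | hj
  · have h2 : j ≠ ⟨i, hi⟩ := fun h => by rw [h] at hj; exact lt_irrefl _ hj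
    simp [hj, h2, Nat.lt_succ_of_lt hj]
  · have h2 : j = ⟨i, hi⟩ := Fin.ext hj
    simp [h2]
  · have h2 : j ≠ ⟨i, hi⟩ := fun h => by rw [h] at hj; exact lt_irrefl _ hj
    simp [h2, not_lt.2 hj.le, not_le.2 hj]

theorem lowSum_nonneg {m : Type*} [Fintype m] [DecidableEq m] {A : Fin r → Matrix m m ℝ}
    (hA : ∀ i, 0 ≤ A i) {μ : ℕ → ℝ} {i : ℕ} (hμ : ∀ j < i, 0 ≤ μ j) : 0 ≤ lowSum A μ i :=
  Finset.sum_nonneg fun j _ => by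
    split_ifs with h
    · exact smul_nonneg (hμ j h) (hA j)
    · exact le_rfl

theorem highSum_nonneg {m : Type*} [Fintype m] [DecidableEq m] {A : Fin r → Matrix m m ℝ}
    (hA : ∀ i, 0 ≤ A i) (i : ℕ) : 0 ≤ highSum A i :=
  Finset.sum_nonneg fun j _ => by
    split_ifs with h
    · exact le_rfl
    · exact hA j

theorem lowSum_conj {m ι : Type*} [Fintype ι] [Fintype m] (F : Matrix m ι ℝ)
    (B : Fin r → Matrix ι ι ℝ) (μ : ℕ → ℝ) (i : ℕ) :
    lowSum (fun j => F * B j * Fᵀ) μ i = F * lowSum B μ i * Fᵀ := by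
  unfold lowSum
  rw [Matrix.mul_sum, Matrix.sum_mul]
  refine Finset.sum_congr rfl fun j _ => ?_
  split_ifs <;> simp

theorem highSum_conj {m ι : Type*} [Fintype ι] [Fintype m] (F : Matrix m ι ℝ)
    (B : Fin r → Matrix ι ι ℝ) (i : ℕ) :
    highSum (fun j => F * B j * Fᵀ) i = F * highSum B i * Fᵀ := by
  unfold highSum
  rw [Matrix.mul_sum, Matrix.sum_mul]
  refine Finset.sum_congr rfl fun j _ => ?_
  split_ifs <;> simp

/-- All of the analysis takes place for the B_i, whereas the program only handles the A_i and H. The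
last clause holds because conjugation by the left inverse of F recovers X and Y. -/
theorem exists_normalization {A : Fin r → Matrix (Fin n) (Fin n) ℝ} (hA : ∀ i, 0 ≤ A i)
    {H : Matrix (Fin n) (Fin n) ℝ} (hH : IsGenInv (∑ i, A i) H) :
    ∃ (ι : Type) (_ : Fintype ι) (_ : DecidableEq ι) (F : Matrix (Fin n) ι ℝ)
      (B : Fin r → Matrix ι ι ℝ), (∀ i, 0 ≤ B i) ∧ ∑ i, B i = 1 ∧ (A = fun i => F * B i * Fᵀ) ∧
      Fᵀ * H * F = 1 ∧ ∑ i, A i = F * Fᵀ ∧ Fintype.card ι = (∑ i, A i).rank ∧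
      ∀ (X Y : Matrix ι ι ℝ), F * X * Fᵀ ≤ F * Y * Fᵀ → X ≤ Y := by
  obtain ⟨ι, _, _, F, G, hMF, hGF, hcard, hdom⟩ :=
    exists_factorization (Finset.sum_nonneg fun i (_ : i ∈ Finset.univ) => hA i)
  have hGF' : Fᵀ * Gᵀ = 1 := by rw [← transpose_mul, hGF, transpose_one]
  have hback : ∀ X : Matrix ι ι ℝ, G * (F * X * Fᵀ) * Gᵀ = X := by
    intro X
    calc G * (F * X * Fᵀ) * Gᵀ = (G * F) * X * (Fᵀ * Gᵀ) := by simp only [Matrix.mul_assoc]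
      _ = X := by rw [hGF, hGF']; simp
  refine ⟨ι, inferInstance, inferInstance, F, fun i => G * A i * Gᵀ,
    fun i => mul_mul_transpose_nonneg (hA i) G, ?_, ?_, hH.transpose_mul_mul hMF hGF, hMF, hcard,
    fun X Y h => ?_⟩
  · rw [← Matrix.sum_mul, ← Matrix.mul_sum, hMF]
    simpa using hback 1
  · funext i
    exact (hdom _ (hA i) (Finset.single_le_sum (fun j _ => hA j) (Finset.mem_univ i))).symm
  · have := mul_mul_transpose_mono h G
    rwa [hback, hback] at this

theorem trace_pow_nonneg_of_even {ι : Type*} [Fintype ι] [DecidableEq ι] {X : Matrix ι ι ℝ}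
    (hX : X.IsHermitian) {p : ℕ} (hp : Even p) : 0 ≤ (X ^ p).trace := by
  obtain ⟨U, z, h1, h2, rfl⟩ := exists_diagonalization hX
  rw [trace_pow_eq_sum h1 h2]
  exact Finset.sum_nonneg fun i _ => hp.pow_nonneg _

/-- The loop invariant of the derandomised rounding after the treatment of the first `i` matrices:
`μ` are the weights chosen so far, `U`, `V` the matrices of the upper and the lower potential, and
`c` the pessimistic estimator of the size of the support. -/
structure RoundInv (A : Fin r → Matrix (Fin n) (Fin n) ℝ) (H : Matrix (Fin n) (Fin n) ℝ) (p : ℕ)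
    (ε : ℝ) (i : ℕ) (μ : ℕ → ℝ) (U V : Matrix (Fin n) (Fin n) ℝ) (c : ℝ) : Prop where
  nonneg : ∀ j < i, 0 ≤ μ j
  upper : U = (8 / ε + (1 + ε / 4))⁻¹ •
    ((8 / ε) • ∑ j, A j + (lowSum A μ i + (1 + ε / 4) • highSum A i))
  lower : V = (8 / ε - (1 - ε / 4))⁻¹ •
    ((8 / ε) • ∑ j, A j - (lowSum A μ i + (1 - ε / 4) • highSum A i))
  count : (((Finset.range i).filter fun j => μ j ≠ 0).card : ℝ)
    + highSum (fun j => keepProb H (A j) p) i ≤ c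
  bound : potential H p U + potential H p V
    + (∑ j, A j).rank * c / ∑ j, keepProb H (A j) p ≤ 3 * (∑ j, A j).rank

theorem keepProb_le_one (H A : Matrix (Fin n) (Fin n) ℝ) (p : ℕ) : keepProb H A p ≤ 1 :=
  min_le_left _ _

/-- The base 1 + ε²/32 is at most 2, so the exponent of the potentials is also large enough for the
norm estimate. -/
theorem card_le_two_pow {ε : ℝ} {m k : ℕ} (hε0 : 0 < ε) (hε1 : ε < 1)
    (hκ : 3 * (m : ℝ) ≤ (1 + ε ^ 2 / 32) ^ (k + 1)) : (m : ℝ) ≤ 2 ^ (k + 1) := by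
  have h1 : (1 + ε ^ 2 / 32) ^ (k + 1) ≤ 2 ^ (k + 1) := by
    gcongr
    nlinarith
  have : (0 : ℝ) ≤ m := Nat.cast_nonneg m
  linarith

section

variable {A : Fin r → Matrix (Fin n) (Fin n) ℝ} {H : Matrix (Fin n) (Fin n) ℝ} {k : ℕ} {ε : ℝ}

theorem importance_nonneg (hA : ∀ i, 0 ≤ A i) (hH : IsGenInv (∑ i, A i) H)
    (hp : ((∑ i, A i).rank : ℝ) ≤ 2 ^ (k + 1)) (i : Fin r) : 0 ≤ importance H (A i) (k + 1) := by
  obtain ⟨ι, _, _, F, B, hB, hB1, hAB, hFHF, hMF, hcard, hinj⟩ := exists_normalization hA hH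
  rw [← hcard] at hp
  rw [hAB]
  exact (importance_conj hFHF (hB i) hp).1

theorem importance_le (hA : ∀ i, 0 ≤ A i) (hH : IsGenInv (∑ i, A i) H)
    (hp : ((∑ i, A i).rank : ℝ) ≤ 2 ^ (k + 1)) (i : Fin r) {τ : ℝ} (hτ : 0 ≤ τ)
    (h : A i ≤ τ • ∑ i, A i) : importance H (A i) (k + 1) ≤ 2 * τ := by
  obtain ⟨ι, _, _, F, B, hB, hB1, hAB, hFHF, hMF, hcard, hinj⟩ := exists_normalization hA hH
  rw [← hcard] at hp
  have hAi : A i = F * B i * Fᵀ := by rw [hAB]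
  rw [hAi]
  refine (importance_conj hFHF (hB i) hp).2.2 τ hτ (hinj _ _ ?_)
  rw [hMF, hAi] at h
  simpa using h

theorem keepProb_nonneg (hA : ∀ i, 0 ≤ A i) (hH : IsGenInv (∑ i, A i) H)
    (hp : ((∑ i, A i).rank : ℝ) ≤ 2 ^ (k + 1)) (i : Fin r) : 0 ≤ keepProb H (A i) (k + 1) := by
  have := importance_nonneg hA hH hp i
  unfold keepProb
  positivity

/-- With nothing decided, both base matrices are M, and each of the three parts of the bound is at
most m: the two potentials are traces of the identity, and the estimator equals the sum of the
probabilities by which it is divided. The earlier contents of the weights are irrelevant. -/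
theorem RoundInv.zero (hε0 : 0 < ε) (hε1 : ε < 1) (hH : IsGenInv (∑ i, A i) H)
    (hA : ∀ i, 0 ≤ A i) (μ : ℕ → ℝ) :
    RoundInv A H (k + 1) ε 0 μ (∑ i, A i) (∑ i, A i) (∑ j, keepProb H (A j) (k + 1)) := by
  have hL : 8 < 8 / ε := by rw [lt_div_iff₀ hε0]; linarith
  have hlow : lowSum A μ 0 = 0 := by simp [lowSum]
  have hhigh : highSum A 0 = ∑ i, A i := by simp [highSum]
  have hb : 8 / ε - (1 - ε / 4) ≠ 0 := by linarith
  have ha : 8 / ε + (1 + ε / 4) ≠ 0 := by positivity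
  refine ⟨by simp, ?_, ?_, by simp [highSum], ?_⟩
  · rw [hlow, hhigh, zero_add, ← add_smul, smul_smul, inv_mul_cancel₀ ha, one_smul]
  · rw [hlow, hhigh, zero_add, ← sub_smul, smul_smul, inv_mul_cancel₀ hb, one_smul]
  · have h1 : potential H (k + 1) (∑ i, A i) = (∑ i, A i).rank := by
      obtain ⟨ι, _, _, F, B, hB, hB1, hAB, hFHF, hMF, hcard, hinj⟩ := exists_normalization hA hH
      have := trace_conj_pow hFHF 1 k
      rw [Matrix.mul_one, ← hMF, one_pow, trace_one, hcard] at this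
      exact this
    rw [h1]
    have h2 : ((∑ i, A i).rank : ℝ) * (∑ j, keepProb H (A j) (k + 1))
        / (∑ j, keepProb H (A j) (k + 1)) ≤ (∑ i, A i).rank := by
      by_cases h : ∑ j, keepProb H (A j) (k + 1) = 0
      · simp [h]
      · rw [mul_div_cancel_right₀ _ h]
    linarith

/-- The values of the two options, averaged with weights q and 1 - q, are at most the current total,
by `round_step` for the potentials and by linearity for the estimator. The smaller value is at most
this average. The candidates are described by the updates that the program performs, so the proof
first rewrites them in terms of the weights. -/
theorem RoundInv.step (hε0 : 0 < ε) (hε1 : ε < 1) (hA : ∀ i, 0 ≤ A i)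
    (hH : IsGenInv (∑ i, A i) H) (hk : Even (k + 1))
    (hκ : 3 * ((∑ i, A i).rank : ℝ) ≤ (1 + ε ^ 2 / 32) ^ (k + 1)) {i : ℕ} (hi : i < r)
    {μ : ℕ → ℝ} {U V : Matrix (Fin n) (Fin n) ℝ} {c : ℝ}
    (h : RoundInv A H (k + 1) ε i μ U V c) {q m Q : ℝ} (hq : q = keepProb H (A ⟨i, hi⟩) (k + 1))
    (hm : m = (∑ i, A i).rank) (hQ : Q = ∑ j, keepProb H (A j) (k + 1))
    {U₀ V₀ U₁ V₁ : Matrix (Fin n) (Fin n) ℝ} {μ' : ℕ → ℝ} (hμ' : ∀ j < i, μ' j = μ j)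
    (hU₀ : U₀ = U - ((8 / ε + (1 + ε / 4))⁻¹ * (1 + ε / 4)) • A ⟨i, hi⟩)
    (hV₀ : V₀ = V + ((8 / ε - (1 - ε / 4))⁻¹ * (1 - ε / 4)) • A ⟨i, hi⟩)
    (hU₁ : U₁ = U₀ + ((8 / ε + (1 + ε / 4))⁻¹ * q⁻¹) • A ⟨i, hi⟩)
    (hV₁ : V₁ = V₀ - ((8 / ε - (1 - ε / 4))⁻¹ * q⁻¹) • A ⟨i, hi⟩) :
    (potential H (k + 1) U₁ + potential H (k + 1) V₁ + m * (c - q + 1) / Q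
        ≤ potential H (k + 1) U₀ + potential H (k + 1) V₀ + m * (c - q) / Q →
      μ' i = q⁻¹ → RoundInv A H (k + 1) ε (i + 1) μ' U₁ V₁ (c - q + 1)) ∧
    (¬ potential H (k + 1) U₁ + potential H (k + 1) V₁ + m * (c - q + 1) / Q
        ≤ potential H (k + 1) U₀ + potential H (k + 1) V₀ + m * (c - q) / Q →
      μ' i = 0 → RoundInv A H (k + 1) ε (i + 1) μ' U₀ V₀ (c - q)) := by
  have hp := card_le_two_pow hε0 hε1 hκ
  have hq0 : 0 ≤ q := hq ▸ keepProb_nonneg hA hH hp ⟨i, hi⟩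
  have hq1 : q ≤ 1 := hq ▸ keepProb_le_one _ _ _
  have hQ0 : 0 ≤ Q := hQ ▸ Finset.sum_nonneg fun j _ => keepProb_nonneg hA hH hp j
  have hm0 : 0 ≤ m := hm ▸ Nat.cast_nonneg _
  have hhq0 : 0 ≤ highSum (fun j => keepProb H (A j) (k + 1)) i :=
    Finset.sum_nonneg fun j _ => by
      split_ifs
      exacts [le_rfl, keepProb_nonneg hA hH hp j]
  have hc0 : 0 ≤ c := le_trans (add_nonneg (Nat.cast_nonneg _) hhq0) h.count
  have hbound := h.bound
  rw [← hm, ← hQ] at hbound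
  have hcQ : 0 ≤ m * c / Q := by positivity
  have hnonneg : ∀ j < i + 1, 0 ≤ μ' i → 0 ≤ μ' j := by
    intro j hj h0
    rcases Nat.lt_succ_iff_lt_or_eq.1 hj with hj | rfl
    · rw [hμ' j hj]; exact h.nonneg j hj
    · exact h0
  have hfilt : ((Finset.range i).filter fun j => μ' j ≠ 0)
      = (Finset.range i).filter fun j => μ j ≠ 0 := by
    refine Finset.filter_congr fun j hj => ?_
    rw [hμ' j (Finset.mem_range.1 hj)]
  have hhq := highSum_eq_add (fun j => keepProb H (A j) (k + 1)) hi
  rw [← hq] at hhq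
  have hcnt := h.count
  rw [hhq] at hcnt
  -- the two new pairs of matrices in terms of the weights
  have eU : ∀ x, U₀ + ((8 / ε + (1 + ε / 4))⁻¹ * x) • A ⟨i, hi⟩ = (8 / ε + (1 + ε / 4))⁻¹ •
      ((8 / ε) • ∑ j, A j + (lowSum A μ i + x • A ⟨i, hi⟩ + (1 + ε / 4) • highSum A (i + 1))) := by
    intro x
    rw [hU₀, h.upper, highSum_eq_add A hi]
    module
  have eV : ∀ x, V₀ - ((8 / ε - (1 - ε / 4))⁻¹ * x) • A ⟨i, hi⟩ = (8 / ε - (1 - ε / 4))⁻¹ •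
      ((8 / ε) • ∑ j, A j - (lowSum A μ i + x • A ⟨i, hi⟩ + (1 - ε / 4) • highSum A (i + 1))) := by
    intro x
    rw [hV₀, h.lower, highSum_eq_add A hi]
    module
  have eU₀ := eU 0
  have eV₀ := eV 0
  rw [mul_zero, zero_smul, add_zero, add_zero] at eU₀
  rw [mul_zero, zero_smul, sub_zero, add_zero] at eV₀
  have eU₁ := eU q⁻¹
  have eV₁ := eV q⁻¹
  rw [← hU₁] at eU₁
  rw [← hV₁] at eV₁
  -- the averaged inequality
  have havg : q * (potential H (k + 1) U₁ + potential H (k + 1) V₁ + m * (c - q + 1) / Q)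
      + (1 - q) * (potential H (k + 1) U₀ + potential H (k + 1) V₀ + m * (c - q) / Q) ≤ 3 * m := by
    obtain ⟨ι, _, _, F, B, hB, hB1, hAB, hFHF, hMF, hcard, hinj⟩ := exists_normalization hA hH
    have hlowB := lowSum_nonneg hB h.nonneg
    have hhighB := highSum_nonneg hB (i + 1)
    have hpot : ∀ (a s t : ℝ) (X R : Matrix ι ι ℝ), potential H (k + 1)
        (a • (s • ∑ j, A j + (F * X * Fᵀ + t • (F * R * Fᵀ))))
        = ((a • (s • 1 + (X + t • R))) ^ (k + 1)).trace := by
      intro a s t X R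
      rw [← trace_conj_pow hFHF, potential, hMF]
      simp only [Matrix.mul_add, Matrix.add_mul, Matrix.mul_smul, Matrix.smul_mul, Matrix.mul_one]
    have hpot' : ∀ (a s t : ℝ) (X R : Matrix ι ι ℝ), potential H (k + 1)
        (a • (s • ∑ j, A j - (F * X * Fᵀ + t • (F * R * Fᵀ))))
        = ((a • (s • 1 - (X + t • R))) ^ (k + 1)).trace := by
      intro a s t X R
      rw [← trace_conj_pow hFHF, potential, hMF]
      simp only [Matrix.mul_add, Matrix.add_mul, Matrix.mul_smul, Matrix.smul_mul, Matrix.mul_one,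
        Matrix.mul_sub, Matrix.sub_mul]
    have eA : A ⟨i, hi⟩ = F * B ⟨i, hi⟩ * Fᵀ := by rw [hAB]
    have elow : lowSum A μ i = F * lowSum B μ i * Fᵀ := by rw [hAB, lowSum_conj]
    have ehigh : highSum A (i + 1) = F * highSum B (i + 1) * Fᵀ := by rw [hAB, highSum_conj]
    have elow1 : lowSum A μ i + q⁻¹ • A ⟨i, hi⟩
        = F * (lowSum B μ i + q⁻¹ • B ⟨i, hi⟩) * Fᵀ := by
      rw [elow, eA]
      simp only [Matrix.mul_add, Matrix.add_mul, Matrix.mul_smul, Matrix.smul_mul]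
    have ehigh1 : highSum A i = F * (B ⟨i, hi⟩ + highSum B (i + 1)) * Fᵀ := by
      rw [← highSum_eq_add B hi, hAB, highSum_conj]
    have pU := h.upper
    have pV := h.lower
    have qU₀ := eU₀
    have qV₀ := eV₀
    have qU₁ := eU₁
    have qV₁ := eV₁
    rw [elow, ehigh1] at pU pV
    rw [elow, ehigh] at qU₀ qV₀
    rw [elow1, ehigh] at qU₁ qV₁
    -- Positivity of the lower base matrix follows from the upper potential, but isolating the upper
    -- potential in the bound requires that the lower one be nonnegative. The even exponent breaks
    -- this circle.
    have hVh : 0 ≤ potential H (k + 1) V := by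
      rw [pV, hpot']
      refine trace_pow_nonneg_of_even ?_ hk
      refine IsHermitian.smul ?_ (IsSelfAdjoint.all _)
      refine IsHermitian.sub (IsHermitian.smul isHermitian_one (IsSelfAdjoint.all _)) ?_
      refine IsHermitian.add (isHermitian_of_nonneg hlowB) ?_
      exact IsHermitian.smul (isHermitian_of_nonneg (add_nonneg (hB _) hhighB))
        (IsSelfAdjoint.all _)
    -- If q < 1 the minimum in the probability is not truncated, so q/(4p) is exactly the importance
    -- estimate, which dominates B.
    have hqB : q < 1 → B ⟨i, hi⟩ ≤ (q / (4 * (k + 1))) • 1 := by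
      intro hlt
      have hcard' : (Fintype.card ι : ℝ) ≤ 2 ^ (k + 1) := by rw [hcard]; exact hp
      have h1 := (importance_conj hFHF (hB ⟨i, hi⟩) hcard').2.1
      rw [← eA] at h1
      have h2 : q = 4 * (k + 1 : ℕ) * importance H (A ⟨i, hi⟩) (k + 1) := by
        rw [hq, keepProb, min_eq_right]
        by_contra! hgt
        rw [hq, keepProb, min_eq_left hgt.le] at hlt
        exact lt_irrefl _ hlt
      have h3 : q / (4 * (k + 1)) = importance H (A ⟨i, hi⟩) (k + 1) := by
        rw [h2]; push_cast; field_simp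
      rwa [h3]
    have hUle : (((8 / ε + (1 + ε / 4))⁻¹ • ((8 / ε) • 1 + (lowSum B μ i +
        (1 + ε / 4) • (B ⟨i, hi⟩ + highSum B (i + 1))))) ^ (k + 1)).trace ≤ 3 * m := by
      rw [← hpot, ← pU]
      linarith
    obtain ⟨-, h1, h2⟩ := round_step hε0 hε1 (by rw [hm]; exact hκ) hlowB (hB ⟨i, hi⟩) hhighB hq0
      hq1 hqB hUle
    rw [← hpot, ← hpot, ← hpot, ← pU, ← qU₀, ← qU₁] at h1
    rw [← hpot', ← hpot', ← hpot', ← pV, ← qV₀, ← qV₁] at h2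
    have h3 : q * (m * (c - q + 1) / Q) + (1 - q) * (m * (c - q) / Q) = m * c / Q := by ring
    linarith
  constructor
  · intro hle hμi
    refine ⟨fun j hj => hnonneg j hj (by rw [hμi]; positivity), ?_, ?_, ?_, ?_⟩
    · rw [eU₁, lowSum_succ A hi hμ', hμi]
    · rw [eV₁, lowSum_succ A hi hμ', hμi]
    · have h1 : (((Finset.range (i + 1)).filter fun j => μ' j ≠ 0).card : ℝ)
          ≤ ((Finset.range i).filter fun j => μ j ≠ 0).card + 1 := by
        rw [← hfilt, Finset.range_add_one, Finset.filter_insert]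
        split_ifs
        · exact_mod_cast Finset.card_insert_le _ _
        · linarith
      linarith
    · rw [← hm, ← hQ]
      nlinarith
  · intro hlt hμi
    refine ⟨fun j hj => hnonneg j hj (by rw [hμi]), ?_, ?_, ?_, ?_⟩
    · rw [eU₀, lowSum_succ A hi hμ', hμi, zero_smul, add_zero]
    · rw [eV₀, lowSum_succ A hi hμ', hμi, zero_smul, add_zero]
    · have h1 : ((Finset.range (i + 1)).filter fun j => μ' j ≠ 0)
          = (Finset.range i).filter fun j => μ j ≠ 0 := by
        rw [← hfilt, Finset.range_add_one, Finset.filter_insert, if_neg (by simp [hμi])]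
      rw [h1]
      linarith
    · rw [← hm, ← hQ]
      rw [not_le] at hlt
      nlinarith

theorem lowSum_self {m : Type*} (A : Fin r → Matrix m m ℝ) (μ : ℕ → ℝ) :
    lowSum A μ r = ∑ j : Fin r, μ j • A j := by
  simp [lowSum]

theorem highSum_self {E : Type*} [AddCommMonoid E] (A : Fin r → E) : highSum A r = 0 := by
  simp [highSum]

/-- If all probabilities vanish, so do all norm estimates, hence all B_i and their sum. The positive
sum permits clearing the denominator of the size estimator at the end. -/
theorem sum_keepProb_pos (hA : ∀ i, 0 ≤ A i) (hH : IsGenInv (∑ i, A i) H)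
    (hp : ((∑ i, A i).rank : ℝ) ≤ 2 ^ (k + 1)) (hM : ∑ i, A i ≠ 0) :
    0 < ∑ j, keepProb H (A j) (k + 1) := by
  refine (Finset.sum_nonneg fun j _ => keepProb_nonneg hA hH hp j).lt_of_ne' fun h0 => hM ?_
  refine Finset.sum_eq_zero fun i _ => ?_
  have h1 := (Finset.sum_eq_zero_iff_of_nonneg
    (fun j _ => keepProb_nonneg hA hH hp j)).1 h0 i (Finset.mem_univ i)
  obtain ⟨ι, _, _, F, B, hB, hB1, hAB, hFHF, hMF, hcard, hinj⟩ := exists_normalization hA hH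
  have eA : A i = F * B i * Fᵀ := by rw [hAB]
  have h2 : importance H (A i) (k + 1) = 0 := by
    rw [keepProb] at h1
    rcases min_choice 1 (4 * ((k + 1 : ℕ) : ℝ) * importance H (A i) (k + 1)) with h | h
    · rw [h] at h1; norm_num at h1
    · rw [h] at h1
      have : (4 * ((k + 1 : ℕ) : ℝ)) ≠ 0 := by positivity
      exact (mul_eq_zero.1 h1).resolve_left this
  rw [← hcard] at hp
  have h3 := (importance_conj hFHF (hB i) hp).2.1
  rw [← eA, h2, zero_smul] at h3
  rw [eA, le_antisymm h3 (hB i)]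
  simp

/-- What the rounding achieves. -/
theorem RoundInv.result (hε0 : 0 < ε) (hε1 : ε < 1) (hA : ∀ i, 0 ≤ A i)
    (hH : IsGenInv (∑ i, A i) H) (hk : Even (k + 1)) (hM : ∑ i, A i ≠ 0)
    (hκ : 3 * ((∑ i, A i).rank : ℝ) ≤ (1 + ε ^ 2 / 32) ^ (k + 1))
    {μ : ℕ → ℝ} {U V : Matrix (Fin n) (Fin n) ℝ} {c : ℝ}
    (h : RoundInv A H (k + 1) ε r μ U V c) :
    (∀ j < r, 0 ≤ μ j) ∧ (1 - ε) • ∑ i, A i ≤ ∑ i : Fin r, μ i • A i ∧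
      ∑ i : Fin r, μ i • A i ≤ (1 + ε) • ∑ i, A i ∧
      (((Finset.range r).filter fun j => μ j ≠ 0).card : ℝ)
        ≤ 3 * ∑ j, keepProb H (A j) (k + 1) := by
  have hp := card_le_two_pow hε0 hε1 hκ
  have hQ0 := sum_keepProb_pos hA hH hp hM
  obtain ⟨ι, _, _, F, B, hB, hB1, hAB, hFHF, hMF, hcard, hinj⟩ := exists_normalization hA hH
  have hcount := h.count
  rw [highSum_self, add_zero] at hcount
  have hc0 : 0 ≤ c := (Nat.cast_nonneg _).trans hcount
  have hm0 : (0 : ℝ) < (∑ j, A j).rank := by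
    exact_mod_cast Nat.pos_of_ne_zero fun h0 => hM (eq_zero_of_rank_eq_zero h0)
  have hL : 8 < 8 / ε := by rw [lt_div_iff₀ hε0]; linarith
  set Z := lowSum B μ r with hZ
  have hZ0 : 0 ≤ Z := lowSum_nonneg hB h.nonneg
  have eZ : lowSum A μ r = F * Z * Fᵀ := by rw [hAB, lowSum_conj]
  have hU : potential H (k + 1) U
      = (((8 / ε + (1 + ε / 4))⁻¹ • ((8 / ε) • 1 + Z)) ^ (k + 1)).trace := by
    rw [← trace_conj_pow hFHF, potential, h.upper, eZ, highSum_self, hMF]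
    simp only [Matrix.mul_add, Matrix.add_mul, Matrix.mul_smul, Matrix.smul_mul, Matrix.mul_one,
      smul_zero, add_zero]
  have hV : potential H (k + 1) V
      = (((8 / ε - (1 - ε / 4))⁻¹ • ((8 / ε) • 1 - Z)) ^ (k + 1)).trace := by
    rw [← trace_conj_pow hFHF, potential, h.lower, eZ, highSum_self, hMF]
    simp only [Matrix.mul_sub, Matrix.sub_mul, Matrix.mul_smul, Matrix.smul_mul, Matrix.mul_one,
      smul_zero, add_zero]
  have hU0 : 0 ≤ potential H (k + 1) U := by
    rw [hU]
    refine trace_pow_nonneg_of_even (IsHermitian.smul (IsHermitian.add (IsHermitian.smul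
      isHermitian_one (IsSelfAdjoint.all _)) (isHermitian_of_nonneg hZ0)) (IsSelfAdjoint.all _)) hk
  have hV0 : 0 ≤ potential H (k + 1) V := by
    rw [hV]
    refine trace_pow_nonneg_of_even (IsHermitian.smul (IsHermitian.sub (IsHermitian.smul
      isHermitian_one (IsSelfAdjoint.all _)) (isHermitian_of_nonneg hZ0)) (IsSelfAdjoint.all _)) hk
  have hb := h.bound
  have hcQ : 0 ≤ ((∑ j, A j).rank : ℝ) * c / ∑ j, keepProb H (A j) (k + 1) := by positivity
  have hZ1 := partial_sum_le hε0 hε1 hκ hZ0 (by rw [← hU]; linarith)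
  have hZ2 := le_partial_sum hε0 hε1 hκ
    (sub_nonneg.2 (hZ1.trans (smul_one_mono (by linarith)))) (by rw [← hV]; linarith)
  rw [← lowSum_self, eZ, hMF]
  refine ⟨h.nonneg, ?_, ?_, hcount.trans ?_⟩
  · simpa using mul_mul_transpose_mono hZ2 F
  · simpa using mul_mul_transpose_mono hZ1 F
  -- Both potentials are nonnegative, so the size term alone is at most 3m; cancelling m bounds c by
  -- three times the sum of the probabilities.
  · have h1 : ((∑ j, A j).rank : ℝ) * c / ∑ j, keepProb H (A j) (k + 1)
        ≤ 3 * (∑ j, A j).rank := by linarith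
    rw [div_le_iff₀ hQ0] at h1
    refine le_of_mul_le_mul_left ?_ hm0
    linarith

end

end Algorithm

/-! ### The size of the support, with explicit constants. -/

section SizeBounds

open Matrix

variable {r n : ℕ}

/-- The sub-collection indexed by `T`, padded by zeros. -/
def masked (A : Fin r → Matrix (Fin n) (Fin n) ℝ) (T : Finset (Fin r)) (i : Fin r) :
    Matrix (Fin n) (Fin n) ℝ :=
  if i ∈ T then A i else 0

theorem sum_masked (A : Fin r → Matrix (Fin n) (Fin n) ℝ) (T : Finset (Fin r)) :
    ∑ i, masked A T i = ∑ i ∈ T, A i := by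
  simp [masked, Finset.sum_ite_mem]

theorem sum_smul_masked (A : Fin r → Matrix (Fin n) (Fin n) ℝ) (T : Finset (Fin r))
    (μ : Fin r → ℝ) : ∑ i, μ i • masked A T i = ∑ i : T, μ i • A i := by
  rw [Finset.sum_coe_sort T fun i => μ i • A i]
  simp [masked, smul_ite, Finset.sum_ite_mem]

theorem masked_nonneg {A : Fin r → Matrix (Fin n) (Fin n) ℝ} (hA : ∀ i, (A i).PosSemidef)
    (T : Finset (Fin r)) (i : Fin r) : 0 ≤ masked A T i := by
  unfold masked
  split_ifs
  · exact nonneg_iff_posSemidef.2 (hA i)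
  · exact le_rfl

theorem sum_masked_ne_zero {A : Fin r → Matrix (Fin n) (Fin n) ℝ} (hA : ∀ i, (A i).PosSemidef)
    {T : Finset (Fin r)} (hT : ∃ i ∈ T, A i ≠ 0) : ∑ i, masked A T i ≠ 0 := by
  obtain ⟨i, hi, hne⟩ := hT
  intro h0
  have h1 := Finset.single_le_sum (fun j _ => masked_nonneg hA T j) (Finset.mem_univ i)
  rw [h0] at h1
  have h2 : masked A T i = A i := by simp [masked, hi]
  rw [h2] at h1
  exact hne (le_antisymm h1 (nonneg_iff_posSemidef.2 (hA i)))

theorem support_ncard_le (T : Finset (Fin r)) (μ : ℕ → ℝ) :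
    (Function.support fun i : T => μ (i : Fin r)).ncard
      ≤ ((Finset.range r).filter fun j => μ j ≠ 0).card := by
  rw [← Set.ncard_coe_finset]
  refine Set.ncard_le_ncard_of_injOn (fun i : T => ((i : Fin r) : ℕ)) ?_ ?_ (Finset.finite_toSet _)
  · intro i hi
    simpa using hi
  · intro i _ j _ h
    exact Subtype.ext (Fin.ext h)

theorem one_le_localBound (A : Fin r → Matrix (Fin n) (Fin n) ℝ) (T : Finset (Fin r)) :
    1 ≤ localBound A T := by
  have h1 := one_le_minRatio (fun i : T => A i)
  have h2 := one_le_logPlus T.card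
  have h3 := one_le_logPlus (∑ i ∈ T, A i).rank
  unfold localBound
  exact one_le_mul_of_one_le_of_one_le (one_le_mul_of_one_le_of_one_le h2 h3) h1

/-- The constant of the theorem. -/
def sizeConstant : ℝ := 250 * 147456

theorem sizeConstant_pos : 0 < sizeConstant := by norm_num [sizeConstant]

/-- Take logarithms: log(1 + x) ≥ x/2 for x = ε²/32 and log(3m) ≤ 3 logPlus m. The constant is 384 =
2 · 3 · 64. -/
theorem sq_mul_exponent_le {ε : ℝ} (hε0 : 0 ≤ ε) (hε1 : ε < 1) {m h : ℕ} (hm : 0 < m)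
    (hlt : (1 + ε ^ 2 / 32) ^ h < 3 * m) : ε ^ 2 * (2 * h : ℕ) ≤ 384 * logPlus m := by
  have hx : 0 ≤ ε ^ 2 / 32 := by positivity
  have hx1 : ε ^ 2 / 32 ≤ 1 := by nlinarith
  have hm0 : (0 : ℝ) < m := by exact_mod_cast hm
  have h1 := Real.log_lt_log (by positivity) hlt
  rw [Real.log_pow, Real.log_mul (by norm_num) hm0.ne'] at h1
  have h2 := Real.one_sub_inv_le_log_of_pos (show 0 < 1 + ε ^ 2 / 32 by positivity)
  have h3 : ε ^ 2 / 32 / 2 ≤ 1 - (1 + ε ^ 2 / 32)⁻¹ := by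
    rw [le_sub_iff_add_le, ← le_sub_iff_add_le', inv_le_iff_one_le_mul₀ (by positivity)]
    nlinarith
  have h4 : (h : ℝ) * (ε ^ 2 / 32 / 2) ≤ h * Real.log (1 + ε ^ 2 / 32) := by gcongr; linarith
  have h5 : Real.log 3 ≤ 2 := by
    have := Real.log_le_sub_one_of_pos (show (0 : ℝ) < 3 by norm_num)
    linarith
  have h6 := one_le_logPlus m
  have h7 := log_le_logPlus m
  push_cast
  linarith

theorem importance_zero (H : Matrix (Fin n) (Fin n) ℝ) (p : ℕ) : importance H 0 p = 0 := by
  simp [importance]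

/-- The exponent p is sufficient while its half h is not, which bounds p from both sides. The
support is at most 3 · 4p times the total importance, and 3 · 4 · 32 = 384 meets the 384 of
`sq_mul_exponent_le`, giving 147456. The zeros outside T have importance zero and cost nothing. -/
theorem goodWeights_of_roundInv {A : Fin r → Matrix (Fin n) (Fin n) ℝ}
    (hA : ∀ i, (A i).PosSemidef) {T : Finset (Fin r)} (hT : ∃ i ∈ T, A i ≠ 0) {ε : ℝ}
    (hε0 : 0 < ε) (hε1 : ε < 1) {H : Matrix (Fin n) (Fin n) ℝ}
    (hH : IsGenInv (∑ i, masked A T i) H) {h p : ℕ} (hp : p = 2 * h) (hh : 0 < h)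
    (hκ : 3 * ((∑ i, masked A T i).rank : ℝ) ≤ (1 + ε ^ 2 / 32) ^ p)
    (hlt : (1 + ε ^ 2 / 32) ^ h < 3 * ((∑ i, masked A T i).rank : ℝ))
    {μ : ℕ → ℝ} {U V : Matrix (Fin n) (Fin n) ℝ} {c : ℝ}
    (hR : RoundInv (masked A T) H p ε r μ U V c) :
    GoodWeights sizeConstant A ε T (fun i : T => μ (i : Fin r)) := by
  obtain ⟨k, rfl⟩ : ∃ k, p = k + 1 := ⟨p - 1, by omega⟩
  have hM := sum_masked_ne_zero hA hT
  have hA' := masked_nonneg hA T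
  have hm : 0 < (∑ i, masked A T i).rank :=
    Nat.pos_of_ne_zero fun h0 => hM (eq_zero_of_rank_eq_zero h0)
  have hp2 := card_le_two_pow hε0 hε1 hκ
  obtain ⟨h0, hl, hu, hc⟩ := hR.result hε0 hε1 hA' hH ⟨h, by omega⟩ hM hκ
  rw [sum_smul_masked A T fun i => μ i, sum_masked, ← Finset.sum_coe_sort T A] at hl hu
  refine goodWeights_of_local hA hT hε0.le (by norm_num) (fun i => h0 _ (i : Fin r).2) hl hu ?_
  have h1 : (((Function.support fun i : T => μ (i : Fin r)).ncard : ℕ) : ℝ)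
      ≤ ((Finset.range r).filter fun j => μ j ≠ 0).card := by exact_mod_cast support_ncard_le T μ
  have h2 : ∑ j, keepProb H (masked A T j) (k + 1)
      ≤ 4 * (k + 1 : ℕ) * ∑ i : T, importance H (A i) (k + 1) := by
    rw [Finset.sum_coe_sort T fun i => importance H (A i) (k + 1), Finset.mul_sum,
      ← Finset.sum_subset (Finset.subset_univ T)]
    · refine Finset.sum_le_sum fun i hi => ?_
      simp only [keepProb, masked, if_pos hi]
      exact min_le_right _ _
    · intro i _ hi
      simp [keepProb, masked, hi, importance_zero]
  have h3 : ∑ i : T, importance H (A i) (k + 1)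
      ≤ 32 * (logPlus T.card * minRatio fun i : T => A i) := by
    have := sum_le_minRatio (A := fun i : T => A i)
      (fun i => nonneg_iff_posSemidef.2 (hA i)) (t := fun i => importance H (A i) (k + 1)) ?_
    · rwa [Fintype.card_coe] at this
    · intro i τ hτ hle
      have e : A i = masked A T i := by simp [masked]
      rw [Finset.sum_coe_sort T A, ← sum_masked] at hle
      simp only [e] at hle ⊢
      exact importance_le hA' hH hp2 _ hτ hle
  have h4 := sq_mul_exponent_le hε0.le hε1 hm hlt
  rw [← hp, sum_masked] at h4
  have h5 := minRatio_nonneg fun i : T => A i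
  have h6 := one_le_logPlus T.card
  have h7 : 0 ≤ logPlus T.card * minRatio fun i : T => A i := by positivity
  calc ε ^ 2 * ((Function.support fun i : T => μ (i : Fin r)).ncard : ℝ)
      ≤ ε ^ 2 * (3 * (4 * (k + 1 : ℕ) *
          (32 * (logPlus T.card * minRatio fun i : T => A i)))) := by
        gcongr
        refine h1.trans (hc.trans ?_)
        gcongr
        refine h2.trans ?_
        gcongr
    _ = (ε ^ 2 * (k + 1 : ℕ)) * (384 * (logPlus T.card * minRatio fun i : T => A i)) := by ring
    _ ≤ (384 * logPlus (∑ i ∈ T, A i).rank) *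
          (384 * (logPlus T.card * minRatio fun i : T => A i)) := by gcongr
    _ = 147456 * localBound A T := by unfold localBound; ring

/-- By Bernoulli's inequality the hypothesis gives 2^(r+n) ε²/32 < 3m ≤ 3 · 2^n, so ε² r ≤ 96:
keeping everything is affordable, as the local bound is at least one. This covers ε = 0. -/
theorem goodWeights_one {A : Fin r → Matrix (Fin n) (Fin n) ℝ}
    (hA : ∀ i, (A i).PosSemidef) {T : Finset (Fin r)} (hT : ∃ i ∈ T, A i ≠ 0) {ε : ℝ}
    (hε0 : 0 ≤ ε)
    (hlt : (1 + ε ^ 2 / 32) ^ 2 ^ (r + n) < 3 * ((∑ i, masked A T i).rank : ℝ)) :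
    GoodWeights sizeConstant A ε T (fun _ => 1) := by
  have hMn : 0 ≤ ∑ i : T, A i := Finset.sum_nonneg fun i _ => nonneg_iff_posSemidef.2 (hA i)
  refine goodWeights_of_local hA hT hε0 (by norm_num) (fun _ => zero_le_one) ?_ ?_ ?_
  · simp only [one_smul]
    simpa using smul_le_smul_of_nonneg_right (show 1 - ε ≤ 1 by linarith) hMn
  · simp only [one_smul]
    simpa using smul_le_smul_of_nonneg_right (show 1 ≤ 1 + ε by linarith) hMn
  · have h1 : ((Function.support fun _ : T => (1 : ℝ)).ncard : ℝ) ≤ r := by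
      have h2 := Set.ncard_le_card (Function.support fun _ : T => (1 : ℝ))
      rw [Nat.card_eq_fintype_card, Fintype.card_coe] at h2
      have h3 := T.card_le_univ
      rw [Fintype.card_fin] at h3
      exact_mod_cast h2.trans h3
    have h2 := one_add_mul_le_pow (show -2 ≤ ε ^ 2 / 32 by nlinarith [sq_nonneg ε]) (2 ^ (r + n))
    have h3 : ((∑ i, masked A T i).rank : ℝ) ≤ n := by exact_mod_cast rank_le_width _
    have h4 : (r : ℝ) ≤ 2 ^ r := by exact_mod_cast Nat.lt_two_pow_self.le
    have h5 : (n : ℝ) ≤ 2 ^ n := by exact_mod_cast Nat.lt_two_pow_self.le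
    have h6 : ε ^ 2 * r ≤ 96 := by
      have h7 : (0 : ℝ) < 2 ^ n := by positivity
      push_cast at h2
      rw [pow_add] at h2
      have h8 : (2 ^ n : ℝ) * (ε ^ 2 * r) ≤ 2 ^ n * 96 := by
        calc (2 ^ n : ℝ) * (ε ^ 2 * r) ≤ 2 ^ n * (ε ^ 2 * 2 ^ r) := by gcongr
          _ = 32 * (2 ^ r * 2 ^ n * (ε ^ 2 / 32)) := by ring
          _ ≤ _ := by linarith
      exact le_of_mul_le_mul_left h8 h7
    have h7 := one_le_localBound A T
    calc ε ^ 2 * ((Function.support fun _ : T => (1 : ℝ)).ncard : ℝ) ≤ ε ^ 2 * r := by gcongr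
      _ ≤ 96 := h6
      _ ≤ _ := by linarith

end SizeBounds

namespace RealRAM

/-! ### Deterministic semantics, frame rules, and running time. -/

section Semantics

theorem NExpr.eval_tick (e : NExpr) (s : State) (k : ℕ) : e.eval (s.tick k) = e.eval s := by
  induction e with
  | const => rfl
  | reg => rfl
  | add e f he hf => simp only [NExpr.eval, he, hf]
  | sub e f he hf => simp only [NExpr.eval, he, hf]

theorem RExpr.eval_tick (e : RExpr) (s : State) (k : ℕ) : e.eval (s.tick k) = e.eval s := by
  induction e with
  | const => rfl
  | get a i j l =>
    simp only [RExpr.eval, NExpr.eval_tick]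
    rfl
  | add e f he hf => simp only [RExpr.eval, he, hf]
  | sub e f he hf => simp only [RExpr.eval, he, hf]
  | mul e f he hf => simp only [RExpr.eval, he, hf]
  | div e f he hf => simp only [RExpr.eval, he, hf]

theorem Test.holds_tick (t : Test) (s : State) (k : ℕ) : t.Holds (s.tick k) ↔ t.Holds s := by
  induction t with
  | natLE e f => simp only [Test.Holds, NExpr.eval_tick]
  | realLE e f => simp only [Test.Holds, RExpr.eval_tick]
  | not t ht => simp only [Test.Holds, ht]
  | and t u ht hu => simp only [Test.Holds, ht, hu]

theorem State.tick_tick (s : State) (k l : ℕ) : (s.tick k).tick l = s.tick (k + l) := by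
  simp [State.tick, add_assoc]

theorem State.putReg_reg (s : State) (x v y : ℕ) :
    (s.putReg x v).reg y = if y = x then v else s.reg y :=
  rfl

theorem State.putReg_arr (s : State) (x v : ℕ) : (s.putReg x v).arr = s.arr :=
  rfl

theorem State.tick_putReg (s : State) (k x v : ℕ) : (s.tick k).putReg x v = (s.putReg x v).tick k :=
  rfl

open Classical in
/-- The effect of a program without coin flips on registers and arrays. -/
noncomputable def Program.exec : Program → State → State
  | skip, s => s
  | seq c d, s => d.exec (c.exec s)
  | setReg x e, s => s.putReg x (e.eval s)
  | setArr a i j k e, s => s.putArr a (i.eval s) (j.eval s) (k.eval s) (e.eval s)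
  | flip _, s => s
  | ite t c d, s => if t.Holds s then c.exec s else d.exec s
  | loop x e c, s =>
      Nat.rec (motive := fun _ => State) s (fun i s' => c.exec (s'.putReg x i)) (e.eval s)

theorem Program.exec_tick (c : Program) (s : State) (k : ℕ) :
    c.exec (s.tick k) = (c.exec s).tick k := by
  induction c generalizing s with
  | skip => rfl
  | seq c d hc hd => simp only [exec, hc, hd]
  | setReg x e => simp only [exec, NExpr.eval_tick, State.tick_putReg]
  | setArr a i j l e =>
    simp only [exec, NExpr.eval_tick, RExpr.eval_tick]
    rfl
  | flip x => rfl
  | ite t c d hc hd => by_cases h : t.Holds s <;> simp [exec, Test.holds_tick, hc, hd, h]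
  | loop x e c hc =>
    simp only [exec, NExpr.eval_tick]
    induction e.eval s with
    | zero => rfl
    | succ m ih => simp only [ih, State.tick_putReg, hc]

/-- The registers that a program may change. -/
def Program.writtenRegs : Program → List ℕ
  | skip => []
  | seq c d => c.writtenRegs ++ d.writtenRegs
  | setReg x _ => [x]
  | setArr _ _ _ _ _ => []
  | flip x => [x]
  | ite _ c d => c.writtenRegs ++ d.writtenRegs
  | loop x _ c => x :: c.writtenRegs

/-- The arrays that a program may change. -/
def Program.writtenArrs : Program → List ℕ
  | skip => []
  | seq c d => c.writtenArrs ++ d.writtenArrs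
  | setReg _ _ => []
  | setArr a _ _ _ _ => [a]
  | flip _ => []
  | ite _ c d => c.writtenArrs ++ d.writtenArrs
  | loop _ _ c => c.writtenArrs

/-- Frame rule. The side condition is a syntactic computation, so for concrete programs `decide` or
`simp` discharges it. -/
theorem Program.exec_reg (c : Program) (s : State) {x : ℕ} (hx : x ∉ c.writtenRegs) :
    (c.exec s).reg x = s.reg x := by
  induction c generalizing s with
  | skip => rfl
  | seq c d hc hd =>
    simp only [writtenRegs, List.mem_append, not_or] at hx
    simp only [exec, hc _ hx.1, hd _ hx.2]
  | setReg y e =>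
    simp only [writtenRegs, List.mem_singleton] at hx
    simp [exec, State.putReg, hx]
  | setArr a i j l e => rfl
  | flip y => rfl
  | ite t c d hc hd =>
    simp only [writtenRegs, List.mem_append, not_or] at hx
    simp only [exec]
    split_ifs
    exacts [hc _ hx.1, hd _ hx.2]
  | loop y e c hc =>
    simp only [writtenRegs, List.mem_cons, not_or] at hx
    simp only [exec]
    induction e.eval s with
    | zero => rfl
    | succ m ih => simp only [hc _ hx.2, State.putReg_reg, if_neg hx.1, ih]

theorem Program.exec_arr (c : Program) (s : State) {a : ℕ} (ha : a ∉ c.writtenArrs) :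
    (c.exec s).arr a = s.arr a := by
  induction c generalizing s with
  | skip => rfl
  | seq c d hc hd =>
    simp only [writtenArrs, List.mem_append, not_or] at ha
    simp only [exec, hc _ ha.1, hd _ ha.2]
  | setReg y e => rfl
  | setArr b i j l e =>
    simp only [writtenArrs, List.mem_singleton] at ha
    funext i j k
    simp [exec, State.putArr, ha]
  | flip y => rfl
  | ite t c d hc hd =>
    simp only [writtenArrs, List.mem_append, not_or] at ha
    simp only [exec]
    split_ifs
    exacts [hc _ ha.1, hd _ ha.2]
  | loop y e c hc =>
    simp only [writtenArrs] at ha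
    simp only [exec]
    induction e.eval s with
    | zero => rfl
    | succ m ih => simp only [hc _ ha, State.putReg_arr, ih]

/-- The invariant is stated before the counter register is set, so each round starts from an
arbitrary invariant state with the counter overwritten. -/
theorem Program.exec_loop_induction {I : ℕ → State → Prop} {x : ℕ} {e : NExpr} {c : Program}
    {s : State} {N : ℕ} (hN : e.eval s = N) (h0 : I 0 s)
    (hstep : ∀ i < N, ∀ s', I i s' → I (i + 1) (c.exec (s'.putReg x i))) :
    I N ((Program.loop x e c).exec s) := by
  simp only [exec, hN]
  have : ∀ m ≤ N, I m (Nat.rec (motive := fun _ => State) s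
      (fun i s' => c.exec (s'.putReg x i)) m) := by
    intro m
    induction m with
    | zero => exact fun _ => h0
    | succ m ih => exact fun hm => hstep m (by omega) _ (ih (by omega))
  exact this N le_rfl

/-- Programs without coin flips that keep the registers `0` and `1` and whose loops have at most
`reg 0 + reg 1` rounds. -/
def Program.Simple : Program → Prop
  | skip => True
  | seq c d => c.Simple ∧ d.Simple
  | setReg x _ => 2 ≤ x
  | setArr _ _ _ _ _ => True
  | flip _ => False
  | ite _ c d => c.Simple ∧ d.Simple
  | loop x e c => 2 ≤ x ∧ (e = .reg 0 ∨ e = .reg 1 ∨ e = .add (.reg 0) (.reg 1)) ∧ c.Simple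

theorem Program.Simple.notMem_writtenRegs {c : Program} (h : c.Simple) {x : ℕ} (hx : x < 2) :
    x ∉ c.writtenRegs := by
  induction c with
  | skip => simp [writtenRegs]
  | seq c d hc hd => simp [writtenRegs, hc h.1, hd h.2]
  | setReg y e =>
    have : 2 ≤ y := h
    simp only [writtenRegs, List.mem_singleton]
    omega
  | setArr => simp [writtenRegs]
  | flip => exact h.elim
  | ite t c d hc hd => simp [writtenRegs, hc h.1, hd h.2]
  | loop y e c hc =>
    have : 2 ≤ y := h.1
    simp only [writtenRegs, List.mem_cons, hc h.2.2, or_false]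
    omega

/-- Time bounds have the form d · N^d with a single parameter; this family is closed under sums,
which makes the induction over programs uniform. -/
theorem add_poly_le {N : ℕ} (hN : 1 ≤ N) (a b : ℕ) :
    a * N ^ a + b * N ^ b ≤ (a + b) * N ^ (a + b) := by
  have h1 : N ^ a ≤ N ^ (a + b) := Nat.pow_le_pow_right hN (by omega)
  have h2 : N ^ b ≤ N ^ (a + b) := Nat.pow_le_pow_right hN (by omega)
  nlinarith

theorem poly_mono {N : ℕ} (hN : 1 ≤ N) {a b : ℕ} (h : a ≤ b) : a * N ^ a ≤ b * N ^ b :=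
  Nat.mul_le_mul h (Nat.pow_le_pow_right hN h)

theorem le_poly {N : ℕ} (hN : 1 ≤ N) (a : ℕ) : a ≤ a * N ^ a :=
  Nat.le_mul_of_pos_right _ (Nat.pow_pos hN)

/-- A simple program is deterministic and takes polynomial time. -/
theorem Program.Simple.run_eq {c : Program} (h : c.Simple) :
    ∃ d : ℕ, ∀ s : State, ∃ k ≤ d * (s.reg 0 + s.reg 1 + 1) ^ d,
      c.run s = PMF.pure ((c.exec s).tick k) := by
  induction c with
  | skip => exact ⟨1, fun s => ⟨1, le_poly (by omega) 1, rfl⟩⟩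
  | seq c d hc hd =>
    obtain ⟨d₁, h₁⟩ := hc h.1
    obtain ⟨d₂, h₂⟩ := hd h.2
    refine ⟨d₁ + d₂, fun s => ?_⟩
    obtain ⟨k₁, hk₁, e₁⟩ := h₁ s
    obtain ⟨k₂, hk₂, e₂⟩ := h₂ ((c.exec s).tick k₁)
    have hr : ∀ x < 2, ((c.exec s).tick k₁).reg x = s.reg x := fun x hx =>
      c.exec_reg s (h.1.notMem_writtenRegs hx)
    rw [hr 0 (by omega), hr 1 (by omega)] at hk₂
    refine ⟨k₁ + k₂, (add_le_add hk₁ hk₂).trans (add_poly_le (by omega) _ _), ?_⟩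
    rw [run, e₁, PMF.pure_bind, e₂, exec_tick, State.tick_tick, exec]
  | setReg x e => exact ⟨e.cost + 1, fun s => ⟨_, le_poly (by omega) _, rfl⟩⟩
  | setArr a i j l e =>
    exact ⟨i.cost + j.cost + l.cost + e.cost + 1, fun s => ⟨_, le_poly (by omega) _, rfl⟩⟩
  | flip => exact h.elim
  | ite t c d hc hd =>
    obtain ⟨d₁, h₁⟩ := hc h.1
    obtain ⟨d₂, h₂⟩ := hd h.2
    refine ⟨t.cost + 1 + (d₁ + d₂), fun s => ?_⟩
    by_cases ht : t.Holds s
    · obtain ⟨k, hk, e⟩ := h₁ (s.tick (t.cost + 1))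
      refine ⟨t.cost + 1 + k, le_trans ?_ (add_poly_le (by omega) _ _), ?_⟩
      · exact add_le_add (le_poly (by omega) _) (hk.trans (poly_mono (by omega) (by omega)))
      · simp only [run, exec, if_pos ht, e, exec_tick, State.tick_tick]
    · obtain ⟨k, hk, e⟩ := h₂ (s.tick (t.cost + 1))
      refine ⟨t.cost + 1 + k, le_trans ?_ (add_poly_le (by omega) _ _), ?_⟩
      · exact add_le_add (le_poly (by omega) _) (hk.trans (poly_mono (by omega) (by omega)))
      · simp only [run, exec, if_neg ht, e, exec_tick, State.tick_tick]
  | loop x e c hc =>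
    obtain ⟨d, hd⟩ := hc h.2.2
    refine ⟨e.cost + 1 + (d + 1), fun s => ?_⟩
    set N := s.reg 0 + s.reg 1 + 1 with hN
    -- The registers 0 and 1 are carried along, because the time bound of the body depends on the
    -- state only through them.
    have key : ∀ m : ℕ, ∃ k ≤ m * (1 + d * N ^ d),
        Nat.rec (motive := fun _ => PMF State) (PMF.pure (s.tick (e.cost + 1)))
          (fun i p => p.bind fun s' => c.run ((s'.putReg x i).tick 1)) m
        = PMF.pure ((Nat.rec (motive := fun _ => State) s
            (fun i s' => c.exec (s'.putReg x i)) m : State).tick (e.cost + 1 + k)) ∧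
        ∀ y < 2, (Nat.rec (motive := fun _ => State) s
            (fun i s' => c.exec (s'.putReg x i)) m : State).reg y = s.reg y := by
      intro m
      induction m with
      | zero => exact ⟨0, by simp, rfl, fun _ _ => rfl⟩
      | succ m ih =>
        obtain ⟨k, hk, e1, hreg⟩ := ih
        set t : State := Nat.rec (motive := fun _ => State) s
            (fun i s' => c.exec (s'.putReg x i)) m with ht
        obtain ⟨k', hk', e2⟩ := hd (((t.tick (e.cost + 1 + k)).putReg x m).tick 1)
        have hx : 2 ≤ x := h.1
        have hr : ∀ y < 2, (((t.tick (e.cost + 1 + k)).putReg x m).tick 1).reg y = s.reg y := by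
          intro y hy
          rw [← hreg y hy]
          have : y ≠ x := by omega
          simp [State.tick, State.putReg, this]
        rw [hr 0 (by omega), hr 1 (by omega), ← hN] at hk'
        refine ⟨k + 1 + k', ?_, ?_, ?_⟩
        · rw [Nat.succ_mul]
          omega
        · simp only [e1, PMF.pure_bind, e2]
          rw [State.tick_putReg, State.tick_tick, exec_tick, State.tick_tick]
          congr 2
          omega
        · intro y hy
          simp only
          rw [c.exec_reg _ (h.2.2.notMem_writtenRegs hy), ← hreg y hy]
          have : y ≠ x := by omega
          simp [State.putReg, this, ht]
    obtain ⟨k, hk, e1, -⟩ := key (e.eval s)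
    refine ⟨e.cost + 1 + k, ?_, ?_⟩
    · have he : e.eval s ≤ N := by
        rcases h.2.1 with rfl | rfl | rfl <;> simp only [NExpr.eval] <;> omega
      refine le_trans (add_le_add (le_poly (N := N) (by omega) (e.cost + 1)) ?_)
        (add_poly_le (by omega) _ _)
      have h1 : 1 ≤ N ^ d := Nat.one_le_pow _ _ (by omega)
      calc k ≤ N * (1 + d * N ^ d) := hk.trans (Nat.mul_le_mul_right _ he)
        _ ≤ N * (N ^ d + d * N ^ d) := by gcongr
        _ = (d + 1) * N ^ (d + 1) := by ring
    · simp only [run, exec]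
      exact e1

end Semantics

/-! ### Programs for matrix arithmetic. -/

section MatrixPrograms

open Program

/-- The matrix in the slice `0` of the array `a`. -/
def State.mat (n : ℕ) (s : State) (a : ℕ) : Matrix (Fin n) (Fin n) ℝ :=
  Matrix.of fun j k => s.arr a 0 j k

/-- The scalar in the array `a`. -/
abbrev RExpr.scal (a : ℕ) : RExpr := .get a (.const 0) (.const 0) (.const 0)

/-- The entry of the array `a` with the indices in the registers `10` and `11`. -/
abbrev RExpr.entry (a : ℕ) : RExpr := .get a (.const 0) (.reg 10) (.reg 11)

/-- Assignment to a scalar. -/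
abbrev Program.setScal (a : ℕ) (e : RExpr) : Program :=
  .setArr a (.const 0) (.const 0) (.const 0) e

/-- Runs `c` for all values of the registers `10` and `11` below `reg 1`. -/
def Program.forEntries (c : Program) : Program := .loop 10 (.reg 1) (.loop 11 (.reg 1) c)

theorem Program.mat_exec (c : Program) (s : State) (n : ℕ) {a : ℕ} (ha : a ∉ c.writtenArrs) :
    (c.exec s).mat n a = s.mat n a := by
  simp only [State.mat, c.exec_arr s ha]

theorem State.arr_of_mat {n : ℕ} {s : State} {a : ℕ} {X : Matrix (Fin n) (Fin n) ℝ}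
    (h : s.mat n a = X) (j k : Fin n) : s.arr a 0 j k = X j k :=
  congrFun (congrFun h j) k

theorem Program.exec_setScal (a : ℕ) (e : RExpr) (s : State) :
    ((setScal a e).exec s).arr a 0 0 0 = e.eval s := by
  simp [exec, State.putArr, NExpr.eval]

/-- The state `s'` agrees with `s` as far as the treatment of the entry `(j, k)` of the array `a`
is concerned. -/
structure EntryAgree (a j k : ℕ) (s s' : State) : Prop where
  reg : ∀ x, x ≠ 10 → x ≠ 11 → x ≠ 12 → s'.reg x = s.reg x
  arr : ∀ b, b ≠ a → s'.arr b = s.arr b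
  entry : s'.arr a 0 j k = s.arr a 0 j k
  row : s'.reg 10 = j
  col : s'.reg 11 = k

/-- Entries are treated in lexicographic order, and the body sees the old value of the entry it is
about to write, though perhaps not of the other entries of that array. This is what makes in-place
updates correct. -/
theorem Program.mat_forEntries {c : Program} {a n : ℕ} {s : State} {f : Fin n → Fin n → ℝ}
    (hn : s.reg 1 = n) (hregs : ∀ x ∈ c.writtenRegs, x = 12) (harrs : ∀ b ∈ c.writtenArrs, b = a)
    (hc : ∀ (j k : Fin n) (s' : State), EntryAgree a j k s s' →
      (c.exec s').arr a 0 j k = f j k ∧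
        ∀ j' k' : ℕ, j' ≠ j ∨ k' ≠ k → (c.exec s').arr a 0 j' k' = s'.arr a 0 j' k') :
    ((forEntries c).exec s).mat n a = Matrix.of f := by
  have h10 : 10 ∉ c.writtenRegs := fun h => by simpa using hregs _ h
  have h11 : 11 ∉ c.writtenRegs := fun h => by simpa using hregs _ h
  let I : ℕ → State → Prop := fun J s' =>
    (∀ x, x ≠ 10 → x ≠ 11 → x ≠ 12 → s'.reg x = s.reg x) ∧ (∀ b, b ≠ a → s'.arr b = s.arr b) ∧
    ∀ j k : Fin n, s'.arr a 0 j k = if (j : ℕ) < J then f j k else s.arr a 0 j k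
  have key : I n ((forEntries c).exec s) := by
    refine exec_loop_induction (I := I) (by exact hn) ?_ ?_
    · exact ⟨fun _ _ _ _ => rfl, fun _ _ => rfl, by simp⟩
    · rintro J hJ s1 ⟨hr1, ha1, he1⟩
      let I' : ℕ → State → Prop := fun K s' =>
        (∀ x, x ≠ 10 → x ≠ 11 → x ≠ 12 → s'.reg x = s.reg x) ∧ (∀ b, b ≠ a → s'.arr b = s.arr b) ∧
        s'.reg 10 = J ∧ ∀ j k : Fin n, s'.arr a 0 j k =
          if (j : ℕ) < J ∨ (j : ℕ) = J ∧ (k : ℕ) < K then f j k else s.arr a 0 j k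
      have hinner : I' n ((loop 11 (.reg 1) c).exec (s1.putReg 10 J)) := by
        refine exec_loop_induction (I := I') ?_ ?_ ?_
        · simp only [NExpr.eval, State.putReg_reg]
          rw [if_neg (by decide), hr1 1 (by decide) (by decide) (by decide), hn]
        · refine ⟨fun x h1 h2 h3 => ?_, ha1, by simp [State.putReg_reg], fun j k => ?_⟩
          · rw [State.putReg_reg, if_neg h1, hr1 x h1 h2 h3]
          · rw [State.putReg_arr, he1]
            simp
        · rintro K hK s2 ⟨hr2, ha2, h10', he2⟩
          have hag : EntryAgree a (⟨J, hJ⟩ : Fin n) (⟨K, hK⟩ : Fin n) s (s2.putReg 11 K) := by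
            refine ⟨fun x h1 h2 h3 => ?_, ha2, ?_, ?_, by simp [State.putReg_reg]⟩
            · rw [State.putReg_reg, if_neg h2, hr2 x h1 h2 h3]
            · rw [State.putReg_arr, he2]
              simp
            · simpa [State.putReg_reg] using h10'
          obtain ⟨hnew, hold⟩ := hc ⟨J, hJ⟩ ⟨K, hK⟩ _ hag
          refine ⟨fun x h1 h2 h3 => ?_, fun b hb => ?_, ?_, fun j k => ?_⟩
          · rw [c.exec_reg _ fun h => h3 (hregs x h), hag.reg x h1 h2 h3]
          · rw [c.exec_arr _ fun h => hb (harrs b h), hag.arr b hb]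
          · rw [c.exec_reg _ h10, hag.row]
          · by_cases hjk : (j : ℕ) = J ∧ (k : ℕ) = K
            · obtain ⟨hj, hk⟩ := hjk
              obtain rfl : j = ⟨J, hJ⟩ := Fin.ext hj
              obtain rfl : k = ⟨K, hK⟩ := Fin.ext hk
              rw [hnew, if_pos]
              exact Or.inr ⟨rfl, Nat.lt_succ_self _⟩
            · rw [hold j k (by simp only; omega), State.putReg_arr, he2]
              congr 1
              simp only [eq_iff_iff]
              omega
      obtain ⟨hr, ha, -, he⟩ := hinner
      refine ⟨hr, ha, fun j k => ?_⟩
      rw [he]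
      congr 1
      have := k.2
      simp only [eq_iff_iff]
      omega
  ext j k
  rw [State.mat, Matrix.of_apply, Matrix.of_apply, key.2.2 j k, if_pos j.2]

/-- Entrywise assignment to the matrix in the array `a`. -/
def Program.setMat (a : ℕ) (e : RExpr) : Program :=
  forEntries (.setArr a (.const 0) (.reg 10) (.reg 11) e)

theorem Program.mat_setMat {e : RExpr} {a n : ℕ} {s : State} {f : Fin n → Fin n → ℝ}
    (hn : s.reg 1 = n) (he : ∀ (j k : Fin n) (s' : State), EntryAgree a j k s s' →
      e.eval s' = f j k) : ((setMat a e).exec s).mat n a = Matrix.of f := by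
  refine mat_forEntries hn (by simp [writtenRegs]) (by simp [writtenArrs]) fun j k s' h => ?_
  refine ⟨?_, fun j' k' hne => ?_⟩
  · simp [exec, State.putArr, NExpr.eval, h.row, h.col, he j k s' h]
  · simp only [exec, State.putArr, NExpr.eval, h.row, h.col]
    rw [if_neg]
    omega

/-- Copies a matrix. -/
def Program.copyMat (a b : ℕ) : Program := setMat a (.entry b)

theorem Program.mat_copyMat {a b n : ℕ} {s : State} (hn : s.reg 1 = n) :
    ((copyMat a b).exec s).mat n a = s.mat n b := by
  refine mat_setMat hn fun j k s' h => ?_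
  simp only [RExpr.eval, NExpr.eval, h.row, h.col]
  by_cases hb : b = a
  · rw [hb, h.entry]
  · rw [h.arr b hb]

/-- Sums `e` over the values of the register `12` below `reg 1`, into an entry of the array `a`. -/
def Program.accumulate (a : ℕ) (e : RExpr) : Program :=
  .seq (.setArr a (.const 0) (.reg 10) (.reg 11) (.const 0))
    (.loop 12 (.reg 1) (.setArr a (.const 0) (.reg 10) (.reg 11) (.add (.entry a) e)))

theorem Program.exec_accumulate {e : RExpr} {a n : ℕ} {s : State} (hn : s.reg 1 = n) {g : ℕ → ℝ}
    (hg : ∀ l < n, ∀ s' : State, (∀ x, x ≠ 12 → s'.reg x = s.reg x) →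
      (∀ b, b ≠ a → s'.arr b = s.arr b) → s'.reg 12 = l → e.eval s' = g l) :
    ((accumulate a e).exec s).arr a 0 (s.reg 10) (s.reg 11) = ∑ l ∈ Finset.range n, g l ∧
      ∀ j' k' : ℕ, j' ≠ s.reg 10 ∨ k' ≠ s.reg 11 →
        ((accumulate a e).exec s).arr a 0 j' k' = s.arr a 0 j' k' := by
  let I : ℕ → State → Prop := fun L s' =>
    (∀ x, x ≠ 12 → s'.reg x = s.reg x) ∧ (∀ b, b ≠ a → s'.arr b = s.arr b) ∧
    s'.arr a 0 (s.reg 10) (s.reg 11) = ∑ l ∈ Finset.range L, g l ∧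
    ∀ j' k' : ℕ, j' ≠ s.reg 10 ∨ k' ≠ s.reg 11 → s'.arr a 0 j' k' = s.arr a 0 j' k'
  have key : I n ((accumulate a e).exec s) := by
    refine exec_loop_induction (I := I) ?_ ?_ ?_
    · exact hn
    · refine ⟨fun _ _ => rfl, fun b hb => ?_, ?_, fun j' k' h => ?_⟩
      · funext i j k
        simp [exec, State.putArr, hb]
      · simp [exec, State.putArr, NExpr.eval, RExpr.eval]
      · simp only [exec, State.putArr, NExpr.eval]
        rw [if_neg]
        omega
    · rintro L hL s1 ⟨hr, ha, hsum, hold⟩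
      have hr' : ∀ x, x ≠ 12 → (s1.putReg 12 L).reg x = s.reg x := fun x hx => by
        rw [State.putReg_reg, if_neg hx, hr x hx]
      have h10 := hr' 10 (by decide)
      have h11 := hr' 11 (by decide)
      have hg' := hg L hL (s1.putReg 12 L) hr' ha (by simp [State.putReg_reg])
      refine ⟨hr', fun b hb => ?_, ?_, fun j' k' h => ?_⟩
      · rw [← ha b hb]
        funext i j k
        simp [exec, State.putArr, hb, State.putReg_arr]
      · simp [exec, State.putArr, NExpr.eval, RExpr.eval, h10, h11, hg', State.putReg_arr, hsum,
          Finset.sum_range_succ]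
      · rw [← hold j' k' h]
        simp only [exec, State.putArr, NExpr.eval, h10, h11]
        rw [if_neg (by omega), State.putReg_arr]
  exact ⟨key.2.2.1, key.2.2.2⟩

/-- Matrix product. -/
def Program.mulMat (c a b : ℕ) : Program :=
  forEntries (accumulate c (.mul (.get a (.const 0) (.reg 10) (.reg 12))
    (.get b (.const 0) (.reg 12) (.reg 11))))

theorem Program.mat_mulMat {a b c n : ℕ} {s : State} (hn : s.reg 1 = n) (ha : a ≠ c) (hb : b ≠ c) :
    ((mulMat c a b).exec s).mat n c = s.mat n a * s.mat n b := by
  have : s.mat n a * s.mat n b = Matrix.of fun j k : Fin n => ∑ l ∈ Finset.range n,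
      s.arr a 0 j l * s.arr b 0 l k := by
    ext j k
    rw [Matrix.of_apply, Matrix.mul_apply, Finset.sum_range]
    rfl
  rw [this]
  refine mat_forEntries hn (by simp [accumulate, writtenRegs]) (by simp [accumulate, writtenArrs])
    fun j k s' h => ?_
  have := exec_accumulate (e := .mul (.get a (.const 0) (.reg 10) (.reg 12))
    (.get b (.const 0) (.reg 12) (.reg 11))) (a := c) (s := s') (n := n)
    (by rw [h.reg 1 (by decide) (by decide) (by decide), hn])
    (g := fun l => s.arr a 0 j l * s.arr b 0 l k) (fun l _ s2 hr2 ha2 hl => by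
      simp only [RExpr.eval, NExpr.eval, hl, hr2 10 (by decide), hr2 11 (by decide), h.row, h.col,
        ha2 a ha, ha2 b hb, h.arr a ha, h.arr b hb])
  rw [h.row, h.col] at this
  exact this

/-- The trace of the matrix in the array `a`, into the scalar `c`. -/
def Program.traceMat (c a : ℕ) : Program :=
  .seq (.setReg 10 (.const 0)) (.seq (.setReg 11 (.const 0))
    (accumulate c (.get a (.const 0) (.reg 12) (.reg 12))))

theorem Program.scal_traceMat {a c n : ℕ} {s : State} (hn : s.reg 1 = n) (ha : a ≠ c) :
    ((traceMat c a).exec s).arr c 0 0 0 = (s.mat n a).trace := by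
  set s1 := (s.putReg 10 0).putReg 11 0 with hs1
  have h10 : s1.reg 10 = 0 := by simp [hs1, State.putReg_reg]
  have h11 : s1.reg 11 = 0 := by simp [hs1, State.putReg_reg]
  have h := (exec_accumulate (e := .get a (.const 0) (.reg 12) (.reg 12)) (a := c) (s := s1)
    (n := n) (by simpa [hs1, State.putReg_reg] using hn) (g := fun l => s.arr a 0 l l)
    (fun l _ s2 hr2 ha2 hl => by
      simp only [RExpr.eval, NExpr.eval, hl, ha2 a ha]
      rfl)).1
  rw [h10, h11, Finset.sum_range] at h
  exact h

/-- Squares the matrix in the array `14` as many times as the register `4` says. -/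
def Program.powMat : Program :=
  .loop 5 (.add (.reg 0) (.reg 1)) (.ite (.natLE (.add (.reg 5) (.const 1)) (.reg 4))
    (.seq (mulMat 15 14 14) (copyMat 14 15)) .skip)

/-- The loop always has r + n rounds, a bound allowed for simple programs, and idles once w
squarings are done; hence `min i w` in the invariant. -/
theorem Program.mat_powMat {n w : ℕ} {s : State} (hn : s.reg 1 = n) (hw : s.reg 4 = w)
    (hle : w ≤ s.reg 0 + s.reg 1) : (powMat.exec s).mat n 14 = s.mat n 14 ^ 2 ^ w := by
  let I : ℕ → State → Prop := fun i s' => s'.reg 1 = n ∧ s'.reg 4 = w ∧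
    s'.mat n 14 = s.mat n 14 ^ 2 ^ min i w
  have key : I (s.reg 0 + s.reg 1) (powMat.exec s) := by
    refine exec_loop_induction (I := I) rfl ⟨hn, hw, by simp⟩ ?_
    rintro i - s1 ⟨h1, h4, hm⟩
    set s2 := s1.putReg 5 i with hs2
    have e1 : s2.reg 1 = n := by simpa [hs2, State.putReg_reg] using h1
    have e4 : s2.reg 4 = w := by simpa [hs2, State.putReg_reg] using h4
    have e5 : s2.reg 5 = i := by simp [hs2, State.putReg_reg]
    have em : s2.mat n 14 = s.mat n 14 ^ 2 ^ min i w := hm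
    refine ⟨?_, ?_, ?_⟩
    · rw [exec_reg _ _ (by decide), e1]
    · rw [exec_reg _ _ (by decide), e4]
    · rw [exec]
      split_ifs with hif
      · simp only [Test.Holds, NExpr.eval, e4, e5] at hif
        rw [exec, mat_copyMat (by rw [exec_reg _ _ (by decide), e1]),
          mat_mulMat e1 (by decide) (by decide), em, ← pow_add, min_eq_left hif,
          min_eq_left (by omega), pow_succ, mul_two]
      · simp only [Test.Holds, NExpr.eval, e4, e5] at hif
        rw [exec, em, min_eq_right (by omega), min_eq_right (by omega)]
  have := key.2.2
  rwa [min_eq_right hle] at this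

/-- The potential of the matrix in the array `a` relative to the array `7`, into the scalar `c`. -/
def Program.potentialMat (c a : ℕ) : Program :=
  .seq (mulMat 8 a 7) (.seq (copyMat 14 8) (.seq powMat (traceMat c 14)))

/-- The full power stays behind in array 14; the norm estimate multiplies it once more to get the
next trace power. -/
theorem Program.mat_potentialMat {a c n w : ℕ} {s : State} (hn : s.reg 1 = n) (hw : s.reg 4 = w)
    (hle : w ≤ s.reg 0 + s.reg 1) (ha : a ≠ 8) (hc : c ≠ 14) :
    ((potentialMat c a).exec s).mat n 14 = (s.mat n a * s.mat n 7) ^ 2 ^ w := by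
  simp only [potentialMat, exec]
  rw [mat_exec _ _ _ (by simpa [traceMat, accumulate, writtenArrs] using hc.symm)]
  rw [mat_powMat (n := n) (w := w), mat_copyMat, mat_mulMat hn ha (by decide)]
  · rw [exec_reg _ _ (by simp [mulMat, forEntries, accumulate, writtenRegs]), hn]
  all_goals simp only [exec_reg (copyMat 14 8) _ (show 0 ∉ (copyMat 14 8).writtenRegs by decide),
      exec_reg (copyMat 14 8) _ (show 1 ∉ (copyMat 14 8).writtenRegs by decide),
      exec_reg (copyMat 14 8) _ (show 4 ∉ (copyMat 14 8).writtenRegs by decide),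
      exec_reg (mulMat 8 a 7) _ (show 0 ∉ (mulMat 8 a 7).writtenRegs by
        simp [mulMat, forEntries, accumulate, writtenRegs]),
      exec_reg (mulMat 8 a 7) _ (show 1 ∉ (mulMat 8 a 7).writtenRegs by
        simp [mulMat, forEntries, accumulate, writtenRegs]),
      exec_reg (mulMat 8 a 7) _ (show 4 ∉ (mulMat 8 a 7).writtenRegs by
        simp [mulMat, forEntries, accumulate, writtenRegs]), hn, hw]
  rw [← hn]
  exact hle

theorem Program.scal_potentialMat {a c n w : ℕ} {s : State} (hn : s.reg 1 = n) (hw : s.reg 4 = w)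
    (hle : w ≤ s.reg 0 + s.reg 1) (ha : a ≠ 8) (hc : c ≠ 14) :
    ((potentialMat c a).exec s).arr c 0 0 0 = potential (s.mat n 7) (2 ^ w) (s.mat n a) := by
  have h1 := mat_potentialMat hn hw hle ha hc
  simp only [potentialMat, exec] at h1 ⊢
  rw [mat_exec _ _ _ (by simpa [traceMat, accumulate, writtenArrs] using hc.symm)] at h1
  rw [scal_traceMat (n := n) _ hc.symm, h1, potential]
  have : 1 ∉ (mulMat 8 a 7).writtenRegs := by simp [mulMat, forEntries, accumulate, writtenRegs]
  rw [exec_reg _ _ (by decide), exec_reg _ _ (by decide), exec_reg _ _ this, hn]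

end MatrixPrograms

/-! ### The program and the specification of its parts. -/

section SparsificationProgram

open Program

/-- Sequential composition of a list of programs. -/
def Program.block : List Program → Program
  | [] => .skip
  | c :: cs => .seq c (block cs)

/-- Loads the matrix `A_i` of the sub-collection, `i` being in the register `2`, into the
array `4`. -/
def loadItem : Program :=
  setMat 4 (.mul (.get 1 (.reg 2) (.reg 10) (.reg 11)) (.get 2 (.reg 2) (.const 0) (.const 0)))

/-- The sum of the sub-collection, into the array `5`. -/
def sumProgram : Program :=
  .loop 2 (.reg 0) (block [loadItem, setMat 5 (.add (.entry 5) (.entry 4))])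

/-- The identity matrix, into the array `6`. -/
def identityProgram : Program :=
  forEntries (.ite (.and (.natLE (.reg 10) (.reg 11)) (.natLE (.reg 11) (.reg 10)))
    (.setArr 6 (.const 0) (.reg 10) (.reg 11) (.const 1))
    (.setArr 6 (.const 0) (.reg 10) (.reg 11) (.const 0)))

/-- The generalized inverse of the matrix in the array `5`, into the array `7`. -/
def genInvProgram : Program :=
  .loop 3 (.reg 1) (block [mulMat 8 7 5, mulMat 9 5 8,
    setScal 10 (.sub (.get 5 (.const 0) (.reg 3) (.reg 3)) (.get 9 (.const 0) (.reg 3) (.reg 3))),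
    setMat 7 (.add (.entry 7) (.div
      (.mul (.sub (.get 6 (.const 0) (.reg 10) (.reg 3)) (.get 8 (.const 0) (.reg 10) (.reg 3)))
        (.sub (.get 6 (.const 0) (.reg 11) (.reg 3)) (.get 8 (.const 0) (.reg 11) (.reg 3))))
      (.scal 10)))])

/-- The rank of the matrix in the array `5`, into the array `11`. -/
def rankProgram : Program := block [mulMat 8 5 7, traceMat 11 8]

/-- Finds the exponent `2 ^ w` of the potentials: `w` in the register `4`, `2 ^ w` in the
array `13`, and `(1 + ε² / 32) ^ 2 ^ w` in the array `12`. -/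
def exponentProgram : Program :=
  block [setScal 12 (.add (.const 1) (.div (.mul (.scal 0) (.scal 0)) (.const 32))),
    setScal 13 (.const 1), .setReg 4 (.const 0),
    .loop 2 (.add (.reg 0) (.reg 1))
      (.ite (.realLE (.mul (.const 3) (.scal 11)) (.scal 12)) .skip
        (block [setScal 12 (.mul (.scal 12) (.scal 12)), setScal 13 (.add (.scal 13) (.scal 13)),
          .setReg 4 (.add (.reg 4) (.const 1))]))]

/-- All weights equal to one. -/
def trivialProgram : Program :=
  .loop 2 (.reg 0) (.setArr 3 (.reg 2) (.const 0) (.const 0) (.const 1))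

/-- The probabilities of the rounding, into the array `18`, and their sum, into the array `19`. -/
def probProgram : Program :=
  .loop 2 (.reg 0) (block [loadItem, mulMat 16 4 7, potentialMat 17 4, mulMat 8 14 16,
    traceMat 10 8,
    setScal 31 (.mul (.mul (.const 8) (.scal 13)) (.div (.scal 10) (.scal 17))),
    .ite (.realLE (.const 1) (.scal 31)) (setScal 31 (.const 1)) .skip,
    .setArr 18 (.reg 2) (.const 0) (.const 0) (.scal 31),
    setScal 19 (.add (.scal 19) (.scal 31))])

/-- Prepares the loop of the rounding. -/
def initProgram : Program :=
  block [setScal 20 (.scal 19), copyMat 21 5, copyMat 22 5,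
    setScal 25 (.div (.const 1) (.add (.div (.const 8) (.scal 0))
      (.add (.const 1) (.div (.scal 0) (.const 4))))),
    setScal 26 (.div (.const 1) (.sub (.div (.const 8) (.scal 0))
      (.sub (.const 1) (.div (.scal 0) (.const 4)))))]

/-- The probability of the item in the register `2`. -/
abbrev probExpr : RExpr := .get 18 (.reg 2) (.const 0) (.const 0)

/-- Computes the matrices and the potentials of the two choices. -/
def compareProgram : Program :=
  block [loadItem,
    setMat 23 (.sub (.entry 21) (.mul (.mul (.scal 25) (.add (.const 1) (.div (.scal 0) (.const 4))))
      (.entry 4))),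
    setMat 24 (.add (.entry 22) (.mul (.mul (.scal 26) (.sub (.const 1) (.div (.scal 0) (.const 4))))
      (.entry 4))),
    potentialMat 27 23, potentialMat 28 24,
    setScal 29 (.add (.add (.scal 27) (.scal 28))
      (.div (.mul (.scal 11) (.sub (.scal 20) probExpr)) (.scal 19))),
    setMat 21 (.add (.entry 23) (.mul (.div (.scal 25) probExpr) (.entry 4))),
    setMat 22 (.sub (.entry 24) (.mul (.div (.scal 26) probExpr) (.entry 4))),
    potentialMat 27 21, potentialMat 28 22,
    setScal 30 (.add (.add (.scal 27) (.scal 28))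
      (.div (.mul (.scal 11) (.add (.sub (.scal 20) probExpr) (.const 1))) (.scal 19)))]

/-- Carries out the choice with the smaller potential. -/
def chooseProgram : Program :=
  .ite (.realLE (.scal 30) (.scal 29))
    (block [.setArr 3 (.reg 2) (.const 0) (.const 0) (.div (.const 1) probExpr),
      setScal 20 (.add (.sub (.scal 20) probExpr) (.const 1))])
    (block [copyMat 21 23, copyMat 22 24,
      .setArr 3 (.reg 2) (.const 0) (.const 0) (.const 0),
      setScal 20 (.sub (.scal 20) probExpr)])

/-- The derandomised rounding. -/
def roundProgram : Program := .loop 2 (.reg 0) (block [compareProgram, chooseProgram])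

/-- The sparsification algorithm. -/
def sparsify : Program :=
  block [sumProgram, identityProgram, genInvProgram, rankProgram, exponentProgram,
    .ite (.realLE (.mul (.const 3) (.scal 11)) (.scal 12))
      (block [probProgram, initProgram, roundProgram]) trivialProgram]

theorem sparsify_simple : sparsify.Simple := by
  simp [sparsify, block, sumProgram, identityProgram, genInvProgram, rankProgram, exponentProgram,
    probProgram, initProgram, roundProgram, trivialProgram, compareProgram, chooseProgram, loadItem,
    setMat, forEntries, mulMat, accumulate, traceMat, potentialMat, powMat, copyMat, Simple]

section Correctness

variable {r n : ℕ}

/-- The input is still in place. -/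
structure HasInput (A : Fin r → Matrix (Fin n) (Fin n) ℝ) (ε : ℝ) (T : Finset (Fin r))
    (s : State) : Prop where
  reg0 : s.reg 0 = r
  reg1 : s.reg 1 = n
  eps : s.arr 0 0 0 0 = ε
  fam : ∀ (i : Fin r) (j k : Fin n), s.arr 1 i j k = A i j k
  ind : ∀ i : Fin r, s.arr 2 i 0 0 = if i ∈ T then 1 else 0

variable {A : Fin r → Matrix (Fin n) (Fin n) ℝ} {ε : ℝ} {T : Finset (Fin r)} {s : State}

theorem HasInput.exec (h : HasInput A ε T s) (c : Program)
    (hc : (0 ∉ c.writtenRegs ∧ 1 ∉ c.writtenRegs) ∧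
      0 ∉ c.writtenArrs ∧ 1 ∉ c.writtenArrs ∧ 2 ∉ c.writtenArrs) :
    HasInput A ε T (c.exec s) := by
  obtain ⟨⟨h0, h1⟩, h2, h3, h4⟩ := hc
  refine ⟨?_, ?_, ?_, ?_, ?_⟩
  · rw [c.exec_reg s h0, h.reg0]
  · rw [c.exec_reg s h1, h.reg1]
  · rw [c.exec_arr s h2, h.eps]
  · rw [c.exec_arr s h3]; exact h.fam
  · rw [c.exec_arr s h4]; exact h.ind

theorem HasInput.putReg (h : HasInput A ε T s) {x : ℕ} (hx : 2 ≤ x) (v : ℕ) :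
    HasInput A ε T (s.putReg x v) := by
  refine ⟨?_, ?_, h.eps, h.fam, h.ind⟩
  · rw [State.putReg_reg, if_neg (by omega), h.reg0]
  · rw [State.putReg_reg, if_neg (by omega), h.reg1]

theorem hasInput_inputState : HasInput A ε T (inputState A ε T) := by
  refine ⟨rfl, rfl, by simp [inputState], fun i j k => ?_, fun i => ?_⟩
  · simp [inputState]
  · simp [inputState]

theorem mat_loadItem (h : HasInput A ε T s) {i : ℕ} (hi : i < r) (h2 : s.reg 2 = i) :
    (loadItem.exec s).mat n 4 = masked A T ⟨i, hi⟩ := by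
  obtain ⟨i, rfl⟩ : ∃ i' : Fin r, (i' : ℕ) = i := ⟨⟨i, hi⟩, rfl⟩
  rw [loadItem, mat_setMat (f := fun j k => masked A T i j k) h.reg1]
  · rfl
  · intro j k s' hs
    simp only [RExpr.eval, NExpr.eval, hs.row, hs.col, hs.reg 2 (by decide) (by decide) (by decide),
      h2, hs.arr 1 (by decide), hs.arr 2 (by decide), h.fam, h.ind, masked]
    split_ifs <;> simp

theorem mat_sumProgram (h : HasInput A ε T s) (h5 : s.mat n 5 = 0) :
    (sumProgram.exec s).mat n 5 = ∑ i, masked A T i := by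
  let I : ℕ → State → Prop := fun i s' => HasInput A ε T s' ∧
    s'.mat n 5 = lowSum (masked A T) (fun _ => 1) i
  have key : I r (sumProgram.exec s) := by
    refine exec_loop_induction (I := I) h.reg0 ⟨h, by rw [h5]; simp [lowSum]⟩ ?_
    rintro i hi s1 ⟨hin, h51⟩
    have hin2 := hin.putReg (show 2 ≤ 2 by omega) i
    have e4 := mat_loadItem hin2 hi (by simp [State.putReg_reg])
    have e5 : (loadItem.exec (s1.putReg 2 i)).mat n 5 = lowSum (masked A T) (fun _ => 1) i := by
      rw [mat_exec _ _ _ (by decide)]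
      exact h51
    refine ⟨hin2.exec _ (by decide), ?_⟩
    simp only [block, exec]
    rw [mat_setMat (f := fun j k => (lowSum (masked A T) (fun _ => 1) i + masked A T ⟨i, hi⟩) j k)
      (hin2.exec loadItem (by decide)).reg1, lowSum_succ (masked A T) hi (fun _ _ => rfl), one_smul]
    · rfl
    · intro j k s' hs
      simp only [RExpr.eval, NExpr.eval, hs.row, hs.col, hs.entry, hs.arr 4 (by decide),
        State.arr_of_mat e4, State.arr_of_mat e5, Matrix.add_apply]
  have := key.2
  rw [lowSum_self] at this
  simpa using this

theorem mat_identityProgram (hn : s.reg 1 = n) : (identityProgram.exec s).mat n 6 = 1 := by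
  rw [identityProgram, mat_forEntries (f := fun j k => (1 : Matrix (Fin n) (Fin n) ℝ) j k) hn]
  · rfl
  · simp [writtenRegs]
  · simp [writtenArrs]
  · intro j k s' hs
    have hiff : (s'.reg 10 ≤ s'.reg 11 ∧ s'.reg 11 ≤ s'.reg 10) ↔ j = k := by
      rw [hs.row, hs.col, Fin.ext_iff]
      omega
    simp only [exec, Test.Holds, NExpr.eval, hiff]
    by_cases hjk : j = k
    · rw [if_pos hjk]
      subst hjk
      refine ⟨by simp [State.putArr, hs.row, hs.col, RExpr.eval], fun j' k' hne => ?_⟩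
      simp only [State.putArr, hs.row, hs.col]
      rw [if_neg]
      omega
    · rw [if_neg hjk]
      refine ⟨by simp [State.putArr, hs.row, hs.col, hjk, RExpr.eval], fun j' k' hne => ?_⟩
      simp only [State.putArr, hs.row, hs.col]
      rw [if_neg]
      omega

/-- Each round is one application of `IsPartialGenInv.succ`; the machine's division by zero agrees
with the convention 0⁻¹ = 0 used there. -/
theorem mat_genInvProgram {M : Matrix (Fin n) (Fin n) ℝ} (hM : 0 ≤ M) (hn : s.reg 1 = n)
    (h5 : s.mat n 5 = M) (h6 : s.mat n 6 = 1) (h7 : s.mat n 7 = 0) :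
    IsGenInv M ((genInvProgram.exec s).mat n 7) := by
  let I : ℕ → State → Prop := fun k s' => s'.reg 1 = n ∧ s'.mat n 5 = M ∧ s'.mat n 6 = 1 ∧
    IsPartialGenInv M (s'.mat n 7) k
  have key : I n (genInvProgram.exec s) := by
    refine exec_loop_induction (I := I) hn ⟨hn, h5, h6, by rw [h7]; exact IsPartialGenInv.zero M⟩ ?_
    rintro k hk s0 ⟨h1', h5', h6', h7'⟩
    obtain ⟨κ, rfl⟩ : ∃ κ : Fin n, (κ : ℕ) = k := ⟨⟨k, hk⟩, rfl⟩
    obtain ⟨s1, d1⟩ : ∃ t, t = s0.putReg 3 κ := ⟨_, rfl⟩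
    obtain ⟨s2, d2⟩ : ∃ t, t = (mulMat 8 7 5).exec s1 := ⟨_, rfl⟩
    obtain ⟨s3, d3⟩ : ∃ t, t = (mulMat 9 5 8).exec s2 := ⟨_, rfl⟩
    obtain ⟨s4, d4⟩ : ∃ t, t = (setScal 10 (.sub (.get 5 (.const 0) (.reg 3) (.reg 3))
      (.get 9 (.const 0) (.reg 3) (.reg 3)))).exec s3 := ⟨_, rfl⟩
    have r1 : s1.reg 1 = n := by rw [d1, State.putReg_reg, if_neg (by decide), h1']
    have r3 : s1.reg 3 = κ := by rw [d1, State.putReg_reg, if_pos rfl]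
    have e5 : s1.mat n 5 = M := by rw [d1]; exact h5'
    have e6 : s1.mat n 6 = 1 := by rw [d1]; exact h6'
    have e7 : s1.mat n 7 = s0.mat n 7 := by rw [d1]; rfl
    set H := s0.mat n 7 with hH
    have e8 : s2.mat n 8 = H * M := by rw [d2, mat_mulMat r1 (by decide) (by decide), e7, e5]
    have r12 : s2.reg 1 = n := by rw [d2, exec_reg _ _ (by decide), r1]
    have e52 : s2.mat n 5 = M := by rw [d2, mat_exec _ _ _ (by decide), e5]
    have e9 : s3.mat n 9 = M * (H * M) := by
      rw [d3, mat_mulMat r12 (by decide) (by decide), e52, e8]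
    have e53 : s3.mat n 5 = M := by rw [d3, mat_exec _ _ _ (by decide), e52]
    have r33 : s3.reg 3 = κ := by
      rw [d3, exec_reg _ _ (by decide), d2, exec_reg _ _ (by decide), r3]
    have e10 : s4.arr 10 0 0 0 = M κ κ - (M * (H * M)) κ κ := by
      rw [d4, exec_setScal]
      simp only [RExpr.eval, NExpr.eval, r33, State.arr_of_mat e53, State.arr_of_mat e9]
    have e74 : s4.mat n 7 = H := by
      rw [d4, mat_exec _ _ _ (by decide), d3, mat_exec _ _ _ (by decide), d2,
        mat_exec _ _ _ (by decide), e7]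
    have e64 : s4.mat n 6 = 1 := by
      rw [d4, mat_exec _ _ _ (by decide), d3, mat_exec _ _ _ (by decide), d2,
        mat_exec _ _ _ (by decide), e6]
    have e84 : s4.mat n 8 = H * M := by
      rw [d4, mat_exec _ _ _ (by decide), d3, mat_exec _ _ _ (by decide), e8]
    have e54 : s4.mat n 5 = M := by rw [d4, mat_exec _ _ _ (by decide), e53]
    have r14 : s4.reg 1 = n := by
      rw [d4, exec_reg _ _ (by decide), d3, exec_reg _ _ (by decide), r12]
    have r34 : s4.reg 3 = κ := by rw [d4, exec_reg _ _ (by decide), r33]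
    have hnext := h7'.succ hM κ.2
    simp only [block, exec] at d4 ⊢
    rw [← d1, ← d2, ← d3, ← d4]
    refine ⟨?_, ?_, ?_, ?_⟩
    · rw [exec_reg _ _ (by decide), r14]
    · rw [mat_exec _ _ _ (by decide), e54]
    · rw [mat_exec _ _ _ (by decide), e64]
    · rw [mat_setMat (f := fun j l => (H + (M κ κ - (M * (H * M)) κ κ)⁻¹ •
        Matrix.of fun j l => (1 - H * M) j κ * (1 - H * M) l κ) j l) r14]
      · exact hnext
      · intro j l s' hs
        simp only [RExpr.eval, NExpr.eval, hs.row, hs.col, hs.entry, hs.arr 6 (by decide),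
          hs.arr 8 (by decide), hs.arr 10 (by decide), hs.reg 3 (by decide) (by decide) (by decide),
          r34, State.arr_of_mat e74, State.arr_of_mat e64, State.arr_of_mat e84, e10,
          Matrix.add_apply, Matrix.smul_apply, Matrix.of_apply, Matrix.sub_apply, smul_eq_mul]
        rw [div_eq_inv_mul]
  exact key.2.2.2.isGenInv

theorem scal_rankProgram {M : Matrix (Fin n) (Fin n) ℝ} (hM : 0 ≤ M) (hn : s.reg 1 = n)
    (h5 : s.mat n 5 = M) (h7 : IsGenInv M (s.mat n 7)) :
    (rankProgram.exec s).arr 11 0 0 0 = M.rank := by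
  simp only [rankProgram, block, exec]
  rw [scal_traceMat (n := n) _ (by decide), mat_mulMat hn (by decide) (by decide), h5,
    h7.trace_mul hM]
  rw [exec_reg _ _ (by decide), hn]

/-- Squaring stops at the first success. The last two clauses say that the preceding exponent was
insufficient, which bounds the size, and that either the final one suffices or all r + n rounds were
used up. -/
theorem exponentProgram_spec (h : HasInput A ε T s) {m : ℝ} (h11 : s.arr 11 0 0 0 = m) :
    ∃ w : ℕ, w ≤ r + n ∧ (exponentProgram.exec s).reg 4 = w ∧
      (exponentProgram.exec s).arr 12 0 0 0 = (1 + ε ^ 2 / 32) ^ 2 ^ w ∧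
      (exponentProgram.exec s).arr 13 0 0 0 = 2 ^ w ∧
      (w = 0 ∨ (1 + ε ^ 2 / 32) ^ 2 ^ (w - 1) < 3 * m) ∧
      (3 * m ≤ (1 + ε ^ 2 / 32) ^ 2 ^ w ∨ w = r + n) := by
  let I : ℕ → State → Prop := fun i s' => s'.arr 11 0 0 0 = m ∧
    ∃ w : ℕ, w ≤ i ∧ s'.reg 4 = w ∧
      s'.arr 12 0 0 0 = (1 + ε ^ 2 / 32) ^ 2 ^ w ∧ s'.arr 13 0 0 0 = 2 ^ w ∧
      (w = 0 ∨ (1 + ε ^ 2 / 32) ^ 2 ^ (w - 1) < 3 * m) ∧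
      (3 * m ≤ (1 + ε ^ 2 / 32) ^ 2 ^ w ∨ w = i)
  have key : I (r + n) (exponentProgram.exec s) := by
    simp only [exponentProgram, block]
    rw [exec, exec, exec, exec]
    refine exec_loop_induction (I := I) ?_ ⟨?_, 0, le_rfl, ?_, ?_, ?_, Or.inl rfl, Or.inr rfl⟩ ?_
    · simp [exec, NExpr.eval, State.putReg_reg, State.putArr, h.reg0, h.reg1]
    · simp [exec, State.putReg_arr, State.putArr, h11]
    · simp [exec, NExpr.eval, State.putReg_reg]
    · simp [exec, State.putReg_arr, State.putArr, NExpr.eval, RExpr.eval, h.eps, pow_two]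
    · simp [exec, State.putReg_arr, State.putArr, NExpr.eval, RExpr.eval]
    · rintro i hi s1 ⟨h11', w, hwi, hw, h12, h13, hlt, hle⟩
      by_cases hif : 3 * m ≤ (1 + ε ^ 2 / 32) ^ 2 ^ w
      · have hT : Test.Holds (s1.putReg 2 i) (.realLE (.mul (.const 3) (.scal 11)) (.scal 12)) := by
          simpa [Test.Holds, RExpr.eval, NExpr.eval, State.putReg_arr, h11', h12] using hif
        rw [exec, if_pos hT, exec]
        refine ⟨h11', w, by omega, ?_, h12, h13, hlt, Or.inl hif⟩
        simpa [State.putReg_reg] using hw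
      · have hT : ¬ Test.Holds (s1.putReg 2 i)
            (.realLE (.mul (.const 3) (.scal 11)) (.scal 12)) := by
          simpa [Test.Holds, RExpr.eval, NExpr.eval, State.putReg_arr, h11', h12] using hif
        rw [exec, if_neg hT]
        refine ⟨?_, w + 1, by omega, ?_, ?_, ?_, Or.inr ?_, ?_⟩
        · simp [exec, State.putReg_arr, State.putArr, h11']
        · simp [exec, NExpr.eval, State.putReg_reg, State.putArr, hw]
        · simp [exec, State.putReg_arr, State.putArr, NExpr.eval, RExpr.eval, h12]
          rw [← pow_add, pow_succ 2, mul_two]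
        · simp [exec, State.putReg_arr, State.putArr, NExpr.eval, RExpr.eval, h13, pow_succ]
          ring
        · simpa using lt_of_not_ge hif
        · exact Or.inr (by rw [hle.resolve_left hif])
  exact key.2

theorem trivialProgram_spec (h : HasInput A ε T s) (i : Fin r) :
    (trivialProgram.exec s).arr 3 i 0 0 = 1 := by
  let I : ℕ → State → Prop := fun k s' => ∀ i : Fin r, (i : ℕ) < k → s'.arr 3 i 0 0 = 1
  have key : I r (trivialProgram.exec s) := by
    refine exec_loop_induction (I := I) h.reg0 (fun i hi => absurd hi (by omega)) ?_
    intro k hk s' hs i hi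
    by_cases hik : (i : ℕ) = k
    · simp [exec, State.putArr, NExpr.eval, RExpr.eval, State.putReg_reg, hik]
    · simp [exec, State.putArr, NExpr.eval, State.putReg_reg, State.putReg_arr, hik,
        hs i (by omega)]
  exact key i i.2

theorem probProgram_spec (h : HasInput A ε T s) {H : Matrix (Fin n) (Fin n) ℝ}
    (h7 : s.mat n 7 = H) {w : ℕ} (hw : w ≤ r + n) (h4 : s.reg 4 = w)
    (h13 : s.arr 13 0 0 0 = 2 ^ w) (h19 : s.arr 19 0 0 0 = 0) :
    (∀ j : Fin r, (probProgram.exec s).arr 18 j 0 0 = keepProb H (masked A T j) (2 ^ w)) ∧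
    (probProgram.exec s).arr 19 0 0 0 = ∑ j, keepProb H (masked A T j) (2 ^ w) := by
  set q : Fin r → ℝ := fun j => keepProb H (masked A T j) (2 ^ w) with hq
  let I : ℕ → State → Prop := fun i s' => HasInput A ε T s' ∧ s'.mat n 7 = H ∧ s'.reg 4 = w ∧
    s'.arr 13 0 0 0 = 2 ^ w ∧ (∀ j : Fin r, (j : ℕ) < i → s'.arr 18 j 0 0 = q j) ∧
    s'.arr 19 0 0 0 = ∑ j, q j - highSum q i
  have key : I r (probProgram.exec s) := by
    refine exec_loop_induction (I := I) h.reg0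
      ⟨h, h7, h4, h13, fun j hj => absurd hj (by omega), by rw [h19]; simp [highSum]⟩ ?_
    rintro i hi s0 ⟨hin, h7', h4', h13', h18', h19'⟩
    obtain ⟨s1, d1⟩ : ∃ t, t = s0.putReg 2 i := ⟨_, rfl⟩
    have i1 : HasInput A ε T s1 := d1 ▸ hin.putReg (by omega) i
    have r2 : s1.reg 2 = i := by rw [d1, State.putReg_reg, if_pos rfl]
    have r4 : s1.reg 4 = w := by rw [d1, State.putReg_reg, if_neg (by decide), h4']
    have a1 : s1.arr = s0.arr := by rw [d1]; rfl
    obtain ⟨s2, d2⟩ : ∃ t, t = loadItem.exec s1 := ⟨_, rfl⟩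
    obtain ⟨s3, d3⟩ : ∃ t, t = (mulMat 16 4 7).exec s2 := ⟨_, rfl⟩
    obtain ⟨s4, d4⟩ : ∃ t, t = (potentialMat 17 4).exec s3 := ⟨_, rfl⟩
    obtain ⟨s5, d5⟩ : ∃ t, t = (mulMat 8 14 16).exec s4 := ⟨_, rfl⟩
    obtain ⟨s6, d6⟩ : ∃ t, t = (traceMat 10 8).exec s5 := ⟨_, rfl⟩
    obtain ⟨s7, d7⟩ : ∃ t, t = (setScal 31 (.mul (.mul (.const 8) (.scal 13))
      (.div (.scal 10) (.scal 17)))).exec s6 := ⟨_, rfl⟩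
    obtain ⟨s8, d8⟩ : ∃ t, t = (Program.ite (.realLE (.const 1) (.scal 31))
      (setScal 31 (.const 1)) .skip).exec s7 := ⟨_, rfl⟩
    have i2 : HasInput A ε T s2 := d2 ▸ i1.exec _ (by decide)
    have i3 : HasInput A ε T s3 := d3 ▸ i2.exec _ (by decide)
    have i4 : HasInput A ε T s4 := d4 ▸ i3.exec _ (by decide)
    have i5 : HasInput A ε T s5 := d5 ▸ i4.exec _ (by decide)
    have i6 : HasInput A ε T s6 := d6 ▸ i5.exec _ (by decide)
    have i7 : HasInput A ε T s7 := d7 ▸ i6.exec _ (by decide)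
    have i8 : HasInput A ε T s8 := d8 ▸ i7.exec _ (by decide)
    set X := masked A T ⟨i, hi⟩ with hX
    have e4 : s2.mat n 4 = X := d2 ▸ mat_loadItem i1 hi r2
    have e7 : s2.mat n 7 = H := by
      rw [d2, mat_exec _ _ _ (by decide), d1]; exact h7'
    have e16 : s3.mat n 16 = X * H := by
      rw [d3, mat_mulMat i2.reg1 (by decide) (by decide), e4, e7]
    have e43 : s3.mat n 4 = X := by rw [d3, mat_exec _ _ _ (by decide), e4]
    have e73 : s3.mat n 7 = H := by rw [d3, mat_exec _ _ _ (by decide), e7]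
    have r43 : s3.reg 4 = w := by
      rw [d3, exec_reg _ _ (by decide), d2, exec_reg _ _ (by decide), r4]
    have hw3 : w ≤ s3.reg 0 + s3.reg 1 := by rw [i3.reg0, i3.reg1]; exact hw
    have e17 : s4.arr 17 0 0 0 = ((X * H) ^ 2 ^ w).trace := by
      rw [d4, scal_potentialMat i3.reg1 r43 hw3 (by decide) (by decide), e43, e73, potential]
    have e14 : s4.mat n 14 = (X * H) ^ 2 ^ w := by
      rw [d4, mat_potentialMat i3.reg1 r43 hw3 (by decide) (by decide), e43, e73]
    have e164 : s4.mat n 16 = X * H := by rw [d4, mat_exec _ _ _ (by decide), e16]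
    have e8 : s5.mat n 8 = (X * H) ^ (2 ^ w + 1) := by
      rw [d5, mat_mulMat i4.reg1 (by decide) (by decide), e14, e164, pow_succ]
    have e10 : s6.arr 10 0 0 0 = ((X * H) ^ (2 ^ w + 1)).trace := by
      rw [d6, scal_traceMat i5.reg1 (by decide), e8]
    have e176 : s6.arr 17 0 0 0 = ((X * H) ^ 2 ^ w).trace := by
      rw [d6, exec_arr _ _ (by decide), d5, exec_arr _ _ (by decide), e17]
    have e136 : s6.arr 13 0 0 0 = 2 ^ w := by
      rw [d6, exec_arr _ _ (by decide), d5, exec_arr _ _ (by decide), d4, exec_arr _ _ (by decide),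
        d3, exec_arr _ _ (by decide), d2, exec_arr _ _ (by decide), a1, h13']
    -- The factor 8 of the program is the 4 of the probability times the 2 of the norm estimate.
    have e31 : s7.arr 31 0 0 0 = 4 * (2 ^ w : ℕ) * importance H X (2 ^ w) := by
      rw [d7, exec_setScal]
      simp only [RExpr.eval, NExpr.eval, e136, e10, e176, importance]
      push_cast
      ring
    have e318 : s8.arr 31 0 0 0 = q ⟨i, hi⟩ := by
      have hqi : q ⟨i, hi⟩ = min 1 (s7.arr 31 0 0 0) := by rw [e31, hq]; rfl
      rw [d8, exec, hqi]
      have hiff : Test.Holds s7 (.realLE (.const 1) (.scal 31)) ↔ 1 ≤ s7.arr 31 0 0 0 := by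
        simp [Test.Holds, RExpr.eval, NExpr.eval]
      by_cases h1 : 1 ≤ s7.arr 31 0 0 0
      · rw [if_pos (hiff.2 h1), exec_setScal, min_eq_left h1]
        simp [RExpr.eval]
      · rw [if_neg (fun hh => h1 (hiff.1 hh)), exec, min_eq_right (le_of_not_ge h1)]
    have hframe : ∀ a, a = 7 ∨ a = 13 ∨ a = 18 ∨ a = 19 → s8.arr a = s0.arr a := by
      rintro a (rfl | rfl | rfl | rfl) <;>
      rw [d8, exec_arr _ _ (by decide), d7, exec_arr _ _ (by decide), d6, exec_arr _ _ (by decide),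
        d5, exec_arr _ _ (by decide), d4, exec_arr _ _ (by decide), d3, exec_arr _ _ (by decide),
        d2, exec_arr _ _ (by decide), a1]
    have r28 : s8.reg 2 = i := by
      rw [d8, exec_reg _ _ (by decide), d7, exec_reg _ _ (by decide), d6, exec_reg _ _ (by decide),
        d5, exec_reg _ _ (by decide), d4, exec_reg _ _ (by decide), d3, exec_reg _ _ (by decide),
        d2, exec_reg _ _ (by decide), r2]
    have r48 : s8.reg 4 = w := by
      rw [d8, exec_reg _ _ (by decide), d7, exec_reg _ _ (by decide), d6, exec_reg _ _ (by decide),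
        d5, exec_reg _ _ (by decide), d4, exec_reg _ _ (by decide), r43]
    simp only [block]
    rw [exec, exec, exec, exec, exec, exec, exec, ← d1, ← d2, ← d3, ← d4, ← d5, ← d6, ← d7, ← d8]
    refine ⟨i8.exec _ (by decide), ?_, ?_, ?_, ?_, ?_⟩
    · rw [mat_exec _ _ _ (by decide), State.mat, hframe 7 (by simp)]
      exact h7'
    · rw [exec_reg _ _ (by decide), r48]
    · rw [exec_arr _ _ (by decide), hframe 13 (by simp), h13']
    · intro j hj
      simp only [exec, State.putArr, NExpr.eval, r28, RExpr.eval, e318]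
      rcases Nat.lt_succ_iff_lt_or_eq.1 hj with hj | hj
      · have : (j : ℕ) ≠ i := by omega
        simp [this, hframe 18, h18' j hj]
      · obtain rfl : j = ⟨i, hi⟩ := Fin.ext hj
        simp
    · have := highSum_eq_add q hi
      simp [exec, State.putArr, NExpr.eval, r28, RExpr.eval, e318, hframe 19, h19']
      linarith
  refine ⟨fun j => key.2.2.2.2.1 j j.2, ?_⟩
  rw [key.2.2.2.2.2, highSum_self, sub_zero]

end Correctness

end SparsificationProgram

/-! ### The program of the rounding maintains the invariant. -/

section SparsificationCorrect

open Program

variable {r n : ℕ} {A : Fin r → Matrix (Fin n) (Fin n) ℝ} {ε : ℝ} {T : Finset (Fin r)} {s : State}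

/-- The data that the rounding loop uses but does not change. -/
structure RoundData (A : Fin r → Matrix (Fin n) (Fin n) ℝ) (ε : ℝ) (T : Finset (Fin r))
    (H : Matrix (Fin n) (Fin n) ℝ) (w : ℕ) (s : State) : Prop where
  input : HasInput A ε T s
  genInv : s.mat n 7 = H
  exponent : s.reg 4 = w
  rank : s.arr 11 0 0 0 = (∑ i, masked A T i).rank
  prob : ∀ j : Fin r, s.arr 18 j 0 0 = keepProb H (masked A T j) (2 ^ w)
  total : s.arr 19 0 0 0 = ∑ j, keepProb H (masked A T j) (2 ^ w)
  upperScale : s.arr 25 0 0 0 = (8 / ε + (1 + ε / 4))⁻¹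
  lowerScale : s.arr 26 0 0 0 = (8 / ε - (1 - ε / 4))⁻¹

theorem RoundData.exec {H : Matrix (Fin n) (Fin n) ℝ} {w : ℕ} (h : RoundData A ε T H w s)
    (c : Program)
    (hc : (0 ∉ c.writtenRegs ∧ 1 ∉ c.writtenRegs) ∧
      0 ∉ c.writtenArrs ∧ 1 ∉ c.writtenArrs ∧ 2 ∉ c.writtenArrs)
    (h4 : 4 ∉ c.writtenRegs)
    (ha : 7 ∉ c.writtenArrs ∧ 11 ∉ c.writtenArrs ∧ 18 ∉ c.writtenArrs ∧ 19 ∉ c.writtenArrs ∧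
      25 ∉ c.writtenArrs ∧ 26 ∉ c.writtenArrs) : RoundData A ε T H w (c.exec s) := by
  obtain ⟨h7, h11, h18, h19, h25, h26⟩ := ha
  refine ⟨h.input.exec c hc, ?_, ?_, ?_, ?_, ?_, ?_, ?_⟩
  · rw [mat_exec _ _ _ h7, h.genInv]
  · rw [exec_reg _ _ h4, h.exponent]
  · rw [exec_arr _ _ h11, h.rank]
  · rw [exec_arr _ _ h18]; exact h.prob
  · rw [exec_arr _ _ h19, h.total]
  · rw [exec_arr _ _ h25, h.upperScale]
  · rw [exec_arr _ _ h26, h.lowerScale]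

theorem RoundData.putReg {H : Matrix (Fin n) (Fin n) ℝ} {w : ℕ} (h : RoundData A ε T H w s)
    (v : ℕ) : RoundData A ε T H w (s.putReg 2 v) :=
  ⟨h.input.putReg le_rfl v, h.genInv, h.exponent, h.rank, h.prob, h.total, h.upperScale,
    h.lowerScale⟩

/-- Afterwards arrays 21 and 22 hold the option of keeping the item, while the option of dropping it
waits in 23 and 24 in case it wins. The matrices are named through equations so that they can be
unified with those of `RoundInv.step`. -/
theorem compareProgram_spec {H : Matrix (Fin n) (Fin n) ℝ} {w : ℕ} (h : RoundData A ε T H w s)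
    (hw : w ≤ r + n) {i : ℕ} (hi : i < r) (h2 : s.reg 2 = i)
    {U V U₀ V₀ U₁ V₁ : Matrix (Fin n) (Fin n) ℝ} {q c : ℝ} (h21 : s.mat n 21 = U)
    (h22 : s.mat n 22 = V) (h20 : s.arr 20 0 0 0 = c)
    (hq : q = keepProb H (masked A T ⟨i, hi⟩) (2 ^ w))
    (hU₀ : U₀ = U - ((8 / ε + (1 + ε / 4))⁻¹ * (1 + ε / 4)) • masked A T ⟨i, hi⟩)
    (hV₀ : V₀ = V + ((8 / ε - (1 - ε / 4))⁻¹ * (1 - ε / 4)) • masked A T ⟨i, hi⟩)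
    (hU₁ : U₁ = U₀ + ((8 / ε + (1 + ε / 4))⁻¹ * q⁻¹) • masked A T ⟨i, hi⟩)
    (hV₁ : V₁ = V₀ - ((8 / ε - (1 - ε / 4))⁻¹ * q⁻¹) • masked A T ⟨i, hi⟩) :
    (compareProgram.exec s).mat n 21 = U₁ ∧ (compareProgram.exec s).mat n 22 = V₁ ∧
    (compareProgram.exec s).mat n 23 = U₀ ∧ (compareProgram.exec s).mat n 24 = V₀ ∧
    (compareProgram.exec s).arr 29 0 0 0 = potential H (2 ^ w) U₀ + potential H (2 ^ w) V₀
      + (∑ i, masked A T i).rank * (c - q) / ∑ j, keepProb H (masked A T j) (2 ^ w) ∧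
    (compareProgram.exec s).arr 30 0 0 0 = potential H (2 ^ w) U₁ + potential H (2 ^ w) V₁
      + (∑ i, masked A T i).rank * (c - q + 1) / ∑ j, keepProb H (masked A T j) (2 ^ w) := by
  obtain ⟨s1, d1⟩ : ∃ t, t = loadItem.exec s := ⟨_, rfl⟩
  obtain ⟨s2, d2⟩ : ∃ t, t = (setMat 23 (.sub (.entry 21) (.mul (.mul (.scal 25)
    (.add (.const 1) (.div (.scal 0) (.const 4)))) (.entry 4)))).exec s1 := ⟨_, rfl⟩
  obtain ⟨s3, d3⟩ : ∃ t, t = (setMat 24 (.add (.entry 22) (.mul (.mul (.scal 26)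
    (.sub (.const 1) (.div (.scal 0) (.const 4)))) (.entry 4)))).exec s2 := ⟨_, rfl⟩
  obtain ⟨s4, d4⟩ : ∃ t, t = (potentialMat 27 23).exec s3 := ⟨_, rfl⟩
  obtain ⟨s5, d5⟩ : ∃ t, t = (potentialMat 28 24).exec s4 := ⟨_, rfl⟩
  obtain ⟨s6, d6⟩ : ∃ t, t = (setScal 29 (.add (.add (.scal 27) (.scal 28))
    (.div (.mul (.scal 11) (.sub (.scal 20) probExpr)) (.scal 19)))).exec s5 := ⟨_, rfl⟩
  obtain ⟨s7, d7⟩ : ∃ t, t = (setMat 21 (.add (.entry 23)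
    (.mul (.div (.scal 25) probExpr) (.entry 4)))).exec s6 := ⟨_, rfl⟩
  obtain ⟨s8, d8⟩ : ∃ t, t = (setMat 22 (.sub (.entry 24)
    (.mul (.div (.scal 26) probExpr) (.entry 4)))).exec s7 := ⟨_, rfl⟩
  obtain ⟨s9, d9⟩ : ∃ t, t = (potentialMat 27 21).exec s8 := ⟨_, rfl⟩
  obtain ⟨s10, d10⟩ : ∃ t, t = (potentialMat 28 22).exec s9 := ⟨_, rfl⟩
  obtain ⟨s11, d11⟩ : ∃ t, t = (setScal 30 (.add (.add (.scal 27) (.scal 28))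
    (.div (.mul (.scal 11) (.add (.sub (.scal 20) probExpr) (.const 1)))
      (.scal 19)))).exec s10 := ⟨_, rfl⟩
  have D1 : RoundData A ε T H w s1 := d1 ▸ h.exec _ (by decide) (by decide) (by decide)
  have D2 : RoundData A ε T H w s2 := d2 ▸ D1.exec _ (by decide) (by decide) (by decide)
  have D3 : RoundData A ε T H w s3 := d3 ▸ D2.exec _ (by decide) (by decide) (by decide)
  have D4 : RoundData A ε T H w s4 := d4 ▸ D3.exec _ (by decide) (by decide) (by decide)
  have D5 : RoundData A ε T H w s5 := d5 ▸ D4.exec _ (by decide) (by decide) (by decide)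
  have D6 : RoundData A ε T H w s6 := d6 ▸ D5.exec _ (by decide) (by decide) (by decide)
  have D7 : RoundData A ε T H w s7 := d7 ▸ D6.exec _ (by decide) (by decide) (by decide)
  have D8 : RoundData A ε T H w s8 := d8 ▸ D7.exec _ (by decide) (by decide) (by decide)
  have D9 : RoundData A ε T H w s9 := d9 ▸ D8.exec _ (by decide) (by decide) (by decide)
  have D10 : RoundData A ε T H w s10 := d10 ▸ D9.exec _ (by decide) (by decide) (by decide)
  have hle : ∀ {t : State}, RoundData A ε T H w t → w ≤ t.reg 0 + t.reg 1 := fun D => by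
    rw [D.input.reg0, D.input.reg1]
    exact hw
  have r21 : s1.reg 2 = i := by rw [d1, exec_reg _ _ (by decide), h2]
  have r25 : s5.reg 2 = i := by
    rw [d5, exec_reg _ _ (by decide), d4, exec_reg _ _ (by decide), d3, exec_reg _ _ (by decide),
      d2, exec_reg _ _ (by decide), r21]
  have r26 : s6.reg 2 = i := by rw [d6, exec_reg _ _ (by decide), r25]
  have r27 : s7.reg 2 = i := by rw [d7, exec_reg _ _ (by decide), r26]
  have r210 : s10.reg 2 = i := by
    rw [d10, exec_reg _ _ (by decide), d9, exec_reg _ _ (by decide), d8, exec_reg _ _ (by decide),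
      r27]
  have hprob : ∀ {t : State}, RoundData A ε T H w t → t.arr 18 i 0 0 = q := fun D => by
    rw [hq, ← D.prob]
  have e4 : s1.mat n 4 = masked A T ⟨i, hi⟩ := by rw [d1, mat_loadItem h.input hi h2]
  set X := masked A T ⟨i, hi⟩ with hX
  have e21 : s1.mat n 21 = U := by rw [d1, mat_exec _ _ _ (by decide), h21]
  have e22 : s2.mat n 22 = V := by
    rw [d2, mat_exec _ _ _ (by decide), d1, mat_exec _ _ _ (by decide), h22]
  have e42 : s2.mat n 4 = X := by rw [d2, mat_exec _ _ _ (by decide), e4]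
  have e46 : s6.mat n 4 = X := by
    rw [d6, mat_exec _ _ _ (by decide), d5, mat_exec _ _ _ (by decide), d4,
      mat_exec _ _ _ (by decide), d3, mat_exec _ _ _ (by decide), e42]
  have e47 : s7.mat n 4 = X := by rw [d7, mat_exec _ _ _ (by decide), e46]
  have e23 : s2.mat n 23 = U₀ := by
    rw [d2, mat_setMat (f := fun j k => U₀ j k) D1.input.reg1]
    · rfl
    · intro j k s' hs
      simp only [RExpr.eval, NExpr.eval, hs.row, hs.col, hs.arr 4 (by decide),
        hs.arr 21 (by decide), hs.arr 25 (by decide), hs.arr 0 (by decide), D1.input.eps,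
        D1.upperScale, State.arr_of_mat e4, State.arr_of_mat e21, hU₀, Matrix.sub_apply,
        Matrix.smul_apply, smul_eq_mul, Rat.cast_one, Rat.cast_ofNat]
  have e24 : s3.mat n 24 = V₀ := by
    rw [d3, mat_setMat (f := fun j k => V₀ j k) D2.input.reg1]
    · rfl
    · intro j k s' hs
      simp only [RExpr.eval, NExpr.eval, hs.row, hs.col, hs.arr 4 (by decide),
        hs.arr 22 (by decide), hs.arr 26 (by decide), hs.arr 0 (by decide), D2.input.eps,
        D2.lowerScale, State.arr_of_mat e42, State.arr_of_mat e22, hV₀, Matrix.add_apply,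
        Matrix.smul_apply, smul_eq_mul, Rat.cast_one, Rat.cast_ofNat]
  have e233 : s3.mat n 23 = U₀ := by rw [d3, mat_exec _ _ _ (by decide), e23]
  have e244 : s4.mat n 24 = V₀ := by rw [d4, mat_exec _ _ _ (by decide), e24]
  have e27 : s5.arr 27 0 0 0 = potential H (2 ^ w) U₀ := by
    rw [d5, exec_arr _ _ (by decide), d4,
      scal_potentialMat D3.input.reg1 D3.exponent (hle D3) (by decide) (by decide), D3.genInv, e233]
  have e28 : s5.arr 28 0 0 0 = potential H (2 ^ w) V₀ := by
    rw [d5, scal_potentialMat D4.input.reg1 D4.exponent (hle D4) (by decide) (by decide),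
      D4.genInv, e244]
  have e20 : s5.arr 20 0 0 0 = c := by
    rw [d5, exec_arr _ _ (by decide), d4, exec_arr _ _ (by decide), d3, exec_arr _ _ (by decide),
      d2, exec_arr _ _ (by decide), d1, exec_arr _ _ (by decide), h20]
  have e29 : s6.arr 29 0 0 0 = potential H (2 ^ w) U₀ + potential H (2 ^ w) V₀
      + (∑ i, masked A T i).rank * (c - q) / ∑ j, keepProb H (masked A T j) (2 ^ w) := by
    rw [d6, exec_setScal]
    simp only [RExpr.eval, NExpr.eval, e27, e28, e20, D5.rank, D5.total, r25, hprob D5]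
  have e236 : s6.mat n 23 = U₀ := by
    rw [d6, mat_exec _ _ _ (by decide), d5, mat_exec _ _ _ (by decide), d4,
      mat_exec _ _ _ (by decide), e233]
  have e247 : s7.mat n 24 = V₀ := by
    rw [d7, mat_exec _ _ _ (by decide), d6, mat_exec _ _ _ (by decide), d5,
      mat_exec _ _ _ (by decide), e244]
  have e217 : s7.mat n 21 = U₁ := by
    rw [d7, mat_setMat (f := fun j k => U₁ j k) D6.input.reg1]
    · rfl
    · intro j k s' hs
      simp only [RExpr.eval, NExpr.eval, hs.row, hs.col, hs.arr 4 (by decide),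
        hs.arr 23 (by decide), hs.arr 25 (by decide), hs.arr 18 (by decide),
        hs.reg 2 (by decide) (by decide) (by decide), r26, hprob D6,
        D6.upperScale, State.arr_of_mat e46, State.arr_of_mat e236, hU₁, Matrix.add_apply,
        Matrix.smul_apply, smul_eq_mul, div_eq_mul_inv]
  have e228 : s8.mat n 22 = V₁ := by
    rw [d8, mat_setMat (f := fun j k => V₁ j k) D7.input.reg1]
    · rfl
    · intro j k s' hs
      simp only [RExpr.eval, NExpr.eval, hs.row, hs.col, hs.arr 4 (by decide),
        hs.arr 24 (by decide), hs.arr 26 (by decide), hs.arr 18 (by decide),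
        hs.reg 2 (by decide) (by decide) (by decide), r27, hprob D7,
        D7.lowerScale, State.arr_of_mat e47, State.arr_of_mat e247, hV₁, Matrix.sub_apply,
        Matrix.smul_apply, smul_eq_mul, div_eq_mul_inv]
  have e218 : s8.mat n 21 = U₁ := by rw [d8, mat_exec _ _ _ (by decide), e217]
  have e229 : s9.mat n 22 = V₁ := by rw [d9, mat_exec _ _ _ (by decide), e228]
  have e2710 : s10.arr 27 0 0 0 = potential H (2 ^ w) U₁ := by
    rw [d10, exec_arr _ _ (by decide), d9,
      scal_potentialMat D8.input.reg1 D8.exponent (hle D8) (by decide) (by decide), D8.genInv, e218]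
  have e2810 : s10.arr 28 0 0 0 = potential H (2 ^ w) V₁ := by
    rw [d10, scal_potentialMat D9.input.reg1 D9.exponent (hle D9) (by decide) (by decide),
      D9.genInv, e229]
  have e2010 : s10.arr 20 0 0 0 = c := by
    rw [d10, exec_arr _ _ (by decide), d9, exec_arr _ _ (by decide), d8, exec_arr _ _ (by decide),
      d7, exec_arr _ _ (by decide), d6, exec_arr _ _ (by decide), e20]
  have e30 : s11.arr 30 0 0 0 = potential H (2 ^ w) U₁ + potential H (2 ^ w) V₁
      + (∑ i, masked A T i).rank * (c - q + 1) / ∑ j, keepProb H (masked A T j) (2 ^ w) := by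
    rw [d11, exec_setScal]
    simp only [RExpr.eval, NExpr.eval, e2710, e2810, e2010, D10.rank, D10.total, r210, hprob D10,
      Rat.cast_one]
  simp only [compareProgram, block]
  rw [exec, exec, exec, exec, exec, exec, exec, exec, exec, exec, exec, ← d1, ← d2, ← d3, ← d4,
    ← d5, ← d6, ← d7, ← d8, ← d9, ← d10, ← d11, exec]
  refine ⟨?_, ?_, ?_, ?_, ?_, e30⟩
  · rw [d11, mat_exec _ _ _ (by decide), d10, mat_exec _ _ _ (by decide), d9,
      mat_exec _ _ _ (by decide), e218]
  · rw [d11, mat_exec _ _ _ (by decide), d10, mat_exec _ _ _ (by decide), e229]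
  · rw [d11, mat_exec _ _ _ (by decide), d10, mat_exec _ _ _ (by decide), d9,
      mat_exec _ _ _ (by decide), d8, mat_exec _ _ _ (by decide), d7, mat_exec _ _ _ (by decide),
      e236]
  · rw [d11, mat_exec _ _ _ (by decide), d10, mat_exec _ _ _ (by decide), d9,
      mat_exec _ _ _ (by decide), d8, mat_exec _ _ _ (by decide), e247]
  · rw [d11, exec_arr _ _ (by decide), d10, exec_arr _ _ (by decide), d9, exec_arr _ _ (by decide),
      d8, exec_arr _ _ (by decide), d7, exec_arr _ _ (by decide), e29]

theorem roundProgram_spec (hε0 : 0 < ε) (hε1 : ε < 1) (hA : ∀ i, (A i).PosSemidef)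
    {H : Matrix (Fin n) (Fin n) ℝ} (hH : IsGenInv (∑ i, masked A T i) H) {w : ℕ} (hw : w ≤ r + n)
    (hw0 : w ≠ 0) (hκ : 3 * ((∑ i, masked A T i).rank : ℝ) ≤ (1 + ε ^ 2 / 32) ^ 2 ^ w)
    (h : RoundData A ε T H w s)
    (h0 : RoundInv (masked A T) H (2 ^ w) ε 0 (fun j => s.arr 3 j 0 0) (s.mat n 21) (s.mat n 22)
      (s.arr 20 0 0 0)) :
    ∃ U V c, RoundInv (masked A T) H (2 ^ w) ε r (fun j => (roundProgram.exec s).arr 3 j 0 0)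
      U V c := by
  obtain ⟨k, hk⟩ : ∃ k, 2 ^ w = k + 1 := ⟨2 ^ w - 1, by have := Nat.one_le_two_pow (n := w); omega⟩
  have heven : Even (k + 1) := hk ▸ (Nat.even_pow.2 ⟨even_two, hw0⟩)
  let I : ℕ → State → Prop := fun i s' => RoundData A ε T H w s' ∧
    RoundInv (masked A T) H (2 ^ w) ε i (fun j => s'.arr 3 j 0 0) (s'.mat n 21) (s'.mat n 22)
      (s'.arr 20 0 0 0)
  have key : I r (roundProgram.exec s) := by
    refine exec_loop_induction (I := I) h.input.reg0 ⟨h, h0⟩ ?_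
    rintro i hi s0 ⟨hD, hR⟩
    obtain ⟨s1, d1⟩ : ∃ t, t = s0.putReg 2 i := ⟨_, rfl⟩
    obtain ⟨s2, d2⟩ : ∃ t, t = compareProgram.exec s1 := ⟨_, rfl⟩
    have D1 : RoundData A ε T H w s1 := d1 ▸ hD.putReg i
    have D2 : RoundData A ε T H w s2 := d2 ▸ D1.exec _ (by decide) (by decide) (by decide)
    have r2 : s1.reg 2 = i := by rw [d1, State.putReg_reg, if_pos rfl]
    have r22 : s2.reg 2 = i := by rw [d2, exec_reg _ _ (by decide), r2]
    obtain ⟨e21, e22, e23, e24, e29, e30⟩ := compareProgram_spec D1 hw hi r2 rfl rfl rfl rfl rfl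
      rfl rfl rfl
    rw [← d2] at e21 e22 e23 e24 e29 e30
    have a1 : s1.arr = s0.arr := by rw [d1]; rfl
    have b21 : s1.mat n 21 = s0.mat n 21 := by rw [d1]; rfl
    have b22 : s1.mat n 22 = s0.mat n 22 := by rw [d1]; rfl
    have e3 : s2.arr 3 = s0.arr 3 := by rw [d2, exec_arr _ _ (by decide), a1]
    have e20 : s2.arr 20 = s0.arr 20 := by rw [d2, exec_arr _ _ (by decide), a1]
    have e18 : s2.arr 18 i 0 0 = keepProb H (masked A T ⟨i, hi⟩) (2 ^ w) := D2.prob ⟨i, hi⟩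
    rw [b21] at e21 e23 e29 e30
    rw [b22] at e22 e24 e29 e30
    rw [a1] at e29 e30
    refine ⟨?_, ?_⟩
    · simp only [block]
      rw [exec, exec, exec, ← d1, ← d2]
      exact D2.exec _ (by decide) (by decide) (by decide)
    · simp only [block]
      rw [exec, exec, exec, ← d1, ← d2]
      rw [hk] at hR e18 e29 e30 e21 e22 hκ ⊢
      have hiff : Test.Holds s2 (.realLE (.scal 30) (.scal 29)) ↔
          s2.arr 30 0 0 0 ≤ s2.arr 29 0 0 0 := by simp [Test.Holds, RExpr.eval, NExpr.eval]
      have hstep := fun μ' hμ' => RoundInv.step hε0 hε1 (masked_nonneg hA T) hH heven hκ hi hR rfl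
        rfl rfl (μ' := μ') hμ' rfl rfl rfl rfl
      by_cases hif : s2.arr 30 0 0 0 ≤ s2.arr 29 0 0 0
      · rw [chooseProgram, exec, if_pos (hiff.2 hif)]
        simp only [block]
        rw [e29, e30] at hif
        have := (hstep (fun j => if j = i then (keepProb H (masked A T ⟨i, hi⟩) (k + 1))⁻¹ else
          s0.arr 3 j 0 0) (fun j hj => by rw [if_neg hj.ne])).1 hif (by simp)
        convert this using 1
        · funext j
          by_cases hj : j = i <;>
            simp [exec, State.putArr, NExpr.eval, RExpr.eval, r22, e18, e3, hj]
        · rw [exec, exec, exec, mat_exec _ _ _ (by decide), mat_exec _ _ _ (by decide), e21]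
        · rw [exec, exec, exec, mat_exec _ _ _ (by decide), mat_exec _ _ _ (by decide), e22]
        · simp [exec, State.putArr, NExpr.eval, RExpr.eval, r22, e18, e20]
      · rw [chooseProgram, exec, if_neg (fun hh => hif (hiff.1 hh))]
        simp only [block]
        rw [e29, e30] at hif
        have := (hstep (fun j => if j = i then 0 else
          s0.arr 3 j 0 0) (fun j hj => by rw [if_neg hj.ne])).2 hif (by simp)
        convert this using 1
        · funext j
          rw [exec, exec, exec, exec, exec, exec_arr _ _ (by decide)]
          have h3 : ((copyMat 22 24).exec ((copyMat 21 23).exec s2)).arr 3 = s0.arr 3 := by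
            rw [exec_arr _ _ (by decide), exec_arr _ _ (by decide), e3]
          have h2 : ((copyMat 22 24).exec ((copyMat 21 23).exec s2)).reg 2 = i := by
            rw [exec_reg _ _ (by decide), exec_reg _ _ (by decide), r22]
          by_cases hj : j = i <;>
            simp [exec, State.putArr, NExpr.eval, RExpr.eval, h2, h3, hj]
        · rw [exec, exec, exec, exec, exec, mat_exec _ _ _ (by decide), mat_exec _ _ _ (by decide),
            mat_exec _ _ _ (by decide), mat_copyMat D2.input.reg1, e23]
        · rw [exec, exec, exec, exec, exec, mat_exec _ _ _ (by decide), mat_exec _ _ _ (by decide),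
            mat_copyMat (by rw [exec_reg _ _ (by decide), D2.input.reg1]),
            mat_exec _ _ _ (by decide), e24]
        · rw [exec, exec, exec, exec, exec, exec_setScal]
          have h20 : ((copyMat 22 24).exec ((copyMat 21 23).exec s2)).arr 20 = s0.arr 20 := by
            rw [exec_arr _ _ (by decide), exec_arr _ _ (by decide), e20]
          have h18 : ((copyMat 22 24).exec ((copyMat 21 23).exec s2)).arr 18 = s2.arr 18 := by
            rw [exec_arr _ _ (by decide), exec_arr _ _ (by decide)]
          have h2 : ((copyMat 22 24).exec ((copyMat 21 23).exec s2)).reg 2 = i := by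
            rw [exec_reg _ _ (by decide), exec_reg _ _ (by decide), r22]
          simp [exec, State.putArr, NExpr.eval, RExpr.eval, h2, h18, h20, e18]
  exact ⟨_, _, _, key.2⟩

end SparsificationCorrect

/-! ### Correctness and running time of the whole algorithm. -/

section SparsificationAlgorithm

open Program

variable {r n : ℕ} {A : Fin r → Matrix (Fin n) (Fin n) ℝ} {ε : ℝ} {T : Finset (Fin r)} {s : State}

theorem initProgram_spec (h : HasInput A ε T s) :
    (initProgram.exec s).mat n 21 = s.mat n 5 ∧ (initProgram.exec s).mat n 22 = s.mat n 5 ∧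
    (initProgram.exec s).arr 20 0 0 0 = s.arr 19 0 0 0 ∧
    (initProgram.exec s).arr 25 0 0 0 = (8 / ε + (1 + ε / 4))⁻¹ ∧
    (initProgram.exec s).arr 26 0 0 0 = (8 / ε - (1 - ε / 4))⁻¹ := by
  simp only [initProgram, block]
  rw [exec, exec, exec, exec, exec, exec]
  have h1 := h.exec (setScal 20 (.scal 19)) (by decide)
  have h2 := h1.exec (copyMat 21 5) (by decide)
  have h3 := h2.exec (copyMat 22 5) (by decide)
  set s3 := (copyMat 22 5).exec ((copyMat 21 5).exec ((setScal 20 (.scal 19)).exec s)) with hs3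
  have h4 := h3.exec (setScal 25 (.div (.const 1) (.add (.div (.const 8) (.scal 0))
      (.add (.const 1) (.div (.scal 0) (.const 4)))))) (by decide)
  refine ⟨?_, ?_, ?_, ?_, ?_⟩
  · rw [mat_exec _ _ _ (by decide), mat_exec _ _ _ (by decide), mat_exec _ _ _ (by decide),
      mat_copyMat h1.reg1, mat_exec _ _ _ (by decide)]
  · rw [mat_exec _ _ _ (by decide), mat_exec _ _ _ (by decide), mat_copyMat h2.reg1,
      mat_exec _ _ _ (by decide), mat_exec _ _ _ (by decide)]
  · rw [exec_arr _ _ (by decide), exec_arr _ _ (by decide), exec_arr _ _ (by decide),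
      exec_arr _ _ (by decide), exec_setScal]
    rfl
  · rw [exec_arr _ _ (by decide), exec_setScal]
    simp only [RExpr.eval, NExpr.eval, h3.eps, Rat.cast_one, Rat.cast_ofNat, one_div]
  · rw [exec_setScal]
    simp only [RExpr.eval, NExpr.eval, h4.eps, Rat.cast_one, Rat.cast_ofNat, one_div]

/-- The sparsification algorithm is correct. -/
theorem goodWeights_sparsify (hA : ∀ i, (A i).PosSemidef) (hT : ∃ i ∈ T, A i ≠ 0) (hε0 : 0 ≤ ε)
    (hε1 : ε < 1) :
    GoodWeights sizeConstant A ε T (outputWeights T (sparsify.exec (inputState A ε T))) := by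
  obtain ⟨s0, d0⟩ : ∃ t, t = inputState A ε T := ⟨_, rfl⟩
  obtain ⟨s1, d1⟩ : ∃ t, t = sumProgram.exec s0 := ⟨_, rfl⟩
  obtain ⟨s2, d2⟩ : ∃ t, t = identityProgram.exec s1 := ⟨_, rfl⟩
  obtain ⟨s3, d3⟩ : ∃ t, t = genInvProgram.exec s2 := ⟨_, rfl⟩
  obtain ⟨s4, d4⟩ : ∃ t, t = rankProgram.exec s3 := ⟨_, rfl⟩
  obtain ⟨s5, d5⟩ : ∃ t, t = exponentProgram.exec s4 := ⟨_, rfl⟩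
  have i0 : HasInput A ε T s0 := d0 ▸ hasInput_inputState
  have i1 : HasInput A ε T s1 := d1 ▸ i0.exec _ (by decide)
  have i2 : HasInput A ε T s2 := d2 ▸ i1.exec _ (by decide)
  have i3 : HasInput A ε T s3 := d3 ▸ i2.exec _ (by decide)
  have i4 : HasInput A ε T s4 := d4 ▸ i3.exec _ (by decide)
  have i5 : HasInput A ε T s5 := d5 ▸ i4.exec _ (by decide)
  have hA' := masked_nonneg hA T
  set M := ∑ i, masked A T i with hM
  have hM0 : 0 ≤ M := Finset.sum_nonneg fun i _ => hA' i
  have z5 : s0.mat n 5 = 0 := by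
    ext j k
    simp [State.mat, d0, inputState]
  have z7 : s0.mat n 7 = 0 := by
    ext j k
    simp [State.mat, d0, inputState]
  have z19 : s0.arr 19 0 0 0 = 0 := by simp [d0, inputState]
  have e5 : s1.mat n 5 = M := by rw [d1, mat_sumProgram i0 z5]
  have e52 : s2.mat n 5 = M := by rw [d2, mat_exec _ _ _ (by decide), e5]
  have e53 : s3.mat n 5 = M := by rw [d3, mat_exec _ _ _ (by decide), e52]
  have e6 : s2.mat n 6 = 1 := by rw [d2, mat_identityProgram i1.reg1]
  have e7 : s2.mat n 7 = 0 := by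
    rw [d2, mat_exec _ _ _ (by decide), d1, mat_exec _ _ _ (by decide), z7]
  have hH : IsGenInv M (s3.mat n 7) := d3 ▸ mat_genInvProgram hM0 i2.reg1 e52 e6 e7
  set H := s3.mat n 7 with hHdef
  have e11 : s4.arr 11 0 0 0 = M.rank := by rw [d4, scal_rankProgram hM0 i3.reg1 e53 hH]
  obtain ⟨w, hw, h4, h12, h13, hlt, hle⟩ := exponentProgram_spec i4 e11
  rw [← d5] at h4 h12 h13
  have e115 : s5.arr 11 0 0 0 = M.rank := by rw [d5, exec_arr _ _ (by decide), e11]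
  have hiff : Test.Holds s5 (.realLE (.mul (.const 3) (.scal 11)) (.scal 12)) ↔
      3 * (M.rank : ℝ) ≤ (1 + ε ^ 2 / 32) ^ 2 ^ w := by
    simp [Test.Holds, RExpr.eval, NExpr.eval, e115, h12]
  have hm : (1 : ℝ) ≤ M.rank := by
    exact_mod_cast Nat.one_le_iff_ne_zero.2 fun h0 =>
      sum_masked_ne_zero hA hT (eq_zero_of_rank_eq_zero h0)
  simp only [sparsify, block]
  rw [exec, exec, exec, exec, exec, exec, exec, ← d0, ← d1, ← d2, ← d3, ← d4, ← d5]
  by_cases hκ : 3 * (M.rank : ℝ) ≤ (1 + ε ^ 2 / 32) ^ 2 ^ w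
  · rw [exec, if_pos (hiff.2 hκ)]
    obtain ⟨s6, d6⟩ : ∃ t, t = probProgram.exec s5 := ⟨_, rfl⟩
    obtain ⟨s7, d7⟩ : ∃ t, t = initProgram.exec s6 := ⟨_, rfl⟩
    have i6 : HasInput A ε T s6 := d6 ▸ i5.exec _ (by decide)
    have i7 : HasInput A ε T s7 := d7 ▸ i6.exec _ (by decide)
    -- For ε = 0 the test would read 3m ≤ 1, contradicting m ≥ 1.
    have hεpos : 0 < ε := by
      rcases hε0.eq_or_lt with rfl | h
      · norm_num at hκ
        linarith
      · exact h
    -- Already the first power is less than 2, hence less than 3m, so at least one squaring takes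
    -- place; this makes the exponent even and gives it a half.
    have hw0 : w ≠ 0 := by
      rintro rfl
      norm_num at hκ
      nlinarith
    have e75 : s5.mat n 7 = H := by
      rw [d5, mat_exec _ _ _ (by decide), d4, mat_exec _ _ _ (by decide)]
    have e195 : s5.arr 19 0 0 0 = 0 := by
      rw [d5, exec_arr _ _ (by decide), d4, exec_arr _ _ (by decide), d3, exec_arr _ _ (by decide),
        d2, exec_arr _ _ (by decide), d1, exec_arr _ _ (by decide), z19]
    have e56 : s6.mat n 5 = M := by
      rw [d6, mat_exec _ _ _ (by decide), d5, mat_exec _ _ _ (by decide), d4,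
        mat_exec _ _ _ (by decide), e53]
    obtain ⟨h18, h19⟩ := probProgram_spec i5 e75 hw h4 h13 e195
    rw [← d6] at h18 h19
    obtain ⟨h21, h22, h20, h25, h26⟩ := initProgram_spec i6
    rw [← d7] at h21 h22 h20 h25 h26
    have D7 : RoundData A ε T H w s7 := by
      refine ⟨i7, ?_, ?_, ?_, ?_, ?_, h25, h26⟩
      · rw [d7, mat_exec _ _ _ (by decide), d6, mat_exec _ _ _ (by decide), e75]
      · rw [d7, exec_reg _ _ (by decide), d6, exec_reg _ _ (by decide), h4]
      · rw [d7, exec_arr _ _ (by decide), d6, exec_arr _ _ (by decide), e115]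
      · rw [d7, exec_arr _ _ (by decide)]; exact h18
      · rw [d7, exec_arr _ _ (by decide), h19]
    obtain ⟨k, hk⟩ : ∃ k, 2 ^ w = k + 1 :=
      ⟨2 ^ w - 1, by have := Nat.one_le_two_pow (n := w); omega⟩
    have hR : RoundInv (masked A T) H (2 ^ w) ε 0 (fun j => s7.arr 3 j 0 0) (s7.mat n 21)
        (s7.mat n 22) (s7.arr 20 0 0 0) := by
      rw [h21, h22, h20, h19, e56, hk]
      exact RoundInv.zero hεpos hε1 hH hA' _
    obtain ⟨U, V, c, hfin⟩ := roundProgram_spec hεpos hε1 hA hH hw hw0 hκ D7 hR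
    rw [exec, exec, exec, exec, ← d6, ← d7]
    refine goodWeights_of_roundInv hA hT hεpos hε1 hH (h := 2 ^ (w - 1)) ?_ (by positivity) hκ
      (hlt.resolve_left hw0) hfin
    rw [← pow_succ', Nat.sub_add_cancel (Nat.one_le_iff_ne_zero.2 hw0)]
  · rw [exec, if_neg fun h => hκ (hiff.1 h)]
    obtain rfl := hle.resolve_left hκ
    have : outputWeights T (trivialProgram.exec s5) = fun _ => 1 := by
      funext i
      exact trivialProgram_spec i5 i
    rw [this]
    exact goodWeights_one hA hT hε0 (lt_of_not_ge hκ)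

/-- Since r + n ≥ 1, the shift r + n + 1 is at most 2(r + n), and the factor 2^d goes into the
coefficient. -/
theorem exists_sparsify_run_eq : ∃ d : ℕ, ∀ (r n : ℕ) (A : Fin r → Matrix (Fin n) (Fin n) ℝ) (ε : ℝ)
    (T : Finset (Fin r)), 1 ≤ r + n → ∃ k ≤ d * (r + n) ^ d,
      sparsify.run (inputState A ε T) = PMF.pure ((sparsify.exec (inputState A ε T)).tick k) := by
  obtain ⟨d, hd⟩ := sparsify_simple.run_eq
  refine ⟨d * 2 ^ d + d, fun r n A ε T hrn => ?_⟩
  obtain ⟨k, hk, e⟩ := hd (inputState A ε T)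
  refine ⟨k, hk.trans ?_, e⟩
  have h1 : d * (r + n + 1) ^ d ≤ d * (2 * (r + n)) ^ d := by gcongr; omega
  refine h1.trans ?_
  rw [mul_pow, ← mul_assoc]
  exact Nat.mul_le_mul (Nat.le_add_right _ _) (Nat.pow_le_pow_right hrn (Nat.le_add_left _ _))

theorem Program.exec_steps (c : Program) (s : State) : (c.exec s).steps = s.steps := by
  induction c generalizing s with
  | skip => rfl
  | seq c d hc hd => simp only [exec, hd, hc]
  | setReg x e => rfl
  | setArr a i j l e => rfl
  | flip x => rfl
  | ite t c d hc hd =>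
    simp only [exec]
    split_ifs
    exacts [hc _, hd _]
  | loop x e c hc =>
    simp only [exec]
    induction e.eval s with
    | zero => rfl
    | succ m ih => exact (hc _).trans ih

end SparsificationAlgorithm

end RealRAM

end PSDSparsification

theorem mainTheorem1 :
    ∃ C : ℝ, 0 < C ∧
      (∀ (r n : ℕ) (A : Fin r → Matrix (Fin n) (Fin n) ℝ), (∀ i, (A i).PosSemidef) →
        ∀ ε : ℝ, 0 ≤ ε → ε < 1 →
        ∀ T : Finset (Fin r), (∃ i ∈ T, A i ≠ 0) →
          PSDSparsification.localBound A T ≤ PSDSparsification.globalBound A ∧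
          ∃ μ : T → ℝ, PSDSparsification.GoodWeights C A ε T μ) ∧
      ∃ (P : PSDSparsification.RealRAM.Program) (d : ℕ),
        ∀ (r n : ℕ) (A : Fin r → Matrix (Fin n) (Fin n) ℝ), (∀ i, (A i).PosSemidef) →
        ∀ ε : ℝ, 0 ≤ ε → ε < 1 →
        ∀ T : Finset (Fin r), (∃ i ∈ T, A i ≠ 0) →
          (∀ s ∈ (P.run (PSDSparsification.inputState A ε T)).support,
            s.steps ≤ d * (r + n) ^ d) ∧
          ENNReal.ofReal (1 - 1 / ((n : ℝ) + 2)) ≤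
            (P.run (PSDSparsification.inputState A ε T)).toOuterMeasure
              {s | PSDSparsification.GoodWeights C A ε T
                (PSDSparsification.outputWeights T s)} := by
  obtain ⟨d, hd⟩ := PSDSparsification.RealRAM.exists_sparsify_run_eq
  refine ⟨PSDSparsification.sizeConstant, PSDSparsification.sizeConstant_pos, ?_,
    PSDSparsification.RealRAM.sparsify, d, ?_⟩
  · intro r n A hA ε hε0 hε1 T hT
    exact ⟨PSDSparsification.localBound_le_globalBound A hA hT, _,
      PSDSparsification.RealRAM.goodWeights_sparsify hA hT hε0 hε1⟩
  · intro r n A hA ε hε0 hε1 T hT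
    obtain ⟨i, -, -⟩ := id hT
    obtain ⟨k, hk, e⟩ := hd r n A ε T (by have := i.pos; omega)
    -- The run is a point mass, so both the time bound and the event concern a single state, and the
    -- probability is one.
    rw [e]
    refine ⟨fun s hs => ?_, ?_⟩
    · rw [PMF.support_pure, Set.mem_singleton_iff] at hs
      rw [hs, PSDSparsification.RealRAM.State.tick, PSDSparsification.RealRAM.Program.exec_steps]
      simpa [PSDSparsification.inputState] using hk
    · have hgood := PSDSparsification.RealRAM.goodWeights_sparsify hA hT hε0 hε1
      rw [PMF.toOuterMeasure_pure_apply, if_pos (by exact hgood), ENNReal.ofReal_le_one,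
        sub_le_self_iff]
      positivity
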